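/- Let $k$ be an algebraically closed field of characteristic $0$, let $X$ be a smooth projective rational surface over $k$, and let $G$ be a finite group with a generically free regular action on $X$ over $k$. Let $\beta\in \mathrm{H}^2(G,k^\times)$ (trivial action on $k^\times$), let $b$ be its image in $\mathrm{Br}([X/G])=\mathrm{H}^2([X/G],\mathbb{G}_m)$ under the edge map of the Hochschild--Serre spectral sequence of the $G$-torsor $X\to[X/G]$, and let $\alpha\in\mathrm{Br}(k(X)^G)$ be the restriction of $b$ to the generic point $\mathrm{Spec}\,k(X)^G$ of $[X/G]$. Let $\xi\in X$ be a point of codimension $1$ with residue field $k(\xi)$. Let $D_\xi\subset G$ be its stabilizer and $I_\xi\subset D_\xi$ the subgroup of elements acting trivially on $k(\xi)$. The local ring $\mathcal{O}_{X,\xi}\subset k(X)$ meets the fields $k(X)^G$, $k(X)^{D_\xi}$ and $k(X)^{I_\xi}$ in discrete valuation rings; in the first two cases reduction identifies the residue field with $k(\xi)^{D_\xi}$, so that there are classical residue maps $$\mathrm{Br}(k(X)^G)\to \mathrm{H}^1(k(\xi)^{D_\xi},\mathbb{Q}/\mathbb{Z}),\qquad \mathrm{Br}(k(X)^{D_\xi})\to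 \mathrm{H}^1(k(\xi)^{D_\xi},\mathbb{Q}/\mathbb{Z}).$$ (For a field $F$ with a discrete valuation and residue field $\kappa$ of characteristic $0$, the residue map is the composite of $\mathrm{Br}(F)\to\mathrm{Br}(F^h)\cong \mathrm{H}^2(\mathrm{Gal}(F^{sh}/F^h),(F^{sh})^\times)$, of the map to $\mathrm{H}^2(\mathrm{Gal}(F^{sh}/F^h),\mathbb{Z})=\mathrm{H}^2(\kappa,\mathbb{Z})$ given by the normalized valuation, and of the inverse of the connecting isomorphism $\mathrm{H}^1(\kappa,\mathbb{Q}/\mathbb{Z})\cong\mathrm{H}^2(\kappa,\mathbb{Z})$, where $F^h$ and $F^{sh}$ denote the henselization and the strict henselization.) Then: (i) The residue of $\alpha$ in $\mathrm{H}^1(k(\xi)^{D_\xi},\mathbb{Q}/\mathbb{Z})$ is equal to the residue in $\mathrm{H}^1(k(\xi)^{D_\xi},\mathbb{Q}/\mathbb{Z})$ of the restriction of $\alpha$ to $\mathrm{Br}(k(X)^{D_\xi})$. (ii) The restriction of $\alpha$ to $\mathrm{Br}(k(X)^{D_\xi})$ lies in the image of the inflation map $$\mathrm{inf}_\xi\colon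 \mathrm{H}^2(D_\xi/I_\xi,(k(X)^{I_\xi})^\times)\to \mathrm{H}^2(D_\xi,k(X)^\times),$$ where $\mathrm{H}^2(D_\xi,k(X)^\times)$ is regarded as a subgroup of $\mathrm{Br}(k(X)^{D_\xi})$. (iii) Let $\gamma\in\mathrm{H}^2(D_\xi/I_\xi,(k(X)^{I_\xi})^\times)$ be a lift under $\mathrm{inf}_\xi$, as in (ii), of the restriction of $\alpha$ to $\mathrm{Br}(k(X)^{D_\xi})$. Then the image of the residue of $\alpha$ under the connecting isomorphism $\mathrm{H}^1(k(\xi)^{D_\xi},\mathbb{Q}/\mathbb{Z})\cong \mathrm{H}^2(k(\xi)^{D_\xi},\mathbb{Z})$ is the image of $\gamma$ under the composite $$\mathrm{H}^2(D_\xi/I_\xi,(k(X)^{I_\xi})^\times)\to\mathrm{H}^2(D_\xi/I_\xi,\mathbb{Z})\to\mathrm{H}^2(k(\xi)^{D_\xi},\mathbb{Z})$$ of the map induced by the normalized valuation of $k(X)^{I_\xi}$ and the inflation map, where $D_\xi/I_\xi$ is a quotient of the absolute Galois group of $k(\xi)^{D_\xi}$ by the action of $D_\xi$ on $k(\xi)$.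 -/

import Mathlib

universe u

namespace BrauerResidue

noncomputable section Cohomology

open TopologicalSpace

variable {Γ Γ' Γ'' M M' : Type*} [Group Γ] [TopologicalSpace Γ] [Group Γ'] [TopologicalSpace Γ']
  [AddCommGroup M] [AddCommGroup M']

/-- Continuous inhomogeneous 2-cocycles of `Γ` in the discrete `Γ`-module `(M, ρ)`. -/
def Z2 (ρ : Γ →* AddMonoid.End M) : AddSubgroup (Γ × Γ → M) where
  carrier := {f | IsLocallyConstant f ∧
    ∀ g h j, ρ g (f (h, j)) + f (g, h * j) = f (g * h, j) + f (g, h)}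
  zero_mem' := ⟨IsLocallyConstant.const 0, by simp⟩
  add_mem' := by
    rintro a b ⟨ha, ha'⟩ ⟨hb, hb'⟩
    refine ⟨ha.add hb, fun g h j => ?_⟩
    have h1 := ha' g h j
    have h2 := hb' g h j
    simp only [Pi.add_apply, map_add]
    calc _ = (ρ g (a (h, j)) + a (g, h * j)) + (ρ g (b (h, j)) + b (g, h * j)) := by abel
      _ = _ := by rw [h1, h2]; abel
  neg_mem' := by
    rintro a ⟨ha, ha'⟩
    refine ⟨ha.neg, fun g h j => ?_⟩
    have h1 := ha' g h j
    simp only [Pi.neg_apply, map_neg]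
    rw [← neg_add, h1, neg_add]

/-- The coboundary of a 1-cochain. -/
def d1 (ρ : Γ →* AddMonoid.End M) (c : Γ → M) : Γ × Γ → M :=
  fun p => ρ p.1 (c p.2) - c (p.1 * p.2) + c p.1

/-- Coboundaries of continuous 1-cochains. -/
def B2 (ρ : Γ →* AddMonoid.End M) : AddSubgroup (Γ × Γ → M) where
  carrier := {f | ∃ c : Γ → M, IsLocallyConstant c ∧ f = d1 ρ c}
  zero_mem' := ⟨0, IsLocallyConstant.const 0, by ext; simp [d1]⟩
  add_mem' := by
    rintro _ _ ⟨a, ha, rfl⟩ ⟨b, hb, rfl⟩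
    refine ⟨a + b, ha.add hb, ?_⟩
    ext p
    simp only [d1, Pi.add_apply, map_add]
    abel
  neg_mem' := by
    rintro _ ⟨a, ha, rfl⟩
    refine ⟨-a, ha.neg, ?_⟩
    ext p
    simp only [d1, Pi.neg_apply, map_neg]
    abel

/-- Continuous cohomology `H²(Γ, M)` of a topological group with coefficients in a discrete
module.  For `Γ` discrete this is ordinary group cohomology, for `Γ` an absolute Galois group it
is Galois cohomology. -/
def H2 (ρ : Γ →* AddMonoid.End M) : Type _ := Z2 ρ ⧸ (B2 ρ).addSubgroupOf (Z2 ρ)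

instance (ρ : Γ →* AddMonoid.End M) : AddCommGroup (H2 ρ) :=
  inferInstanceAs (AddCommGroup (Z2 ρ ⧸ (B2 ρ).addSubgroupOf (Z2 ρ)))

/-- The class of a cocycle. -/
def H2.mk (ρ : Γ →* AddMonoid.End M) : Z2 ρ →+ H2 ρ :=
  QuotientAddGroup.mk' ((B2 ρ).addSubgroupOf (Z2 ρ))

/-- Pull-back of cocycles along a homomorphism of groups and a compatible homomorphism of
modules. -/
def Z2.map {ρ : Γ →* AddMonoid.End M} {ρ' : Γ' →* AddMonoid.End M'} (φ : Γ' →ₜ* Γ) (m : M →+ M')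
    (hm : ∀ g x, m (ρ (φ g) x) = ρ' g (m x)) : Z2 ρ →+ Z2 ρ' where
  toFun f := ⟨fun p => m (f.1 (φ p.1, φ p.2)),
    (f.2.1.comp_continuous (φ.continuous_toFun.prodMap φ.continuous_toFun)).comp m, fun g h j => by
      have h1 := congrArg m (f.2.2 (φ g) (φ h) (φ j))
      simpa [hm] using h1⟩
  map_zero' := by ext; simp
  map_add' a b := by ext; simp

/-- The map on `H²` induced by a homomorphism of groups and a compatible homomorphism of modules.
Restrictions, inflations and changes of coefficients are instances of it. -/
def H2.map {ρ : Γ →* AddMonoid.End M} {ρ' : Γ' →* AddMonoid.End M'} (φ : Γ' →ₜ* Γ) (m : M →+ M')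
    (hm : ∀ g x, m (ρ (φ g) x) = ρ' g (m x)) : H2 ρ →+ H2 ρ' :=
  QuotientAddGroup.map _ _ (Z2.map φ m hm) (by
    rintro ⟨f, hf⟩ ⟨c, hc, hc'⟩
    refine ⟨fun g => m (c (φ g)), (hc.comp_continuous φ.continuous_toFun).comp m, ?_⟩
    ext p
    have : f = d1 ρ c := hc'
    subst this
    simp [Z2.map, d1, hm])

/-- The module of units of a ring on which `Γ` acts. -/
def unitsRep (Γ E : Type*) [Group Γ] [CommRing E] [MulSemiringAction Γ E] :
    Γ →* AddMonoid.End (Additive Eˣ) where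
  toFun g := (Units.map (MulSemiringAction.toRingHom Γ E g : E →* E)).toAdditive
  map_one' := by
    refine AddMonoidHom.ext fun x => Additive.toMul.injective (Units.ext ?_)
    exact one_smul Γ (x.toMul : E)
  map_mul' g h := by
    refine AddMonoidHom.ext fun x => Additive.toMul.injective (Units.ext ?_)
    exact mul_smul g h (x.toMul : E)

/-- The trivial `Γ`-module. -/
abbrev trivRep (Γ M : Type*) [Group Γ] [AddCommGroup M] : Γ →* AddMonoid.End M := 1

/-- `H¹(Γ, ℚ/ℤ)`, i.e. continuous characters with values in the discrete group `ℚ/ℤ`. -/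
def H1QZ (Γ : Type*) [Group Γ] [TopologicalSpace Γ] : Type _ :=
  {χ : Γ →* Multiplicative (AddCircle (1 : ℚ)) // IsLocallyConstant χ}

/-- The representative in `[0, 1)` of a value of a character. -/
def H1QZ.lift (χ : H1QZ Γ) (g : Γ) : ℚ :=
  haveI : Fact ((0 : ℚ) < 1) := ⟨one_pos⟩
  (AddCircle.equivIco (1 : ℚ) 0 (χ.1 g).toAdd : ℚ)

lemma H1QZ.coe_lift (χ : H1QZ Γ) (g : Γ) :
    ((χ.lift g : ℚ) : AddCircle (1 : ℚ)) = (χ.1 g).toAdd := by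
  have : Fact ((0 : ℚ) < 1) := ⟨one_pos⟩
  exact (AddCircle.equivIco (1 : ℚ) 0).symm_apply_apply _

lemma H1QZ.lift_add (χ : H1QZ Γ) (g h : Γ) :
    ((⌊χ.lift g + χ.lift h⌋ : ℤ) : ℚ) = χ.lift g + χ.lift h - χ.lift (g * h) := by
  have : Fact ((0 : ℚ) < 1) := ⟨one_pos⟩
  have h1 : ((χ.lift g + χ.lift h - χ.lift (g * h) : ℚ) : AddCircle (1 : ℚ)) = 0 := by
    rw [AddCircle.coe_sub, AddCircle.coe_add, coe_lift, coe_lift, coe_lift, map_mul, toAdd_mul,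
      sub_self]
  obtain ⟨n, hn⟩ := (AddCircle.coe_eq_zero_iff (1 : ℚ)).1 h1
  have hl := (AddCircle.equivIco (1 : ℚ) 0 (χ.1 (g * h)).toAdd).2
  change χ.lift (g * h) ∈ _ at hl
  rw [zsmul_eq_mul, mul_one] at hn
  have : ⌊χ.lift g + χ.lift h⌋ = n := by
    rw [Int.floor_eq_iff]
    constructor <;> linarith [hl.1, hl.2]
  rw [this, hn]

/-- The connecting homomorphism `H¹(Γ, ℚ/ℤ) → H²(Γ, ℤ)` of `0 → ℤ → ℚ → ℚ/ℤ → 0` (for profinite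
`Γ` it is bijective): `χ` is lifted to a `ℚ`-valued cochain `ℓ`, and the class of
`(g, h) ↦ ℓ(g) + ℓ(h) - ℓ(gh)` is taken; see `H1QZ.lift_add`. -/
def bockstein (χ : H1QZ Γ) : H2 (trivRep Γ ℤ) :=
  H2.mk _ ⟨fun p => ⌊χ.lift p.1 + χ.lift p.2⌋, by
    have hχ : IsLocallyConstant χ.lift := χ.2.comp fun a : Multiplicative (AddCircle (1 : ℚ)) =>
      haveI : Fact ((0 : ℚ) < 1) := ⟨one_pos⟩
      (AddCircle.equivIco (1 : ℚ) 0 a.toAdd : ℚ)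
    exact ((hχ.comp_continuous continuous_fst).add (hχ.comp_continuous continuous_snd)).comp
      (Int.floor : ℚ → ℤ), fun g h j => by
      have e : ∀ x : ℤ, trivRep Γ ℤ g x = x := fun x => rfl
      rw [e]
      have : ∀ a b c d : ℤ, (a : ℚ) + b = c + d → a + b = c + d := fun a b c d h => by
        exact_mod_cast h
      apply this
      simp only [H1QZ.lift_add, mul_assoc]
      ring⟩

end Cohomology

noncomputable section Valuations

variable {Γ E : Type*} [Group Γ] [Field E] [MulSemiringAction Γ E]

/-- `v` is the normalized discrete valuation with valuation ring `O`. -/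
def IsNormVal (O : Subring E) (v : Additive Eˣ →+ ℤ) : Prop :=
  Function.Surjective v ∧ ∀ x : Eˣ, (x : E) ∈ O ↔ 0 ≤ v (Additive.ofMul x)

lemma IsNormVal.unique {O : Subring E} {v w : Additive Eˣ →+ ℤ} (hv : IsNormVal O v)
    (hw : IsNormVal O w) : v = w := by
  have key : ∀ x, 0 ≤ v x ↔ 0 ≤ w x := fun x => (hv.2 x.toMul).symm.trans (hw.2 x.toMul)
  have ker : ∀ x, v x = 0 → w x = 0 := fun x hx => by
    have h1 := (key x).1 hx.ge
    have h2 := (key (-x)).1 (by simp [hx])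
    rw [map_neg] at h2
    omega
  obtain ⟨t, ht⟩ := hv.1 1
  have lin : ∀ x, w x = v x * w t := fun x => by
    have := ker (x - v x • t) (by simp [ht])
    rw [map_sub, map_zsmul, smul_eq_mul] at this
    omega
  obtain ⟨s, hs⟩ := hw.1 1
  rw [lin] at hs
  have h0 : 0 ≤ w t := (key t).1 (by omega)
  have h1 : w t = 1 := by
    rcases Int.eq_one_or_neg_one_of_mul_eq_one' hs with h | h <;> omega
  refine AddMonoidHom.ext fun x => ?_
  rw [lin x, h1, mul_one]

open Classical in
/-- The normalized valuation `Eˣ → ℤ` of a discrete valuation ring `O` with fraction field `E`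
(and `0` if `O` is not such a ring). -/
def normVal (O : Subring E) : Additive Eˣ →+ ℤ :=
  if h : ∃ v, IsNormVal O v then h.choose else 0

lemma normVal_smul (O : Subring E) (hO : ∀ (g : Γ), ∀ x ∈ O, g • x ∈ O) (g : Γ)
    (x : Additive Eˣ) : normVal O (unitsRep Γ E g x) = normVal O x := by
  by_cases h : ∃ v, IsNormVal O v
  · have hv : IsNormVal O (normVal O) := by
      rw [normVal, dif_pos h]; exact h.choose_spec
    let w : Additive Eˣ →+ ℤ := AddMonoidHom.mk' (fun y => normVal O (unitsRep Γ E g y))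
      fun a b => by rw [map_add, map_add]
    have hw : IsNormVal O w := by
      refine ⟨hv.1.comp fun y => ⟨unitsRep Γ E g⁻¹ y, ?_⟩, fun y => ?_⟩
      · have := DFunLike.congr_fun ((unitsRep Γ E).map_mul g g⁻¹) y
        rw [mul_inv_cancel, map_one] at this
        exact this.symm
      · refine Iff.trans ?_ (hv.2 (unitsRep Γ E g (Additive.ofMul y)).toMul)
        change _ ↔ g • (y : E) ∈ O
        refine ⟨hO g _, fun hy => ?_⟩
        simpa using hO g⁻¹ _ hy
    exact DFunLike.congr_fun (hw.unique hv) x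
  · simp [normVal, dif_neg h]

/-- The map `H²(Γ, Eˣ) → H²(Γ, ℤ)` induced by the valuation of a `Γ`-stable valuation ring. -/
def valH2 [TopologicalSpace Γ] (O : Subring E) (hO : ∀ (g : Γ), ∀ x ∈ O, g • x ∈ O) :
    H2 (unitsRep Γ E) →+ H2 (trivRep Γ ℤ) :=
  H2.map (ContinuousMonoidHom.id Γ) (normVal O) fun g x => normVal_smul O hO g x

end Valuations

noncomputable section Inflation

variable {Δ E : Type*} [Group Δ] [Field E] [MulSemiringAction Δ E]

/-- The action of `Δ ⧸ N` on the fixed field of `N`. -/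
instance fixedFieldAction (N : Subgroup Δ) [N.Normal] :
    MulSemiringAction (Δ ⧸ N) (FixedPoints.subfield N E) :=
  inferInstanceAs (MulSemiringAction (Δ ⧸ N) (FixedPoints.subring E N))

lemma coe_mk_smul (N : Subgroup Δ) [N.Normal] (g : Δ) (x : FixedPoints.subfield N E) :
    (((g : Δ ⧸ N) • x : FixedPoints.subfield N E) : E) = g • (x : E) := rfl

/-- The inflation map `H²(Δ/N, (E^N)ˣ) → H²(Δ, Eˣ)`. -/
def inflation [TopologicalSpace Δ] (N : Subgroup Δ) [N.Normal] :
    H2 (unitsRep (Δ ⧸ N) (FixedPoints.subfield N E)) →+ H2 (unitsRep Δ E) :=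
  H2.map ⟨QuotientGroup.mk' N, continuous_quotient_mk'⟩
    (Units.map ((FixedPoints.subfield N E).subtype : _ →* E)).toAdditive fun _ _ => rfl

lemma smul_mem_comap (N : Subgroup Δ) [N.Normal] (O : Subring E)
    (hO : ∀ g : Δ, ∀ x ∈ O, g • x ∈ O) (q : Δ ⧸ N) :
    ∀ x ∈ O.comap (FixedPoints.subfield N E).subtype,
      q • x ∈ O.comap (FixedPoints.subfield N E).subtype := by
  induction q using QuotientGroup.induction_on with
  | H g => exact fun x hx => hO g x hx

/-- For a normal subgroup `N` of `Δ` and a `Δ`-stable subring `O` of `E`, such that `O ∩ E^N` is a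
discrete valuation ring: the map `H²(Δ/N, (E^N)ˣ) → H²(Δ/N, ℤ)` induced by the normalized valuation
of `O ∩ E^N`. -/
def fixedValH2 [TopologicalSpace Δ] (N : Subgroup Δ) [N.Normal] (O : Subring E)
    (hO : ∀ g : Δ, ∀ x ∈ O, g • x ∈ O) :
    H2 (unitsRep (Δ ⧸ N) (FixedPoints.subfield N E)) →+ H2 (trivRep (Δ ⧸ N) ℤ) :=
  valH2 (O.comap (FixedPoints.subfield N E).subtype) (smul_mem_comap N O hO)

end Inflation

noncomputable section Galois

/-- The Brauer group of a field `F` with algebraic closure `Ω` (in characteristic zero, where `Ω`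
is also a separable closure), as Galois cohomology `H²(Gal(Ω/F), Ωˣ)`. -/
abbrev Br (F Ω : Type*) [Field F] [Field Ω] [Algebra F Ω] : Type _ :=
  H2 (unitsRep (Ω ≃ₐ[F] Ω) Ω)

lemma continuous_of_fixingSubgroup_le {F Ω Δ : Type*} [Field F] [Field Ω] [Algebra F Ω] [Group Δ]
    [TopologicalSpace Δ] (φ : (Ω ≃ₐ[F] Ω) →* Δ) (L : IntermediateField F Ω)
    [FiniteDimensional F L] (h : ∀ σ ∈ L.fixingSubgroup, φ σ = 1) : Continuous φ := by
  have hl : IsLocallyConstant φ := by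
    rw [IsLocallyConstant.iff_exists_open]
    intro σ
    refine ⟨(fun τ => σ⁻¹ * τ) ⁻¹' (L.fixingSubgroup : Set (Ω ≃ₐ[F] Ω)),
      L.fixingSubgroup_isOpen.preimage (continuous_const_mul _), by simp [one_mem], ?_⟩
    intro τ hτ
    have := h _ hτ
    rw [map_mul, map_inv, inv_mul_eq_one] at this
    exact this.symm
  exact hl.continuous

variable {K Ω : Type*} [Field K] [Field Ω] [Algebra K Ω]

/-- The inclusion of Galois groups attached to subfields `F ≤ F'` of `K`. -/
def galIncl [Algebra.IsAlgebraic K Ω] {F F' : Subfield K} (h : F ≤ F')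
    [Algebra.IsAlgebraic F' K] : (Ω ≃ₐ[F'] Ω) →ₜ* (Ω ≃ₐ[F] Ω) where
  toFun σ := { σ with commutes' := fun r => σ.commutes ⟨r, h r.2⟩ }
  map_one' := rfl
  map_mul' _ _ := rfl
  continuous_toFun := by
    let f : (Ω ≃ₐ[F'] Ω) →* (Ω ≃ₐ[F] Ω) :=
      { toFun := fun σ => { σ with commutes' := fun r => σ.commutes ⟨r, h r.2⟩ }
        map_one' := rfl
        map_mul' := fun _ _ => rfl }
    change Continuous f
    have : Algebra.IsAlgebraic F' Ω := Algebra.IsAlgebraic.trans F' K Ω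
    refine continuous_of_continuousAt_one f (continuousAt_def.mpr fun s hs => ?_)
    rw [map_one, krullTopology_mem_nhds_one_iff] at hs
    obtain ⟨L, hL, hLs⟩ := hs
    obtain ⟨S, hS⟩ := IntermediateField.essFiniteType_iff.1 (inferInstance : Algebra.EssFiniteType F L)
    rw [krullTopology_mem_nhds_one_iff]
    refine ⟨IntermediateField.adjoin F' (S : Set Ω),
      IntermediateField.finiteDimensional_adjoin fun x _ => Algebra.IsIntegral.isIntegral x,
      fun σ hσ => hLs ?_⟩
    rw [SetLike.mem_coe, IntermediateField.mem_fixingSubgroup_iff] at hσ ⊢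
    intro x hx
    rw [← hS] at hx
    have hle : IntermediateField.adjoin F (S : Set Ω) ≤
        IntermediateField.fixedField (Subgroup.zpowers (f σ)) := by
      rw [IntermediateField.adjoin_le_iff]
      intro y hy
      rw [SetLike.mem_coe, IntermediateField.mem_fixedField_iff]
      intro g hg
      have : g ∈ MulAction.stabilizer (Ω ≃ₐ[F] Ω) y :=
        (Subgroup.zpowers_le.2
          (show f σ • y = y from hσ y (IntermediateField.subset_adjoin _ _ hy))) hg
      exact this
    exact (IntermediateField.mem_fixedField_iff _ _).1 (hle hx) _ (Subgroup.mem_zpowers _)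

/-- The restriction map `Br(F) → Br(F')` for subfields `F ≤ F'` of `K`. -/
def brRes [Algebra.IsAlgebraic K Ω] {F F' : Subfield K} (h : F ≤ F')
    [Algebra.IsAlgebraic F' K] : Br F Ω →+ Br F' Ω :=
  H2.map (galIncl h) (AddMonoidHom.id _) fun _ _ => rfl

variable (Ω)

/-- The restriction of automorphisms to a finite normal extension, as a continuous
homomorphism. -/
def galRestrict (F K : Type*) [Field F] [Field K] [Algebra F K] [Algebra K Ω] [Algebra F Ω]
    [IsScalarTower F K Ω] [Normal F K] [FiniteDimensional F K] :
    (Ω ≃ₐ[F] Ω) →ₜ* (K ≃ₐ[F] K) where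
  toMonoidHom := AlgEquiv.restrictNormalHom K
  continuous_toFun := by
    have : FiniteDimensional F (IsScalarTower.toAlgHom F K Ω).fieldRange :=
      LinearEquiv.finiteDimensional
        (AlgEquiv.ofInjectiveField (IsScalarTower.toAlgHom F K Ω)).toLinearEquiv
    refine continuous_of_fixingSubgroup_le (AlgEquiv.restrictNormalHom K)
      (IsScalarTower.toAlgHom F K Ω).fieldRange fun σ hσ => ?_
    ext x
    apply (algebraMap K Ω).injective
    exact (AlgEquiv.restrictNormal_commutes σ K x).trans
      ((IntermediateField.mem_fixingSubgroup_iff _ _).1 hσ _ ⟨x, rfl⟩)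

/-- Inflation `H²(Gal(K/F), Kˣ) → Br(F)` for a finite Galois extension `K/F`. -/
def galInflation (F K : Type*) [Field F] [Field K] [Algebra F K] [Algebra K Ω] [Algebra F Ω]
    [IsScalarTower F K Ω] [Normal F K] [FiniteDimensional F K] :
    H2 (unitsRep (K ≃ₐ[F] K) K) →+ Br F Ω :=
  H2.map (galRestrict Ω F K) (Units.map (algebraMap K Ω : K →* Ω)).toAdditive fun g x =>
    Additive.toMul.injective (Units.ext (AlgEquiv.restrictNormal_commutes g K (x.toMul : K)))

lemma ker_toAlgAut (H : Type*) [Group H] [MulSemiringAction H K] :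
    (MulSemiringAction.toAlgAut H (FixedPoints.subfield H K) K).ker =
    (MulSemiringAction.toRingAut H K).ker := by
  ext g
  simp only [MonoidHom.mem_ker, AlgEquiv.ext_iff, RingEquiv.ext_iff]
  rfl

variable (H : Type*) [Group H] [Finite H] [TopologicalSpace H] [MulSemiringAction H K]

/-- If the finite group `H` acts faithfully on `K`, then `H` is the Galois group of `K` over the
fixed field `K^H`, hence a quotient of `Gal(Ω/K^H)`. -/
def galToGroup [FaithfulSMul H K] : (Ω ≃ₐ[FixedPoints.subfield H K] Ω) →ₜ* H :=
  ContinuousMonoidHom.comp ⟨(FixedPoints.toAlgAutMulEquiv H K).symm.toMonoidHom,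
    continuous_of_discreteTopology⟩ (galRestrict Ω (FixedPoints.subfield H K) K)

lemma galToGroup_smul [FaithfulSMul H K] (σ : Ω ≃ₐ[FixedPoints.subfield H K] Ω) (x : K) :
    algebraMap K Ω (galToGroup Ω H σ • x) = σ (algebraMap K Ω x) := by
  rw [← AlgEquiv.restrictNormal_commutes σ K x]
  congr 1
  exact DFunLike.congr_fun ((FixedPoints.toAlgAutMulEquiv H K).apply_symm_apply
    (AlgEquiv.restrictNormalHom K σ)) x

/-- The inflation map `H²(H, Kˣ) → Br(K^H)`. -/
def fixedInflation [FaithfulSMul H K] : H2 (unitsRep H K) →+ Br (FixedPoints.subfield H K) Ω :=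
  H2.map (galToGroup Ω H) (Units.map (algebraMap K Ω : K →* Ω)).toAdditive fun σ x =>
    Additive.toMul.injective (Units.ext (galToGroup_smul Ω H σ (x.toMul : K)))

/-- The action of the finite group `H` on `K`, with kernel `N`, makes `H ⧸ N` a quotient of the
Galois group of the fixed field `K^H`. -/
def galToQuot : (Ω ≃ₐ[FixedPoints.subfield H K] Ω) →ₜ*
    H ⧸ (MulSemiringAction.toRingAut H K).ker :=
  ContinuousMonoidHom.comp
    ⟨((QuotientGroup.quotientMulEquivOfEq (ker_toAlgAut H)).toMonoidHom.comp
      (QuotientGroup.quotientKerEquivOfSurjective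
        (MulSemiringAction.toAlgAut H (FixedPoints.subfield H K) K)
        (FixedPoints.toAlgAut_surjective H K)).symm.toMonoidHom),
      continuous_of_discreteTopology⟩
    (galRestrict Ω (FixedPoints.subfield H K) K)

lemma galToQuot_eq (σ : Ω ≃ₐ[FixedPoints.subfield H K] Ω) (h : H)
    (hσ : galToQuot Ω H σ = h) (x : K) :
    algebraMap K Ω (h • x) = σ (algebraMap K Ω x) := by
  rw [← AlgEquiv.restrictNormal_commutes σ K x]
  congr 1
  obtain ⟨h', hh'⟩ := FixedPoints.toAlgAut_surjective H K (AlgEquiv.restrictNormalHom K σ)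
  have h1 : galToQuot Ω H σ = (h' : H ⧸ (MulSemiringAction.toRingAut H K).ker) := by
    change QuotientGroup.quotientMulEquivOfEq (ker_toAlgAut H)
      ((QuotientGroup.quotientKerEquivOfSurjective _ (FixedPoints.toAlgAut_surjective H K)).symm
        (AlgEquiv.restrictNormalHom K σ)) = _
    have h2 : (QuotientGroup.quotientKerEquivOfSurjective _
        (FixedPoints.toAlgAut_surjective H K)).symm (AlgEquiv.restrictNormalHom K σ) =
        (h' : H ⧸ (MulSemiringAction.toAlgAut H (FixedPoints.subfield H K) K).ker) := by
      rw [← hh', MulEquiv.symm_apply_eq]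
      rfl
    rw [h2]
    rfl
  rw [hσ, QuotientGroup.eq, MonoidHom.mem_ker] at h1
  have h2 := RingEquiv.congr_fun h1 x
  have h3 : (h⁻¹ * h') • x = x := h2
  rw [mul_smul, inv_smul_eq_iff] at h3
  rw [← h3]
  exact DFunLike.congr_fun hh' x

end Galois

noncomputable section Residue

variable (F Ω : Type*) [Field F] [Field Ω] [Algebra F Ω]

instance inertia_normal (A : ValuationSubring Ω) : (A.inertiaSubgroup F).Normal :=
  MonoidHom.normal_ker _

variable {F}

/-- A place of the algebraic closure `Ω` of `F` above the discrete valuation ring `O` of `F`,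
where `φ : O → κ` exhibits `κ` as the residue field of `O` and `κbar` is an algebraic closure of
`κ`: a valuation ring `A` of `Ω` above `O`, with an embedding `ψ` of its residue field in `κbar`.
Since `Gal(κbar/κ)` is the quotient of the decomposition group of `A` by the inertia group, there
is a homomorphism `θ` as indicated, and it is uniquely determined by `ψ`. -/
structure Place {κ κbar : Type*} [Field κ] [Field κbar] [Algebra κ κbar] {O : Subring F}
    (φ : O →+* κ) where
  /-- the valuation ring -/
  A : ValuationSubring Ω
  mem_iff : ∀ x : F, algebraMap F Ω x ∈ A ↔ x ∈ O
  /-- the reduction map -/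
  ψ : A →+* κbar
  ψ_eq_zero_iff : ∀ a : A, ψ a = 0 ↔ a ∈ IsLocalRing.maximalIdeal A
  ψ_algebraMap : ∀ x : O,
    ψ ⟨algebraMap F Ω x, (mem_iff x).2 x.2⟩ = algebraMap κ κbar (φ x)
  /-- the identification of Galois groups -/
  θ : (κbar ≃ₐ[κ] κbar) →ₜ* (A.decompositionSubgroup F ⧸ A.inertiaSubgroup F)
  θ_spec : ∀ (σ : κbar ≃ₐ[κ] κbar) (d : A.decompositionSubgroup F),
    (d : A.decompositionSubgroup F ⧸ A.inertiaSubgroup F) = θ σ → ∀ a : A, ψ (d • a) = σ (ψ a)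

variable {Ω}
variable {κ κbar : Type*} [Field κ] [Field κbar] [Algebra κ κbar] {O : Subring F}

lemma decomposition_smul_mem (A : ValuationSubring Ω) (d : A.decompositionSubgroup F) (x : Ω)
    (hx : x ∈ A.toSubring) : d • x ∈ A.toSubring :=
  (A.subMulAction F).smul_mem' d hx

/-- `r` is the residue of `α ∈ Br(F)` at the discrete valuation ring `O` of `F` with residue field
`κ` (classical residue map `Br(F) → H¹(κ, ℚ/ℤ)`).  In terms of a valuation ring `A` of `Ω` above
`O`, with decomposition group `D` and inertia group `I`, so that `Ω^D` is a henselization and `Ω^I`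
a strict henselization of `F`, the residue map is
`H²(Gal(Ω/F), Ωˣ) → H²(D, Ωˣ) ← H²(D/I, (Ω^I)ˣ) → H²(D/I, ℤ) ≅ H²(κ, ℤ) ≅ H¹(κ, ℚ/ℤ)`:
restriction, the inverse of inflation, the normalized valuation of `Ω^I`, the identification
`D/I ≅ Gal(κbar/κ)`, and the inverse of the connecting homomorphism. -/
def IsResidue (φ : O →+* κ) (α : Br F Ω) (r : H1QZ (κbar ≃ₐ[κ] κbar)) : Prop :=
  ∃ (P : Place (κbar := κbar) Ω φ)
    (a : H2 (unitsRep (P.A.decompositionSubgroup F ⧸ P.A.inertiaSubgroup F)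
      (FixedPoints.subfield (P.A.inertiaSubgroup F) Ω))),
    inflation (P.A.inertiaSubgroup F) a =
      H2.map (ρ' := unitsRep (P.A.decompositionSubgroup F) Ω)
        ⟨(P.A.decompositionSubgroup F).subtype, continuous_subtype_val⟩
        (AddMonoidHom.id _) (fun _ _ => rfl) α ∧
    bockstein r = H2.map (ρ' := trivRep (κbar ≃ₐ[κ] κbar) ℤ) P.θ (AddMonoidHom.id ℤ)
      (fun _ _ => rfl)
      (fixedValH2 (P.A.inertiaSubgroup F) P.A.toSubring (decomposition_smul_mem P.A) a)

end Residue

noncomputable section Stack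

open CategoryTheory AlgebraicGeometry Opposite

variable (G : Type u) [Group G]

/-- The big étale site of schemes with an action of `G`: a family of equivariant morphisms is a
covering if the underlying morphisms of schemes form an étale covering.  Since every `G`-scheme `Y`
has the covering `Y × G → Y` by a trivial `G`-torsor, the localization of this site at `Y` defines
the big étale topos of the quotient stack `[Y/G]`. -/
def equivEtale : GrothendieckTopology (Action Scheme.{u} G) :=
  (Scheme.etalePrecoverage.comap (Action.forget Scheme.{u} G)).toGrothendieck

/-- Abelian sheaves on the site of `G`-schemes. -/
abbrev EqSheaf : Type _ := Sheaf (equivEtale G) AddCommGrpCat.{u + 1}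

lemma hasSheafify_of_small {C : Type (u + 1)} [SmallCategory.{u + 1} C]
    (J : GrothendieckTopology C) : HasSheafify J AddCommGrpCat.{u + 1} := inferInstance

instance : IsGrothendieckAbelian.{u + 1} (EqSheaf G) :=
  have : HasSheafify ((equivSmallModel.{u + 1} (Action Scheme.{u} G)).inverse.inducedTopology
      (equivEtale G)) AddCommGrpCat.{u + 1} := hasSheafify_of_small _
  Sheaf.isGrothendieckAbelian_of_essentiallySmall.{u + 1, u + 1, u, u + 2, u + 1} _ _

variable {G}

/-- The free abelian sheaf `ℤ[Y]` generated by a `G`-scheme `Y`. -/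
def freeSheaf : Action Scheme.{u} G ⥤ EqSheaf G :=
  uliftYoneda.{u + 1} ⋙ (Functor.whiskeringRight _ _ _).obj AddCommGrpCat.free ⋙
    presheafToSheaf _ _

/-- The cohomology `Hⁿ([Y/G], F)` of the quotient stack of a `G`-scheme `Y`. -/
abbrev StackH (F : EqSheaf G) (n : ℕ) (Y : Action Scheme.{u} G) : Type (u + 1) :=
  Abelian.Ext.{u + 1} (freeSheaf.obj Y) F n

/-- The pull-back `Hⁿ([Y/G], F) → Hⁿ([Y'/G], F)` along an equivariant morphism `Y' → Y`. -/
def StackH.pullback {F : EqSheaf G} {n : ℕ} {Y Y' : Action Scheme.{u} G} (f : Y' ⟶ Y)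
    (c : StackH F n Y) : StackH F n Y' :=
  (Abelian.Ext.mk₀ (freeSheaf.map f)).comp c (zero_add n)

/-- Sections of a sheaf over a `G`-scheme. -/
abbrev Sec (F : EqSheaf G) (Y : Action Scheme.{u} G) : Type (u + 1) := F.obj.obj (op Y)

/-- Restriction of sections along an equivariant morphism. -/
abbrev Sec.res {F : EqSheaf G} {Y Y' : Action Scheme.{u} G} (f : Y' ⟶ Y) (s : Sec F Y) :
    Sec F Y' := F.obj.map f.op s

/-- The action of a morphism of sheaves on sections. -/
abbrev Sec.map {F F' : EqSheaf G} (m : F ⟶ F') {Y : Action Scheme.{u} G} (s : Sec F Y) :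
    Sec F' Y := m.hom.app (op Y) s

/-- The morphism `ℤ[Y] → F` given by a section of `F` over `Y`. -/
def sectionHom {F : EqSheaf G} {Y : Action Scheme.{u} G} (s : Sec F Y) :
    freeSheaf.obj Y ⟶ F :=
  ((sheafificationAdjunction (equivEtale G) AddCommGrpCat.{u + 1}).homEquiv _ F).symm
    { app := fun V => (AddCommGrpCat.adj.homEquiv _ _).symm (↾ fun f => F.obj.map f.down.op s)
      naturality := by
        intro V W j
        have h := (AddCommGrpCat.adj.homEquiv_naturality_left_symm
          ((uliftYoneda.{u + 1}.obj Y).map j) (↾ fun f => F.obj.map f.down.op s :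
            (uliftYoneda.{u + 1}.obj Y).obj W ⟶ (forget AddCommGrpCat).obj (F.obj.obj W)))
        have h' := (AddCommGrpCat.adj.homEquiv_naturality_right_symm
          (↾ fun f => F.obj.map f.down.op s :
            (uliftYoneda.{u + 1}.obj Y).obj V ⟶ (forget AddCommGrpCat).obj (F.obj.obj V))
            (F.obj.map j))
        refine h.symm.trans (Eq.trans ?_ h')
        congr 1
        ext f
        change F.obj.map (j.unop ≫ f.down).op s = F.obj.map j (F.obj.map f.down.op s)
        rw [op_comp, F.obj.map_comp]
        rfl }

/-- The automorphism of a `G`-scheme given by an element of `G` (a left action). -/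
def act (Y : Action Scheme.{u} G) (g : G) : Y.V ⟶ Y.V := Y.ρ g

lemma act_one (Y : Action Scheme.{u} G) : act Y 1 = 𝟙 Y.V := Y.ρ.map_one

lemma act_mul (Y : Action Scheme.{u} G) (g h : G) : act Y (g * h) = act Y h ≫ act Y g :=
  Y.ρ.map_mul g h

/-- Invertible global functions on a `G`-scheme that are invariant under `G`. -/
def invUnits (Y : Action Scheme.{u} G) : Subgroup Γ(Y.V, ⊤)ˣ where
  carrier := {x | ∀ g : G,
    Units.map ((act Y g).appTop.hom : Γ(Y.V, ⊤) →* Γ(Y.V, ⊤)) x = x}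
  one_mem' := by simp
  mul_mem' := by
    intro a b ha hb g
    rw [map_mul, ha g, hb g]
  inv_mem' := by
    intro a ha g
    rw [map_inv, ha g]

/-- Pull-back of invariant invertible functions. -/
def invUnitsMap {Y Y' : Action Scheme.{u} G} (f : Y' ⟶ Y) : invUnits Y →* invUnits Y' :=
  ((Units.map (f.hom.appTop.hom : Γ(Y.V, ⊤) →* Γ(Y'.V, ⊤))).comp (invUnits Y).subtype).codRestrict
    _ fun x g => by
      ext
      have h := congrArg (fun m : Y'.V ⟶ Y.V => m.appTop.hom (x : Γ(Y.V, ⊤)ˣ)) (show act Y' g ≫ f.hom = f.hom ≫ act Y g from f.comm g)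
      have hx := congrArg Units.val (x.2 g)
      simp only [Scheme.Hom.comp_appTop] at h
      simp at h hx ⊢
      rw [h, hx]

lemma invUnitsMap_id (Y : Action Scheme.{u} G) : invUnitsMap (𝟙 Y) = MonoidHom.id _ := by
  refine MonoidHom.ext fun x => Subtype.ext (Units.ext ?_)
  change (𝟙 Y.V : Y.V ⟶ Y.V).appTop.hom _ = _
  rw [Scheme.Hom.id_appTop]
  rfl

lemma invUnitsMap_comp {Y Y' Y'' : Action Scheme.{u} G} (f : Y' ⟶ Y) (g : Y'' ⟶ Y') :
    invUnitsMap (g ≫ f) = (invUnitsMap g).comp (invUnitsMap f) := by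
  refine MonoidHom.ext fun x => Subtype.ext (Units.ext ?_)
  change (g.hom ≫ f.hom).appTop.hom _ = _
  rw [Scheme.Hom.comp_appTop]
  rfl

/-- The presheaf `Y ↦ Γ([Y/G], 𝔾ₘ)`, written multiplicatively. -/
def gmMul : (Action Scheme.{u} G)ᵒᵖ ⥤ CommGrpCat.{u} where
  obj Y := CommGrpCat.of (invUnits Y.unop)
  map {Y Y'} f := CommGrpCat.ofHom (invUnitsMap (f.unop : Y'.unop ⟶ Y.unop))
  map_id Y := congrArg CommGrpCat.ofHom (invUnitsMap_id Y.unop)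
  map_comp f g := congrArg CommGrpCat.ofHom (invUnitsMap_comp f.unop g.unop)

/-- The presheaf `Y ↦ Γ([Y/G], 𝔾ₘ)`. -/
def gmPresheaf : (Action Scheme.{u} G)ᵒᵖ ⥤ AddCommGrpCat.{u + 1} :=
  gmMul ⋙ CommGrpCat.toAddCommGrp ⋙ AddCommGrpCat.uliftFunctor.{u + 1, u}

variable (G) in
/-- The sheaf `𝔾ₘ` (the presheaf `gmPresheaf` is a sheaf already, so that sheafification does not
change it). -/
def Gm : EqSheaf G := (presheafToSheaf _ _).obj gmPresheaf

/-- The section of `𝔾ₘ` given by an invariant invertible function. -/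
def gmSection {Y : Action Scheme.{u} G} (x : invUnits Y) : Sec (Gm G) Y :=
  (toSheafify (equivEtale G) gmPresheaf).app (op Y) (ULift.up (Additive.ofMul x))

/-- The Brauer group `Br([Y/G]) = H²([Y/G], 𝔾ₘ)` of the quotient stack. -/
abbrev StackBr (Y : Action Scheme.{u} G) : Type (u + 1) := StackH (Gm G) 2 Y

/-- Let `U → Y` be a torsor in `G`-schemes under a finite group `Γ`, where `γ` acts by `R γ` from
the right, so that `Γ` acts on the left on the sections over `U` of any sheaf.  The class `c` is the
image of the 2-cocycle `f` of `Γ` with values in `F(U)` under the edge map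
`H²(Γ, F(U)) → H²([Y/G], F)` of the Cartan-Leray (Hochschild-Serre) spectral sequence: in exact
sequences `0 → F → I → Q → 0` and `0 → Q → I' → Q' → 0` of sheaves, `f` is the coboundary of a
1-cochain `e` in `I(U)`, the cocycle in `Q(U)` obtained from `e` is the coboundary of `e' ∈ I'(U)`,
the image of `e'` in `Q'(U)` descends to a section `s` of `Q'` over `Y`, and `c` is obtained from
`s` by the two connecting homomorphisms. -/
def IsEdgeClass {Γ : Type*} [Group Γ] {F : EqSheaf G} {Y U : Action Scheme.{u} G} (p : U ⟶ Y)
    (R : Γ → (U ⟶ U)) (f : Γ × Γ → Sec F U) (c : StackH F 2 Y) : Prop :=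
  ∃ (I Q I' Q' : EqSheaf G) (i : F ⟶ I) (q : I ⟶ Q) (w : i ≫ q = 0)
    (hS : (ShortComplex.mk i q w).ShortExact)
    (i' : Q ⟶ I') (q' : I' ⟶ Q') (w' : i' ≫ q' = 0) (hS' : (ShortComplex.mk i' q' w').ShortExact)
    (e : Γ → Sec I U) (e' : Sec I' U) (s : Sec Q' Y),
    (∀ γ δ, Sec.map i (f (γ, δ)) = Sec.res (R γ) (e δ) - e (γ * δ) + e γ) ∧
    (∀ γ, Sec.map i' (Sec.map q (e γ)) = Sec.res (R γ) e' - e') ∧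
    Sec.res p s = Sec.map q' e' ∧
    c = ((Abelian.Ext.mk₀ (sectionHom s)).comp hS'.extClass (zero_add 1)).comp hS.extClass
      (one_add_one_eq_two)

end Stack

noncomputable section Geometry

open CategoryTheory AlgebraicGeometry Opposite Limits

/-- The action on the local ring at a fixed point `x` of an endomorphism `f` (pull-back of germs of
functions). -/
def fixStalk {X : Scheme.{u}} (f : X ⟶ X) {x : X} (h : f x = x) :
    X.presheaf.stalk x ⟶ X.presheaf.stalk x :=
  X.presheaf.stalkSpecializes (specializes_of_eq h) ≫ f.stalkMap x

lemma fixStalk_id {X : Scheme.{u}} (x : X) (h : (𝟙 X : X ⟶ X) x = x) :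
    fixStalk (𝟙 X) h = 𝟙 _ := by
  rw [fixStalk, Scheme.Hom.stalkMap_id]
  exact (Category.comp_id _).trans (TopCat.Presheaf.stalkSpecializes_refl _ _)

lemma fixStalk_comp {X : Scheme.{u}} (f g : X ⟶ X) {x : X} (hf : f x = x) (hg : g x = x)
    (h : (f ≫ g) x = x) : fixStalk (f ≫ g) h = fixStalk g hg ≫ fixStalk f hf := by
  have h1 := Scheme.Hom.stalkSpecializes_stalkMap g (f x) x (specializes_of_eq hf)
  have h2 : X.presheaf.stalkSpecializes (specializes_of_eq h) =
      X.presheaf.stalkSpecializes (specializes_of_eq hg) ≫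
        X.presheaf.stalkSpecializes (g.base.hom.map_specializes (specializes_of_eq hf)) :=
    (TopCat.Presheaf.stalkSpecializes_comp _ _ _).symm
  calc fixStalk (f ≫ g) h = (X.presheaf.stalkSpecializes (specializes_of_eq hg) ≫
        X.presheaf.stalkSpecializes (g.base.hom.map_specializes (specializes_of_eq hf))) ≫
        g.stalkMap (f x) ≫ f.stalkMap x := by
          rw [← h2, fixStalk, Scheme.Hom.stalkMap_comp]; rfl
    _ = X.presheaf.stalkSpecializes (specializes_of_eq hg) ≫
        (X.presheaf.stalkSpecializes (g.base.hom.map_specializes (specializes_of_eq hf)) ≫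
        g.stalkMap (f x)) ≫ f.stalkMap x := by simp only [Category.assoc]
    _ = _ := by rw [h1]; simp only [fixStalk, Category.assoc]

lemma fixStalk_congr {X : Scheme.{u}} {f g : X ⟶ X} (e : f = g) {x : X} (hf : f x = x)
    (hg : g x = x) : fixStalk f hf = fixStalk g hg := by
  subst e; rfl

lemma fixStalk_fromSpecStalk {X : Scheme.{u}} (f : X ⟶ X) {x : X} (h : f x = x) :
    Spec.map (fixStalk f h) ≫ X.fromSpecStalk x = X.fromSpecStalk x ≫ f := by
  rw [fixStalk, Spec.map_comp, Category.assoc, Scheme.SpecMap_stalkSpecializes_fromSpecStalk,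
    Scheme.SpecMap_stalkMap_fromSpecStalk]

variable {G : Type u} [Group G]

/-- The stabilizer (decomposition group) of a point of a `G`-scheme. -/
def stab (Y : Action Scheme.{u} G) (x : Y.V) : Subgroup G where
  carrier := {g | act Y g x = x}
  one_mem' := by
    change act Y 1 x = x
    rw [act_one]; rfl
  mul_mem' := by
    intro a b (ha : act Y a x = x) (hb : act Y b x = x)
    change act Y (a * b) x = x
    rw [act_mul, Scheme.Hom.comp_apply, hb, ha]
  inv_mem' := by
    intro a (ha : act Y a x = x)
    change act Y a⁻¹ x = x
    have h : act Y (a⁻¹ * a) x = x := by rw [inv_mul_cancel, act_one]; rfl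
    rwa [act_mul, Scheme.Hom.comp_apply, ha] at h

lemma stab_apply {Y : Action Scheme.{u} G} {x : Y.V} (d : stab Y x) : act Y d x = x := d.2

/-- Elements `d` of the stabilizer of `x` act on the germs of functions at `x` by
`s ↦ s ∘ d⁻¹`. -/
def stalkHom (Y : Action Scheme.{u} G) (x : Y.V) :
    stab Y x →* (Y.V.presheaf.stalk x →+* Y.V.presheaf.stalk x) where
  toFun d := (fixStalk (act Y (d⁻¹ : stab Y x)) (stab_apply d⁻¹)).hom
  map_one' := by
    have h1 : act Y ((1⁻¹ : stab Y x) : G) = 𝟙 _ := by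
      rw [inv_one]; exact act_one Y
    have h2 : (𝟙 Y.V : Y.V ⟶ Y.V) x = x := rfl
    rw [fixStalk_congr h1 _ h2, fixStalk_id]
    rfl
  map_mul' d e := by
    have h1 : act Y (((d * e)⁻¹ : stab Y x) : G) =
        act Y (d⁻¹ : stab Y x) ≫ act Y (e⁻¹ : stab Y x) := by
      rw [← act_mul, mul_inv_rev]; rfl
    have h2 : (act Y (d⁻¹ : stab Y x) ≫ act Y (e⁻¹ : stab Y x)) x = x := h1 ▸ stab_apply (d * e)⁻¹
    rw [fixStalk_congr h1 _ h2, fixStalk_comp _ _ (stab_apply d⁻¹) (stab_apply e⁻¹)]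
    rfl

/-- The action of the stabilizer of `x` on the local ring at `x`. -/
instance stalkAction (Y : Action Scheme.{u} G) (x : Y.V) :
    MulSemiringAction (stab Y x) (Y.V.presheaf.stalk x) where
  smul d s := stalkHom Y x d s
  one_smul s := RingHom.congr_fun (map_one (stalkHom Y x)) s
  mul_smul d e s := RingHom.congr_fun (map_mul (stalkHom Y x) d e) s
  smul_zero d := map_zero (stalkHom Y x d)
  smul_add d := map_add (stalkHom Y x d)
  smul_one d := map_one (stalkHom Y x d)
  smul_mul d := map_mul (stalkHom Y x d)

/-- The affine `G`-scheme `Spec R`, where `g ∈ G` acts on functions by `φ g`. -/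
def specAction {R : Type u} [CommRing R] (φ : G →* (R →+* R)) : Action Scheme.{u} G where
  V := Spec (.of R)
  ρ :=
    { toFun := fun g => Spec.map (CommRingCat.ofHom (φ g⁻¹))
      map_one' := by rw [inv_one, map_one]; exact Spec.map_id _
      map_mul' := fun g h => by
        rw [mul_inv_rev, map_mul]
        exact Spec.map_comp (CommRingCat.ofHom (φ g⁻¹)) (CommRingCat.ofHom (φ h⁻¹)) }

/-- The equivariant morphism of affine `G`-schemes given by an equivariant ring homomorphism. -/
def specActionMap {R R' : Type u} [CommRing R] [CommRing R'] {φ : G →* (R →+* R)}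
    {φ' : G →* (R' →+* R')} (f : R →+* R') (hf : ∀ g, f.comp (φ g) = (φ' g).comp f) :
    specAction φ' ⟶ specAction φ where
  hom := Spec.map (CommRingCat.ofHom f)
  comm g := by
    change Spec.map (CommRingCat.ofHom (φ' g⁻¹)) ≫ Spec.map (CommRingCat.ofHom f) =
      Spec.map (CommRingCat.ofHom f) ≫ Spec.map (CommRingCat.ofHom (φ g⁻¹))
    rw [← Spec.map_comp, ← Spec.map_comp, ← CommRingCat.ofHom_comp, ← CommRingCat.ofHom_comp, hf]

/-- The invariant invertible function on `Spec R` given by an invariant unit of `R`. -/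
def specUnit {R : Type u} [CommRing R] (φ : G →* (R →+* R)) (x : Rˣ)
    (hx : ∀ g, φ g (x : R) = x) : invUnits (specAction φ) :=
  ⟨Units.map (M := R) (N := Γ(Spec (.of R), ⊤)) ((Scheme.ΓSpecIso (.of R)).inv.hom : R →+* _) x,
    fun g => Units.ext (by
    have h := RingHom.congr_fun (congrArg CommRingCat.Hom.hom
      (Scheme.ΓSpecIso_inv_naturality (CommRingCat.ofHom (φ g⁻¹)))) (x : R)
    refine Eq.trans h.symm ?_
    exact congrArg (Scheme.ΓSpecIso (.of R)).inv.hom (hx g⁻¹))⟩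

section Sigma

variable (Y : Action Scheme.{u} G)

/-- The disjoint union `∐_{t ∈ G} Y`. -/
abbrev sigmaObj : Scheme.{u} := ∐ fun _ : G => Y.V

/-- The inclusion of the summand with index `t`. -/
abbrev sigmaι (t : G) : Y.V ⟶ sigmaObj Y := Sigma.ι (fun _ : G => Y.V) t

/-- `(y, t) ↦ (gy, gt)`. -/
def sigmaAct (g : G) : sigmaObj Y ⟶ sigmaObj Y := Sigma.desc fun t => act Y g ≫ sigmaι Y (g * t)

/-- `(y, t) ↦ y`. -/
def sigmaFst : sigmaObj Y ⟶ Y.V := Sigma.desc fun _ => 𝟙 Y.V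

/-- `(y, t) ↦ (y, tγ)`. -/
def sigmaRight (γ : G) : sigmaObj Y ⟶ sigmaObj Y := Sigma.desc fun t => sigmaι Y (t * γ)

lemma ι_sigmaAct (g t : G) : sigmaι Y t ≫ sigmaAct Y g = act Y g ≫ sigmaι Y (g * t) :=
  Sigma.ι_desc _ _

lemma ι_sigmaFst (t : G) : sigmaι Y t ≫ sigmaFst Y = 𝟙 Y.V := Sigma.ι_desc _ _

lemma ι_sigmaRight (γ t : G) : sigmaι Y t ≫ sigmaRight Y γ = sigmaι Y (t * γ) := Sigma.ι_desc _ _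

lemma ι_sigmaAct_assoc (g t : G) {Z : Scheme.{u}} (h : sigmaObj Y ⟶ Z) :
    sigmaι Y t ≫ sigmaAct Y g ≫ h = act Y g ≫ sigmaι Y (g * t) ≫ h := by
  rw [← Category.assoc, ι_sigmaAct, Category.assoc]

lemma ι_sigmaFst_assoc (t : G) {Z : Scheme.{u}} (h : Y.V ⟶ Z) :
    sigmaι Y t ≫ sigmaFst Y ≫ h = h := by
  rw [← Category.assoc, ι_sigmaFst, Category.id_comp]

lemma ι_sigmaRight_assoc (γ t : G) {Z : Scheme.{u}} (h : sigmaObj Y ⟶ Z) :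
    sigmaι Y t ≫ sigmaRight Y γ ≫ h = sigmaι Y (t * γ) ≫ h := by
  rw [← Category.assoc, ι_sigmaRight]

lemma sigmaAct_one : sigmaAct Y 1 = 𝟙 _ := by
  refine Sigma.hom_ext _ _ fun t => ?_
  rw [ι_sigmaAct, act_one, one_mul, Category.id_comp, Category.comp_id]

lemma sigmaAct_mul (g h : G) : sigmaAct Y (g * h) = sigmaAct Y h ≫ sigmaAct Y g := by
  refine Sigma.hom_ext _ _ fun t => ?_
  rw [ι_sigmaAct, ι_sigmaAct_assoc, ι_sigmaAct, act_mul, mul_assoc, Category.assoc]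

lemma sigmaAct_fst (g : G) : sigmaAct Y g ≫ sigmaFst Y = sigmaFst Y ≫ act Y g := by
  refine Sigma.hom_ext _ _ fun t => ?_
  rw [ι_sigmaAct_assoc, ι_sigmaFst, ι_sigmaFst_assoc, Category.comp_id]

lemma sigmaAct_right (g γ : G) :
    sigmaAct Y g ≫ sigmaRight Y γ = sigmaRight Y γ ≫ sigmaAct Y g := by
  refine Sigma.hom_ext _ _ fun t => ?_
  rw [ι_sigmaAct_assoc, ι_sigmaRight, ι_sigmaRight_assoc, ι_sigmaAct, mul_assoc]

/-- The `G`-scheme `Y × G = ∐_{t ∈ G} Y`, with the diagonal action of `G`. -/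
def prodGroup : Action Scheme.{u} G where
  V := sigmaObj Y
  ρ :=
    { toFun := sigmaAct Y
      map_one' := sigmaAct_one Y
      map_mul' := sigmaAct_mul Y }

/-- The projection `Y × G → Y`. -/
def prodGroupFst : prodGroup Y ⟶ Y where
  hom := sigmaFst Y
  comm := sigmaAct_fst Y

/-- The right translations of `Y × G`, which make it a `G`-torsor over `Y` in `G`-schemes. -/
def prodGroupRight (γ : G) : prodGroup Y ⟶ prodGroup Y where
  hom := sigmaRight Y γ
  comm g := sigmaAct_right Y g γ

end Sigma

end Geometry

noncomputable section Surface

open CategoryTheory AlgebraicGeometry Opposite Limits TensorProduct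

attribute [local instance] MvPolynomial.gradedAlgebra in
/-- `X` is projective over `k`: it is isomorphic over `k` to a closed subscheme of some `ℙⁿ`. -/
def IsProjectiveOver {k : Type u} [Field k] {X : Scheme.{u}} (s : X ⟶ Spec (.of k)) : Prop :=
  ∃ (n : ℕ) (i : X ⟶ Proj (MvPolynomial.homogeneousSubmodule (Fin (n + 1)) k)),
    IsClosedImmersion i ∧
      i ≫ Proj.toSpecZero (MvPolynomial.homogeneousSubmodule (Fin (n + 1)) k) ≫
        Spec.map (CommRingCat.ofHom
          (algebraMap k (MvPolynomial.homogeneousSubmodule (Fin (n + 1)) k 0))) = s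

/-- A smooth projective rational surface over `k` with a generically free regular action of `G`. -/
structure GSurface (k G : Type u) [Field k] [Group G] where
  /-- the surface with its action of `G` -/
  X : Action Scheme.{u} G
  /-- the structure morphism -/
  str : X.V ⟶ Spec (.of k)
  act_str : ∀ g, act X g ≫ str = str
  integral : IsIntegral X.V
  smooth : SmoothOfRelativeDimension 2 str
  projective : IsProjectiveOver str
  rational : Scheme.IsRationalOver str
  /-- there is a nonempty open subscheme `V` such that `G` acts freely on `V(T)` for all nonempty
  schemes `T` -/
  generically_free : ∃ V : X.V.Opens, (V : Set X.V).Nonempty ∧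
    ∀ (T : Scheme.{u}) [Nonempty T] (t : T ⟶ X.V), (∀ x, t x ∈ V) →
      ∀ g, t ≫ act X g = t → g = 1

/-- The homomorphism to the monoid of ring endomorphisms given by an action on a ring. -/
def ringAction (G R : Type*) [Group G] [CommRing R] [MulSemiringAction G R] :
    G →* (R →+* R) where
  toFun := MulSemiringAction.toRingHom G R
  map_one' := RingHom.ext (one_smul G)
  map_mul' g h := RingHom.ext (mul_smul g h)

namespace GSurface

variable {k G : Type u} [Field k] [Group G] (S : GSurface k G)

instance : IsIntegral S.X.V := S.integral

instance (g : G) : IsIso (act S.X g) :=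
  ⟨act S.X g⁻¹, by rw [← act_mul, inv_mul_cancel, act_one],
    by rw [← act_mul, mul_inv_cancel, act_one]⟩

/-- The generic point. -/
abbrev η : S.X.V := genericPoint S.X.V

lemma act_η (g : G) : act S.X g S.η = S.η := genericPoint_eq_of_isOpenImmersion (act S.X g)

/-- The function field `k(X)`. -/
def K : Type u := S.X.V.functionField

instance : Field S.K := inferInstanceAs (Field S.X.V.functionField)

/-- `G` as the stabilizer of the generic point. -/
def toStab : G →* stab S.X S.η where
  toFun g := ⟨g, S.act_η g⟩
  map_one' := rfl
  map_mul' _ _ := rfl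

/-- The action of `G` on `k(X)`: `g` sends a rational function `f` to `f ∘ g⁻¹`. -/
def kHom : G →* (S.X.V.functionField →+* S.X.V.functionField) := (stalkHom S.X S.η).comp S.toStab

instance : MulSemiringAction G S.K where
  smul g x := S.kHom g x
  one_smul x := RingHom.congr_fun (map_one S.kHom) x
  mul_smul g h x := RingHom.congr_fun (map_mul S.kHom g h) x
  smul_zero g := map_zero (S.kHom g)
  smul_add g := map_add (S.kHom g)
  smul_one g := map_one (S.kHom g)
  smul_mul g := map_mul (S.kHom g)

lemma smul_def (g : G) (x : S.K) :
    g • x = (fixStalk (act S.X g⁻¹) (S.act_η g⁻¹)).hom x := rfl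

/-- `Spec k(X)` as a `G`-scheme. -/
def specK : Action Scheme.{u} G := specAction (ringAction G S.K)

lemma ringAction_inv (g : G) :
    CommRingCat.ofHom (ringAction G S.K g⁻¹) = fixStalk (act S.X g) (S.act_η g) := by
  ext x
  change g⁻¹ • x = _
  rw [smul_def, fixStalk_congr (congrArg (act S.X) (inv_inv g)) _ (S.act_η g)]
  rfl

/-- The equivariant morphism `Spec k(X) → X`. -/
def generic : S.specK ⟶ S.X where
  hom := S.X.V.fromSpecStalk S.η
  comm g := by
    change Spec.map (CommRingCat.ofHom (ringAction G S.K g⁻¹)) ≫ _ = _ ≫ act S.X g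
    rw [ringAction_inv]
    exact fixStalk_fromSpecStalk _ _

instance : FaithfulSMul G S.K where
  eq_of_smul_eq_smul {g h} H := by
    obtain ⟨V, hV, hfree⟩ := S.generically_free
    have hη : ∀ x, S.X.V.fromSpecStalk S.η x ∈ V := fun x => by
      obtain ⟨v, hv⟩ := hV
      have h1 : S.X.V.fromSpecStalk S.η x ∈ Set.range (S.X.V.fromSpecStalk S.η) := ⟨x, rfl⟩
      rw [Scheme.range_fromSpecStalk] at h1
      exact (h1.trans (genericPoint_specializes v)).mem_open V.isOpen hv
    have h1 : CommRingCat.ofHom (ringAction G S.K (g⁻¹ * h)) = 𝟙 _ := by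
      ext x
      change (g⁻¹ * h) • x = x
      rw [mul_smul, ← H, inv_smul_smul]
    have h2 : fixStalk (act S.X (h⁻¹ * g)) (S.act_η (h⁻¹ * g)) = 𝟙 _ := by
      rw [← ringAction_inv, mul_inv_rev, inv_inv, h1]
      rfl
    have h3 := fixStalk_fromSpecStalk (act S.X (h⁻¹ * g)) (S.act_η (h⁻¹ * g))
    rw [h2, Spec.map_id] at h3
    have h4 := hfree _ (S.X.V.fromSpecStalk S.η) hη (h⁻¹ * g) (h3.symm.trans (Category.id_comp _))
    exact (inv_mul_eq_one.1 h4).symm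

variable (ξ : S.X.V)

/-- The decomposition group `D_ξ`. -/
abbrev D : Subgroup G := stab S.X ξ

/-- The residue field `k(ξ)`; it carries the action of `D_ξ` induced by that on the local ring. -/
abbrev κ : Type u := IsLocalRing.ResidueField (S.X.V.presheaf.stalk ξ)

/-- The inertia group `I_ξ`, consisting of the elements of `D_ξ` acting trivially on `k(ξ)`. -/
abbrev I : Subgroup (S.D ξ) := (MulSemiringAction.toRingAut (S.D ξ) (S.κ ξ)).ker

/-- The embedding of the local ring at `ξ` in the function field. -/
def toK : S.X.V.presheaf.stalk ξ →+* S.K :=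
  algebraMap (S.X.V.presheaf.stalk ξ) S.X.V.functionField

lemma toK_injective : Function.Injective (S.toK ξ) :=
  IsFractionRing.injective (S.X.V.presheaf.stalk ξ) S.X.V.functionField

lemma toK_smul (d : S.D ξ) (s : S.X.V.presheaf.stalk ξ) : S.toK ξ (d • s) = d • S.toK ξ s := by
  have hs : S.η ⤳ ξ := genericPoint_specializes ξ
  have h : fixStalk (act S.X (d⁻¹ : S.D ξ)) (stab_apply d⁻¹) ≫ S.X.V.presheaf.stalkSpecializes hs =
      S.X.V.presheaf.stalkSpecializes hs ≫
        fixStalk (act S.X (d⁻¹ : S.D ξ)) (S.act_η (d⁻¹ : S.D ξ)) := by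
    rw [fixStalk, fixStalk, Category.assoc]
    have h1 := Scheme.Hom.stalkSpecializes_stalkMap (act S.X (d⁻¹ : S.D ξ)) S.η ξ hs
    have h2 : S.X.V.presheaf.stalkSpecializes (specializes_of_eq (stab_apply d⁻¹)) ≫
        S.X.V.presheaf.stalkSpecializes
          ((act S.X (d⁻¹ : S.D ξ)).base.hom.map_specializes hs) =
        S.X.V.presheaf.stalkSpecializes hs ≫ S.X.V.presheaf.stalkSpecializes
          (specializes_of_eq (S.act_η (d⁻¹ : S.D ξ))) :=
      (TopCat.Presheaf.stalkSpecializes_comp _ _ _).trans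
        (TopCat.Presheaf.stalkSpecializes_comp _ _ _).symm
    calc _ = S.X.V.presheaf.stalkSpecializes (specializes_of_eq (stab_apply d⁻¹)) ≫
        S.X.V.presheaf.stalkSpecializes
          ((act S.X (d⁻¹ : S.D ξ)).base.hom.map_specializes hs) ≫ _ := by rw [h1]
      _ = _ := by rw [← Category.assoc, h2, Category.assoc]
  exact RingHom.congr_fun (congrArg CommRingCat.Hom.hom h) s

/-- The local ring at `ξ` as a subring of the function field. -/
def O : Subring S.K := (S.toK ξ).range

lemma smul_mem_O (d : S.D ξ) : ∀ x ∈ S.O ξ, d • x ∈ S.O ξ := by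
  rintro _ ⟨s, rfl⟩
  exact ⟨d • s, S.toK_smul ξ d s⟩

/-- The fixed field of `D_ξ` in `k(ξ)`. -/
abbrev κD : Subfield (S.κ ξ) := FixedPoints.subfield (S.D ξ) (S.κ ξ)

/-- The fixed field `k(X)^G`. -/
abbrev KG : Subfield S.K := FixedPoints.subfield G S.K

/-- The fixed field `k(X)^{D_ξ}`. -/
abbrev KD : Subfield S.K := FixedPoints.subfield (S.D ξ) S.K

lemma fixed_le : S.KG ≤ S.KD ξ :=
  fun _ hx d => hx d

/-- For a subfield `F` of `k(X)^{D_ξ}` the reduction map `O_ξ ∩ F → k(ξ)^{D_ξ}`. -/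
def reduction (F : Subfield S.K) (hF : F ≤ S.KD ξ) :
    (S.O ξ).comap F.subtype →+* S.κD ξ :=
  let e : S.X.V.presheaf.stalk ξ ≃+* S.O ξ :=
    RingEquiv.ofBijective (S.toK ξ).rangeRestrict
      ⟨fun _ _ h => S.toK_injective ξ (congrArg Subtype.val h), (S.toK ξ).rangeRestrict_surjective⟩
  let r : (S.O ξ).comap F.subtype →+* S.X.V.presheaf.stalk ξ :=
    e.symm.toRingHom.comp ((F.subtype.comp ((S.O ξ).comap F.subtype).subtype).codRestrict (S.O ξ)
      fun x => x.2)
  ((IsLocalRing.residue (S.X.V.presheaf.stalk ξ)).comp r).codRestrict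
    (S.κD ξ).toSubring fun x d => by
      rw [RingHom.comp_apply, ← IsLocalRing.ResidueField.residue_smul]
      congr 1
      apply S.toK_injective ξ
      rw [toK_smul]
      have h : S.toK ξ (r x) = (x : F) :=
        congrArg Subtype.val (e.apply_symm_apply (⟨((x : F) : S.K), x.2⟩ : S.O ξ))
      rw [h]
      exact hF (x : F).2 d

/-- An algebraic closure of `k(X)`; it serves as algebraic closure of all fields between `k(X)^G`
and `k(X)`. -/
abbrev Kbar : Type u := AlgebraicClosure S.K

/-- An algebraic closure of `k(ξ)`, hence of `k(ξ)^{D_ξ}`. -/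
abbrev κbar : Type u := AlgebraicClosure (S.κ ξ)

/-- The constants, as functions on `X × G`. -/
def constHom : k →+* Γ((prodGroup S.X).V, ⊤) :=
  ((Scheme.ΓSpecIso (.of k)).inv ≫ (sigmaFst S.X ≫ S.str).appTop).hom

/-- The constant invertible function on `X × G` given by an element of `kˣ`. -/
def const (c : kˣ) : invUnits (prodGroup S.X) :=
  ⟨Units.map (S.constHom : k →* Γ((prodGroup S.X).V, ⊤)) c,
    fun g => Units.ext (by
      have h : sigmaAct S.X g ≫ sigmaFst S.X ≫ S.str = sigmaFst S.X ≫ S.str := by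
        rw [← Category.assoc, sigmaAct_fst, Category.assoc, S.act_str]
      have h2 := congrArg (fun m : sigmaObj S.X ⟶ Spec (.of k) => ((Scheme.ΓSpecIso (.of k)).inv ≫
        m.appTop).hom (c : k)) h
      simp only [Scheme.Hom.comp_appTop (sigmaAct S.X g)] at h2
      exact h2)⟩

/-- `b ∈ Br([X/G])` is the image of `β ∈ H²(G, kˣ)` under the edge map of the Hochschild-Serre
spectral sequence of the `G`-torsor `X → [X/G]`. -/
def IsImage [TopologicalSpace G] (β : H2 (trivRep G (Additive kˣ))) (b : StackBr S.X) : Prop :=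
  ∃ z : Z2 (trivRep G (Additive kˣ)), H2.mk _ z = β ∧
    IsEdgeClass (prodGroupFst S.X) (prodGroupRight S.X)
      (fun p => gmSection (S.const (z.1 p).toMul)) b

section Tensor

variable (L : Type u) [Field L] [Algebra S.KG L]

/-- The action of `G` on `L ⊗ k(X)` through the second factor, where `L` is an extension
of `k(X)^G`. -/
def tensorAction : G →* (L ⊗[S.KG] S.K →+* L ⊗[S.KG] S.K) where
  toFun g := (Algebra.TensorProduct.map (AlgHom.id S.KG L)
    (MulSemiringAction.toAlgHom S.KG S.K g)).toRingHom
  map_one' := by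
    refine RingHom.ext fun x => ?_
    have : MulSemiringAction.toAlgHom S.KG S.K (1 : G) = AlgHom.id _ _ :=
      AlgHom.ext (one_smul G)
    change Algebra.TensorProduct.map (AlgHom.id S.KG L) _ x = x
    rw [this, Algebra.TensorProduct.map_id]
    rfl
  map_mul' g h := by
    refine RingHom.ext fun x => ?_
    have : MulSemiringAction.toAlgHom S.KG S.K (g * h) =
        (MulSemiringAction.toAlgHom S.KG S.K g).comp (MulSemiringAction.toAlgHom S.KG S.K h) :=
      AlgHom.ext (mul_smul g h)
    change Algebra.TensorProduct.map (AlgHom.id S.KG L) _ x =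
      Algebra.TensorProduct.map _ _ (Algebra.TensorProduct.map _ _ x)
    rw [this, ← AlgHom.comp_apply, ← Algebra.TensorProduct.map_comp]
    rfl

/-- The `G`-scheme `Spec(L ⊗ k(X))`. -/
def specLK : Action Scheme.{u} G := specAction (S.tensorAction L)

/-- The projection `Spec(L ⊗ k(X)) → Spec k(X)`. -/
def specLKsnd : S.specLK L ⟶ S.specK :=
  specActionMap (Algebra.TensorProduct.includeRight : S.K →ₐ[S.KG] L ⊗[S.KG] S.K).toRingHom
    fun g => RingHom.ext fun x => by
      change (1 : L) ⊗ₜ[S.KG] (g • x) = Algebra.TensorProduct.map _ _ (1 ⊗ₜ x)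
      simp

/-- The right action of `Gal(L/k(X)^G)` on `Spec(L ⊗ k(X))`. -/
def specLKRight (γ : L ≃ₐ[S.KG] L) : S.specLK L ⟶ S.specLK L :=
  specActionMap (Algebra.TensorProduct.map (γ : L →ₐ[S.KG] L) (AlgHom.id S.KG S.K)).toRingHom
    fun g => by
      change ((Algebra.TensorProduct.map _ _).comp (Algebra.TensorProduct.map _ _)).toRingHom =
        ((Algebra.TensorProduct.map _ _).comp (Algebra.TensorProduct.map _ _)).toRingHom
      rw [← Algebra.TensorProduct.map_comp, ← Algebra.TensorProduct.map_comp]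
      rfl

/-- The invariant invertible function `x ⊗ 1` on `Spec(L ⊗ k(X))`. -/
def specLKUnit (x : Lˣ) : invUnits (S.specLK L) :=
  specUnit (S.tensorAction L) (Units.map
    ((Algebra.TensorProduct.includeLeft : L →ₐ[S.KG] L ⊗[S.KG] S.K) : L →* L ⊗[S.KG] S.K) x)
    fun g => by
      change Algebra.TensorProduct.map _ _ ((x : L) ⊗ₜ[S.KG] (1 : S.K)) = (x : L) ⊗ₜ[S.KG] (1 : S.K)
      simp

end Tensor

/-- `α ∈ Br(k(X)^G)` is the restriction of `b ∈ Br([X/G])` to the generic point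
`[Spec k(X)/G] = Spec k(X)^G` of `[X/G]`: there are a finite Galois extension `L` of `k(X)^G` and a
2-cocycle `a` of `Gal(L/k(X)^G)` in `Lˣ`, with class `α` in Galois cohomology, such that the
restriction of `b` is the image of `a` under the edge map of the Hochschild-Serre spectral sequence
of the torsor `[Spec(L ⊗ k(X))/G] → [Spec k(X)/G]`, that is of `Spec L → Spec k(X)^G`. -/
def RestrictsTo [Finite G] (b : StackBr S.X) (α : Br S.KG S.Kbar) : Prop :=
  ∃ (L : IntermediateField S.KG S.Kbar) (_ : FiniteDimensional S.KG L) (_ : IsGalois S.KG L)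
    (a : Z2 (unitsRep (L ≃ₐ[S.KG] L) L)),
    galInflation S.Kbar S.KG L (H2.mk _ a) = α ∧
    IsEdgeClass (S.specLKsnd L) (S.specLKRight L)
      (fun p => gmSection (S.specLKUnit L (a.1 p).toMul)) (StackH.pullback S.generic b)


end GSurface
end Surface

end BrauerResidue

open BrauerResidue

/-! The class at the generic point is explicit. Pulled back to `Spec k(X)`, the class `b` is the
edge class of the cocycle `β` for the trivial torsor and also that of a Galois cocycle representing
`α`. Both are compared in one injective resolution of `Gm` over the `G`-scheme induced from a
geometric point, where every covering splits and the sections of `Gm` are the units of the algebraic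
closure. It follows that `α` is the inflation of the image of `β` in H²(G, k(X)ˣ)
(`GSurface.eq_fixedInflation`).

The local ring at `ξ` is a discrete valuation ring with residue field of characteristic zero, so the
tame character embeds the inertia group in k(ξ)ˣ and this group is cyclic (`isCyclic_inertia`).
Since kˣ is divisible, H²(I_ξ, kˣ) = 0 (`exists_coboundary_of_isCyclic`), hence the restriction of
the class to I_ξ is trivial. Inflation-restriction in degree two, available because of Hilbert 90,
produces the lift `γ` of (ii) (`exists_inflation_eq`).

For the residue, let F be k(X)^G or k(X)^{D_ξ}, let Ω be the algebraic closure and A₀ a valuation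
ring of Ω above O_ξ. All places of Ω above O_ξ ∩ F are conjugate (`IsPlaceOver.exists_conj`), so the
one defining the residue has a valuation ring A = gA₀. An element of the decomposition group of A,
conjugated back by g, preserves A₀ and therefore restricts to an automorphism of k(X) over F
preserving O_ξ. Such an automorphism belongs to D_ξ: for F = k(X)^G this is `GSurface.mem_D`, for F
= k(X)^{D_ξ} it is Galois theory. Thus the decomposition group maps to D_ξ and its inertia group
I(A) to I_ξ. Conjugation being trivial on cohomology, the image of `γ` inflates to the restriction
of the class to the decomposition group. By Hilbert 90 it is the only class that does so
(`inflation_inertia_injective`).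

It remains to compare valuations. The field Ω^{I(A)} has the same value group as F
(`exists_base_valuation_eq`), so k(X)^{I_ξ} → Ω^{I(A)} preserves normalized valuations. Hence the
residue is the image of `γ` described in (iii) (`isResidue_iff`). This description does not involve
F, which gives (i). The connecting homomorphism is bijective for a compact group
(`bockstein_injective`, `bockstein_surjective`), so the residue exists and is unique. -/

namespace BrauerResidue

/-! ### Functoriality of continuous cohomology in degree two -/

section CohomologyLemmas

variable {Γ Γ' Γ'' M M' M'' : Type*} [Group Γ] [TopologicalSpace Γ] [Group Γ'] [TopologicalSpace Γ']
  [Group Γ''] [TopologicalSpace Γ''] [AddCommGroup M] [AddCommGroup M'] [AddCommGroup M'']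
  {ρ : Γ →* AddMonoid.End M} {ρ' : Γ' →* AddMonoid.End M'} {ρ'' : Γ'' →* AddMonoid.End M''}

lemma H2.mk_surjective (ρ : Γ →* AddMonoid.End M) : Function.Surjective (H2.mk ρ) :=
  QuotientAddGroup.mk'_surjective _

lemma H2.mk_eq_mk_iff (a b : Z2 ρ) : H2.mk ρ a = H2.mk ρ b ↔
    ∃ c : Γ → M, IsLocallyConstant c ∧
      ∀ g h, a.1 (g, h) = b.1 (g, h) + (ρ g (c h) - c (g * h) + c g) := by
  rw [eq_comm]
  refine QuotientAddGroup.eq.trans ?_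
  rw [AddSubgroup.mem_addSubgroupOf]
  constructor
  · rintro ⟨c, hc, h⟩
    refine ⟨c, hc, fun g k => ?_⟩
    have h1 : -b.1 (g, k) + a.1 (g, k) = _ := congrFun h (g, k)
    rw [neg_add_eq_iff_eq_add] at h1
    exact h1
  · rintro ⟨c, hc, h⟩
    refine ⟨c, hc, funext fun p => ?_⟩
    change -b.1 p + a.1 p = _
    rw [neg_add_eq_iff_eq_add]
    exact h p.1 p.2

lemma H2.map_mk (φ : Γ' →ₜ* Γ) (m : M →+ M') (hm : ∀ g x, m (ρ (φ g) x) = ρ' g (m x))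
    (z : Z2 ρ) : H2.map φ m hm (H2.mk ρ z) = H2.mk ρ' (Z2.map φ m hm z) := rfl

/-- The composite is an argument of its own, compared pointwise with the two factors. One map can
then be factored through different intermediate groups by checking identities of elements only. -/
lemma H2.map_map (φ : Γ' →ₜ* Γ) (m : M →+ M') (hm : ∀ g x, m (ρ (φ g) x) = ρ' g (m x))
    (φ' : Γ'' →ₜ* Γ') (m' : M' →+ M'') (hm' : ∀ g x, m' (ρ' (φ' g) x) = ρ'' g (m' x))
    (φ'' : Γ'' →ₜ* Γ) (m'' : M →+ M'') (hm'' : ∀ g x, m'' (ρ (φ'' g) x) = ρ'' g (m'' x))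
    (h₁ : ∀ g, φ (φ' g) = φ'' g) (h₂ : ∀ x, m' (m x) = m'' x) (x : H2 ρ) :
    H2.map φ' m' hm' (H2.map φ m hm x) = H2.map φ'' m'' hm'' x := by
  obtain ⟨z, rfl⟩ := H2.mk_surjective ρ x
  rw [map_mk, map_mk, map_mk]
  congr 1
  refine Subtype.ext (funext fun p => ?_)
  change m' (m (z.1 (φ (φ' p.1), φ (φ' p.2)))) = m'' (z.1 (φ'' p.1, φ'' p.2))
  rw [h₁, h₁, h₂]

/-- Conjugation acts trivially on cohomology. -/
lemma H2.map_conj (φ : Γ' →ₜ* Γ) (m : M →+ M') (hm : ∀ g x, m (ρ (φ g) x) = ρ' g (m x))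
    (φ₁ : Γ' →ₜ* Γ) (m₁ : M →+ M') (hm₁ : ∀ g x, m₁ (ρ (φ₁ g) x) = ρ' g (m₁ x)) (t : Γ)
    (h₁ : ∀ g, φ₁ g * t = t * φ g) (h₂ : ∀ x, m x = m₁ (ρ t x)) (x : H2 ρ) :
    H2.map φ m hm x = H2.map φ₁ m₁ hm₁ x := by
  obtain ⟨z, rfl⟩ := H2.mk_surjective ρ x
  rw [map_mk, map_mk, H2.mk_eq_mk_iff]
  refine ⟨fun g => m₁ (z.1 (t, φ g) - z.1 (φ₁ g, t)), ?_, fun g h => ?_⟩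
  · refine IsLocallyConstant.comp (IsLocallyConstant.sub ?_ ?_) m₁
    · exact z.2.1.comp_continuous (Continuous.prodMk continuous_const φ.continuous_toFun)
    · exact z.2.1.comp_continuous (Continuous.prodMk φ₁.continuous_toFun continuous_const)
  · change m (z.1 (φ g, φ h)) = m₁ (z.1 (φ₁ g, φ₁ h)) + _
    rw [← hm₁, h₂]
    simp only [← map_add, ← map_sub]
    congr 1
    -- The cocycle identity with `t` inserted between, after and before the two group elements. The
    -- combination `e2 - e1 + e3` is the claim.
    have e1 := z.2.2 (φ₁ g) t (φ h)
    have e2 := z.2.2 (φ₁ g) (φ₁ h) t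
    have e3 := z.2.2 t (φ g) (φ h)
    rw [h₁] at e1 e2
    rw [map_mul, map_mul, map_sub]
    rw [← sub_eq_zero] at e1 e2 e3 ⊢
    have := congrArg₂ (· + ·) (congrArg₂ (· - ·) e2 e1) e3
    simp only [sub_zero, add_zero] at this
    rw [← this]
    abel

lemma isLocallyConstant_of_comp_mk {N : Subgroup Γ} {X : Type*} {f : Γ ⧸ N → X}
    (h : IsLocallyConstant fun g : Γ => f g) : IsLocallyConstant f := fun s => by
  exact isQuotientMap_quotient_mk'.isOpen_preimage.1 (h s)

end CohomologyLemmas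

/-! ### The connecting isomorphism H¹(Γ, ℚ/ℤ) ≅ H²(Γ, ℤ) for compact Γ -/

section Bockstein

variable {Γ : Type*} [Group Γ] [TopologicalSpace Γ]

lemma exists_int_of_coe_eq {a b : ℚ} (h : (a : AddCircle (1 : ℚ)) = b) : ∃ n : ℤ, a = b + n := by
  rw [← sub_eq_zero, ← AddCircle.coe_sub] at h
  obtain ⟨n, hn⟩ := (AddCircle.coe_eq_zero_iff (1 : ℚ)).1 h
  rw [zsmul_eq_mul, mul_one] at hn
  exact ⟨n, by rw [hn]; ring⟩

lemma H1QZ.isLocallyConstant_lift (χ : H1QZ Γ) : IsLocallyConstant χ.lift :=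
  χ.2.comp fun a : Multiplicative (AddCircle (1 : ℚ)) =>
    haveI : Fact ((0 : ℚ) < 1) := ⟨one_pos⟩
    (AddCircle.equivIco (1 : ℚ) 0 a.toAdd : ℚ)

/-- A locally constant function on a compact space has finitely many values, whereas the multiples
of a nonzero rational number are infinitely many. -/
lemma monoidHom_rat_eq_zero [CompactSpace Γ] (f : Γ → ℚ) (hf : IsLocallyConstant f)
    (h : ∀ a b, f (a * b) = f a + f b) (g : Γ) : f g = 0 := by
  by_contra hg
  have h1 : f 1 = 0 := by have := h 1 1; rw [mul_one] at this; linarith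
  have hp : ∀ n : ℕ, f (g ^ n) = n * f g := fun n => by
    induction n with
    | zero => simp [h1]
    | succ n ih => rw [pow_succ, h, ih]; push_cast; ring
  have : (Set.range f).Finite := hf.range_finite
  refine Set.infinite_range_of_injective (f := fun n : ℕ => (n : ℚ) * f g) ?_
    (this.subset ?_)
  · intro a b hab
    exact_mod_cast mul_right_cancel₀ hg hab
  · rintro _ ⟨n, rfl⟩
    exact ⟨g ^ n, hp n⟩

/-- If the two integral cocycles differ by the coboundary of `c`, then the difference of the
rational lifts minus `c` is a continuous homomorphism to ℚ, hence zero. So the lifts agree modulo ℤ.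
-/
lemma bockstein_injective [CompactSpace Γ] : Function.Injective (bockstein (Γ := Γ)) := by
  intro χ χ' h
  obtain ⟨c, hc, h⟩ := (H2.mk_eq_mk_iff _ _).1 h
  have key : ∀ g, χ.lift g - χ'.lift g - c g = 0 := by
    refine monoidHom_rat_eq_zero _ ((χ.isLocallyConstant_lift.sub χ'.isLocallyConstant_lift).sub
      (hc.comp (Int.cast : ℤ → ℚ))) fun a b => ?_
    have h1 : (⌊χ.lift a + χ.lift b⌋ : ℤ) = ⌊χ'.lift a + χ'.lift b⌋ + (c b - c (a * b) + c a) :=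
      h a b
    have h2 : ((⌊χ.lift a + χ.lift b⌋ : ℤ) : ℚ) =
        ((⌊χ'.lift a + χ'.lift b⌋ : ℤ) : ℚ) + (c b - c (a * b) + c a) := by exact_mod_cast h1
    rw [H1QZ.lift_add, H1QZ.lift_add] at h2
    linarith
  refine Subtype.ext (MonoidHom.ext fun g => Multiplicative.toAdd.injective ?_)
  rw [← H1QZ.coe_lift, ← H1QZ.coe_lift]
  have : χ.lift g = χ'.lift g + c g := by linarith [key g]
  rw [this, AddCircle.coe_add, (AddCircle.coe_eq_zero_iff (1 : ℚ) (x := (c g : ℚ))).2 ⟨c g, by simp⟩, add_zero]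

/-- A locally constant function of two variables on a compact group is invariant under right
translation of the second variable by an open subgroup. -/
lemma exists_open_subgroup_invariant [IsTopologicalGroup Γ] [CompactSpace Γ] {X : Type*}
    (f : Γ × Γ → X) (hf : IsLocallyConstant f) :
    ∃ U : Subgroup Γ, IsOpen (U : Set Γ) ∧ ∀ g h, ∀ u ∈ U, f (g, h * u) = f (g, h) := by
  let U : Subgroup Γ :=
    { carrier := {u | ∀ g h, f (g, h * u) = f (g, h)}
      one_mem' := fun g h => by rw [mul_one]
      mul_mem' := fun {a b} ha hb g h => by rw [← mul_assoc, hb, ha]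
      inv_mem' := fun {a} ha g h => by
        have := ha g (h * a⁻¹)
        rw [inv_mul_cancel_right] at this
        exact this.symm }
  refine ⟨U, ?_, fun g h u hu => hu g h⟩
  -- An open set containing Γ × Γ × {1}. By compactness and the tube lemma it contains Γ × Γ × B for
  -- a neighbourhood B of 1.
  let W : Set ((Γ × Γ) × Γ) := {p | f (p.1.1, p.1.2 * p.2) = f p.1}
  have hW : IsOpen W := by
    have h1 : IsLocallyConstant fun p : (Γ × Γ) × Γ => (f (p.1.1, p.1.2 * p.2), f p.1) :=
      (hf.comp_continuous (f := fun p : (Γ × Γ) × Γ => (p.1.1, p.1.2 * p.2)) (by fun_prop)).prodMk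
        (hf.comp_continuous continuous_fst)
    exact h1 {q | q.1 = q.2}
  obtain ⟨A, B, hA, hB, hA', hB', hAB⟩ := generalized_tube_lemma (s := (Set.univ : Set (Γ × Γ)))
    (t := ({1} : Set Γ)) isCompact_univ isCompact_singleton hW (by
      rintro ⟨⟨a, b⟩, c⟩ ⟨-, hc⟩
      have : c = 1 := hc
      change f (a, b * c) = f (a, b)
      rw [this, mul_one])
  refine Subgroup.isOpen_of_mem_nhds U (g := 1) (Filter.mem_of_superset (hB.mem_nhds (hB' rfl)) ?_)
  intro u hu g h
  exact hAB (a := ((g, h), u)) ⟨hA' trivial, hu⟩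

/-- An integral cocycle becomes a coboundary over ℚ by averaging it over a finite quotient Γ/U in
its second variable. The averaging cochain `l` is additive modulo ℤ, so it is a character with the
given image. -/
lemma bockstein_surjective [IsTopologicalGroup Γ] [CompactSpace Γ] :
    Function.Surjective (bockstein (Γ := Γ)) := by
  intro x
  obtain ⟨⟨f, hf, hcoc⟩, rfl⟩ := H2.mk_surjective _ x
  obtain ⟨U, hU, hUf⟩ := exists_open_subgroup_invariant f hf
  have : Finite (Γ ⧸ U) := Subgroup.quotient_finite_of_isOpen U hU
  have : Fintype (Γ ⧸ U) := Fintype.ofFinite _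
  let F (g : Γ) : Γ ⧸ U → ℤ := fun q => Quotient.liftOn' q (fun h => f (g, h)) fun a b hab => by
    have := hUf g a (a⁻¹ * b) (QuotientGroup.leftRel_apply.1 hab)
    rw [mul_inv_cancel_left] at this
    exact this.symm
  have hF : ∀ g h : Γ, F g (h : Γ ⧸ U) = f (g, h) := fun _ _ => rfl
  let n : ℚ := Fintype.card (Γ ⧸ U)
  have hn : n ≠ 0 := by
    have : Nonempty (Γ ⧸ U) := ⟨((1 : Γ) : Γ ⧸ U)⟩
    exact Nat.cast_ne_zero.2 Fintype.card_ne_zero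
  let l (g : Γ) : ℚ := (∑ q, F g q : ℤ) / n
  have hl : ∀ g h, l g + l h - l (g * h) = f (g, h) := fun g h => by
    -- The cocycle identity summed over the last variable in Γ/U. Translation by `h` permutes the
    -- cosets.
    have h1 : ∑ q, F h q + ∑ q, F g q = ∑ q, F (g * h) q + Fintype.card (Γ ⧸ U) * f (g, h) := by
      have h2 : ∑ q, F g q = ∑ q : Γ ⧸ U, F g (h • q) :=
        (Equiv.sum_comp (MulAction.toPerm h) (F g)).symm
      rw [h2, ← Finset.sum_add_distrib, ← smul_eq_mul, ← nsmul_eq_mul, ← Finset.card_univ,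
        ← Finset.sum_const, ← Finset.sum_add_distrib]
      refine Finset.sum_congr rfl fun q _ => ?_
      induction q using QuotientGroup.induction_on with
      | H j => exact hcoc g h j
    have h2 : ((∑ q, F h q : ℤ) : ℚ) + (∑ q, F g q : ℤ) = (∑ q, F (g * h) q : ℤ) + n * f (g, h) := by
      simp only [n]
      exact_mod_cast h1
    simp only [l]
    field_simp
    linarith
  have hlc : IsLocallyConstant l := by
    have h0 : IsLocallyConstant fun g => F g := by
      rw [IsLocallyConstant.iff_exists_open]
      intro g
      choose V hV hgV hVf using fun q : Γ ⧸ U => (IsLocallyConstant.iff_exists_open _).1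
        (hf.comp_continuous (f := fun g : Γ => (g, q.out)) (by fun_prop)) g
      refine ⟨⋂ q, V q, isOpen_iInter_of_finite hV, Set.mem_iInter.2 hgV, fun g' hg' => ?_⟩
      funext q
      have := hVf q g' (Set.mem_iInter.1 hg' q)
      rw [← QuotientGroup.out_eq' q, hF, hF]
      exact this
    exact h0.comp fun F' : Γ ⧸ U → ℤ => ((∑ q, F' q : ℤ) : ℚ) / n
  let χ : H1QZ Γ := ⟨MonoidHom.mk' (fun g => Multiplicative.ofAdd ((l g : ℚ) : AddCircle (1 : ℚ)))
    fun a b => by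
      rw [← ofAdd_add, ← AddCircle.coe_add]
      congr 1
      have h1 : l a + l b = l (a * b) + f (a, b) := by linarith [hl a b]
      rw [h1, AddCircle.coe_add, (AddCircle.coe_eq_zero_iff (1 : ℚ) (x := (f (a, b) : ℚ))).2 ⟨f (a, b), by simp⟩,
        add_zero], hlc.comp _⟩
  -- The lift of `χ` to `[0, 1)` need not be `l`; the integers by which they differ form the
  -- required cochain.
  have hχ : ∀ g, ∃ m : ℤ, χ.lift g = l g + m := fun g => exists_int_of_coe_eq (χ.coe_lift g)
  choose c hc using hχ
  refine ⟨χ, (H2.mk_eq_mk_iff _ _).2 ⟨c, ?_, fun g h => ?_⟩⟩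
  · have : c = fun g => ⌊χ.lift g - l g⌋ := funext fun g => by
      rw [hc, add_sub_cancel_left, Int.floor_intCast]
    rw [this]
    exact (χ.isLocallyConstant_lift.sub hlc).comp _
  · change ⌊χ.lift g + χ.lift h⌋ = f (g, h) + (c h - c (g * h) + c g)
    have : ((⌊χ.lift g + χ.lift h⌋ : ℤ) : ℚ) = f (g, h) + (c h - c (g * h) + c g) := by
      rw [H1QZ.lift_add, ← hl, hc, hc, hc]
      ring
    exact_mod_cast this

end Bockstein

/-! ### Hilbert's Theorem 90 -/

section Hilbert90

/-- The action on units as an action on `Additive Eˣ`, on the level of elements. -/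
lemma unitsRep_apply_coe {Γ E : Type*} [Group Γ] [CommRing E] [MulSemiringAction Γ E] (g : Γ)
    (x : Additive Eˣ) : ((unitsRep Γ E g x).toMul : E) = g • (x.toMul : E) := rfl

/-- Hilbert's Theorem 90: a multiplicative cocycle of a group of automorphisms of a field `E` is
trivial if its values at `g` only depend on the restriction of `g` to a subfield `L` on which the
group has a finite number of different restrictions. -/
lemma exists_of_cocycle {Γ E L : Type*} [Group Γ] [Field E] [Field L] [MulSemiringAction Γ E]
    (i : L →+* E) (hfin : (Set.range fun (g : Γ) (x : L) => g • i x).Finite) (c : Γ → Additive Eˣ)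
    (hc : ∀ g h, c (g * h) = unitsRep Γ E g (c h) + c g)
    (hL : ∀ g h, (∀ x : L, g • i x = h • i x) → c g = c h) :
    ∃ a : Additive Eˣ, ∀ g, c g = unitsRep Γ E g a - a := by
  classical
  let r : Γ → (L →* E) := fun g => ((MulSemiringAction.toRingHom Γ E g).comp i : L →+* E)
  have hr : (Set.range r).Finite := by
    refine Set.Finite.of_finite_image (f := fun (m : L →* E) (x : L) => m x) (hfin.subset ?_)
      fun a _ b _ h => MonoidHom.ext (congrFun h)
    rintro _ ⟨_, ⟨g, rfl⟩, rfl⟩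
    exact ⟨g, rfl⟩
  have : Fintype (Set.range r) := hr.fintype
  let s : Set.range r → Γ := fun t => t.2.choose
  have hs : ∀ t, r (s t) = t := fun t => t.2.choose_spec
  have hcr : ∀ g h, r g = r h → c g = c h := fun g h e => hL g h fun x => DFunLike.congr_fun e x
  -- The Poincaré series of the cocycle, with one term for each restriction to `L`. Independence of
  -- characters gives a point where it does not vanish.
  let P : L → E := fun y => ∑ t : Set.range r, ((c (s t)).toMul : E) * (t : L →* E) y
  obtain ⟨y, hy⟩ : ∃ y, P y ≠ 0 := by
    by_contra! hP
    have hli := (linearIndependent_monoidHom L E).comp (fun t : Set.range r => (t : L →* E))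
      Subtype.val_injective
    rw [Fintype.linearIndependent_iff] at hli
    have := hli (fun t => ((c (s t)).toMul : E)) (by
      funext y
      simpa [P] using hP y) ⟨r 1, 1, rfl⟩
    exact Units.ne_zero _ this
  have key : ∀ g : Γ, ((c g).toMul : E) * g • P y = P y := fun g => by
    -- Left multiplication by `g` permutes the restrictions, so it only reorders the terms of the
    -- series.
    let e : Set.range r ≃ Set.range r :=
      { toFun := fun t => ⟨r (g * s t), _, rfl⟩
        invFun := fun t => ⟨r (g⁻¹ * s t), _, rfl⟩
        left_inv := fun t => Subtype.ext (by
          have h1 := hs ⟨r (g * s t), _, rfl⟩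
          refine Eq.trans ?_ (hs t)
          refine MonoidHom.ext fun x => ?_
          have h2 := DFunLike.congr_fun h1 x
          change (g⁻¹ * s ⟨r (g * s t), _, rfl⟩) • i x = s t • i x
          change s ⟨r (g * s t), _, rfl⟩ • i x = (g * s t) • i x at h2
          rw [mul_smul, h2, mul_smul, inv_smul_smul])
        right_inv := fun t => Subtype.ext (by
          have h1 := hs ⟨r (g⁻¹ * s t), _, rfl⟩
          refine Eq.trans ?_ (hs t)
          refine MonoidHom.ext fun x => ?_
          have h2 := DFunLike.congr_fun h1 x
          change (g * s ⟨r (g⁻¹ * s t), _, rfl⟩) • i x = s t • i x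
          change s ⟨r (g⁻¹ * s t), _, rfl⟩ • i x = (g⁻¹ * s t) • i x at h2
          rw [mul_smul, h2, mul_smul, smul_inv_smul]) }
    simp only [P]
    rw [Finset.smul_sum, Finset.mul_sum, ← Equiv.sum_comp e
      (fun t : Set.range r => ((c (s t)).toMul : E) * (t : L →* E) y)]
    refine Finset.sum_congr rfl fun t _ => ?_
    have h1 : c (s (e t)) = c (g * s t) := hcr _ _ (hs _)
    rw [h1, hc, smul_mul', toMul_add, Units.val_mul, unitsRep_apply_coe]
    have h2 : ((e t : Set.range r) : L →* E) y = g • (t : L →* E) y := by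
      change (g * s t) • i y = g • (t : L →* E) y
      rw [← hs t, mul_smul]
      rfl
    rw [h2]
    ring
  refine ⟨-Additive.ofMul (Units.mk0 (P y) hy), fun g => ?_⟩
  apply Additive.toMul.injective
  apply Units.ext
  rw [map_neg, sub_neg_eq_add, toMul_add, toMul_neg, Units.val_mul, Units.val_inv_eq_inv_val,
    unitsRep_apply_coe]
  change ((c g).toMul : E) = (g • P y)⁻¹ * P y
  have hg : g • P y ≠ 0 := (smul_ne_zero_iff_ne g).2 hy
  rw [eq_inv_mul_iff_mul_eq₀ hg, mul_comm, key]

/-- Hilbert's Theorem 90 for a finite group. -/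
lemma exists_of_cocycle_of_finite {Γ E : Type*} [Group Γ] [Finite Γ] [Field E]
    [MulSemiringAction Γ E] [FaithfulSMul Γ E] (c : Γ → Additive Eˣ)
    (hc : ∀ g h, c (g * h) = unitsRep Γ E g (c h) + c g) :
    ∃ a : Additive Eˣ, ∀ g, c g = unitsRep Γ E g a - a :=
  exists_of_cocycle (RingHom.id E) (Set.finite_range _) c hc fun g h e => by
    rw [FaithfulSMul.eq_of_smul_eq_smul (α := E) e]

end Hilbert90

/-! ### Inflation and restriction in degree two -/

section InflationRestriction

variable {Δ E : Type*} [Group Δ] [Field E] [MulSemiringAction Δ E] (N : Subgroup Δ)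

/-- The inclusion of the units of the fixed field. -/
abbrev fixedUnits : Additive (FixedPoints.subfield N E)ˣ →+ Additive Eˣ :=
  (Units.map ((FixedPoints.subfield N E).subtype : _ →* E)).toAdditive

lemma fixedUnits_injective : Function.Injective (fixedUnits (E := E) N) := by
  intro x y h
  apply Additive.toMul.injective
  apply Units.ext
  apply Subtype.ext
  exact congrArg Units.val (congrArg Additive.toMul h)

lemma exists_fixedUnits (x : Additive Eˣ) (hx : ∀ n ∈ N, unitsRep Δ E n x = x) :
    ∃ y, fixedUnits N y = x := by
  have h : (x.toMul : E) ∈ FixedPoints.subfield N E := fun n =>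
    congrArg Units.val (congrArg Additive.toMul (hx n n.2))
  refine ⟨Additive.ofMul (Units.mk0 ⟨x.toMul, h⟩ fun h0 => x.toMul.ne_zero ?_), ?_⟩
  · exact congrArg Subtype.val h0
  · apply Additive.toMul.injective
    apply Units.ext
    rfl

lemma unitsRep_fixedUnits (n : Δ) (hn : n ∈ N) (y : Additive (FixedPoints.subfield N E)ˣ) :
    unitsRep Δ E n (fixedUnits N y) = fixedUnits N y := by
  apply Additive.toMul.injective
  apply Units.ext
  exact (y.toMul : FixedPoints.subfield N E).2 ⟨n, hn⟩

variable [N.Normal]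

lemma fixedUnits_unitsRep (g : Δ) (y : Additive (FixedPoints.subfield N E)ˣ) :
    fixedUnits N (unitsRep (Δ ⧸ N) (FixedPoints.subfield N E) g y) =
      unitsRep Δ E g (fixedUnits N y) := rfl

/-- Inflation in degree two is injective if the kernel of inflation satisfies Hilbert 90. -/
lemma inflation_injective [TopologicalSpace Δ]
    (h90 : ∀ c : N → Additive Eˣ, IsLocallyConstant c →
      (∀ m n : N, c (m * n) = unitsRep Δ E m (c n) + c m) →
      ∃ a : Additive Eˣ, ∀ n : N, c n = unitsRep Δ E n a - a)
    (hcont : ∀ a : Additive Eˣ, IsLocallyConstant fun g : Δ => unitsRep Δ E g a) :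
    Function.Injective (inflation (E := E) N) := by
  rw [injective_iff_map_eq_zero]
  intro x hx
  obtain ⟨f, rfl⟩ := H2.mk_surjective _ x
  rw [← map_zero (H2.mk _)] at hx ⊢
  obtain ⟨c, hc, hfc⟩ := (H2.mk_eq_mk_iff _ _).1 hx
  replace hfc : ∀ g h : Δ, fixedUnits N (f.1 (g, h)) =
      unitsRep Δ E g (c h) - c (g * h) + c g := fun g h => (hfc g h).trans (zero_add _)
  set u := fixedUnits N (f.1 (1, 1)) with hu
  have hr1 : ∀ q : Δ ⧸ N, f.1 (1, q) = f.1 (1, 1) := fun q => by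
    have := f.2.2 1 1 q
    rw [one_mul, one_mul, map_one] at this
    exact add_left_cancel this
  have hr2 : ∀ q : Δ ⧸ N, f.1 (q, 1) = unitsRep _ _ q (f.1 (1, 1)) := fun q => by
    have := f.2.2 q 1 1
    rw [mul_one, mul_one] at this
    exact (add_right_cancel this).symm
  have hmk : ∀ n ∈ N, ((n : Δ) : Δ ⧸ N) = 1 := fun n hn => (QuotientGroup.eq_one_iff n).2 hn
  obtain ⟨a, ha⟩ := h90 (fun n => c n - u)
    ((hc.comp_continuous continuous_subtype_val).sub (IsLocallyConstant.const u)) fun m n => by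
      have h1 := hfc m n
      rw [hmk m m.2, hmk n n.2] at h1
      have h2 : unitsRep Δ E m u = u := unitsRep_fixedUnits N _ m.2 _
      rw [map_sub, h2, Subgroup.coe_mul]
      change u = _ at h1
      rw [h1]
      abel
  -- Subtracting the coboundary of `a` does not change the coboundary of the cochain and makes it
  -- constant, equal to `u`, on `N`. It will then descend to the quotient: it is right `N`-invariant
  -- by `hR` and has `N`-fixed values by `hL`.
  let c1 : Δ → Additive Eˣ := fun g => c g - (unitsRep Δ E g a - a)
  have hc1 : IsLocallyConstant c1 := hc.sub ((hcont a).sub (IsLocallyConstant.const a))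
  have hf1 : ∀ g h : Δ, fixedUnits N (f.1 (g, h)) =
      unitsRep Δ E g (c1 h) - c1 (g * h) + c1 g := fun g h => by
    rw [hfc]
    simp only [c1, map_sub, map_mul]
    change _ = _ - _ - (_ - (unitsRep Δ E g (unitsRep Δ E h a) - a)) + _
    abel
  have hN1 : ∀ n ∈ N, c1 n = u := fun n hn => by
    have := ha ⟨n, hn⟩
    simp only [c1]
    rw [← this, sub_sub_cancel]
  have hR : ∀ g, ∀ n ∈ N, c1 (g * n) = c1 g := fun g n hn => by
    have h1 := hf1 g n
    rw [hmk n hn, hr2, fixedUnits_unitsRep, hN1 n hn, ← hu] at h1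
    rw [sub_add, eq_comm, sub_eq_self, sub_eq_zero] at h1
    exact h1
  have hL : ∀ g, ∀ n ∈ N, unitsRep Δ E n (c1 g) = c1 g := fun g n hn => by
    have h1 := hf1 n g
    have h2 : c1 (n * g) = c1 g := by
      have := hR g (g⁻¹ * n * g⁻¹⁻¹) (Subgroup.Normal.conj_mem inferInstance n hn g⁻¹)
      rw [← this]
      congr 1
      group
    rw [hmk n hn, hr1, ← hu, hN1 n hn, h2, right_eq_add] at h1
    exact sub_eq_zero.1 h1
  choose d hd using fun g => exists_fixedUnits N (c1 g) (hL g)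
  have hdq : ∀ g h : Δ, (g : Δ ⧸ N) = h → d g = d h := fun g h e => by
    apply fixedUnits_injective N
    rw [hd, hd, ← hR g _ (QuotientGroup.eq.1 e), mul_inv_cancel_left]
  rw [H2.mk_eq_mk_iff]
  refine ⟨fun q => d q.out, isLocallyConstant_of_comp_mk ?_, fun q r => ?_⟩
  · have h1 : (fun g : Δ => d (g : Δ ⧸ N).out) = d := funext fun g => hdq _ _ (by simp)
    change IsLocallyConstant (fun g : Δ => d (g : Δ ⧸ N).out)
    rw [h1]
    intro s
    have h2 : d ⁻¹' s = c1 ⁻¹' (fixedUnits N '' s) := by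
      ext g
      simp only [Set.mem_preimage, Set.mem_image]
      refine ⟨fun h => ⟨_, h, hd g⟩, ?_⟩
      rintro ⟨y, hy, hy'⟩
      rw [← hd g] at hy'
      rwa [← fixedUnits_injective N hy']
    rw [h2]
    exact hc1 _
  · induction q using QuotientGroup.induction_on with
    | H g =>
      induction r using QuotientGroup.induction_on with
      | H h =>
        apply fixedUnits_injective N
        have e : ∀ g : Δ, d (g : Δ ⧸ N).out = d g := fun g => hdq _ _ (by simp)
        change _ = fixedUnits N (0 + (unitsRep _ _ (g : Δ ⧸ N) (d (h : Δ ⧸ N).out) -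
          d ((g * h : Δ) : Δ ⧸ N).out + d (g : Δ ⧸ N).out))
        rw [hf1, e, e, e, zero_add, map_add, map_sub (fixedUnits (E := E) N), fixedUnits_unitsRep, hd, hd, hd]

/-- Exactness of inflation-restriction in degree two, for a finite group. -/
lemma exists_inflation_eq [Finite Δ] [TopologicalSpace Δ] [DiscreteTopology Δ] [FaithfulSMul Δ E]
    (f : Z2 (unitsRep Δ E)) (c : N → Additive Eˣ)
    (hc : ∀ m n : N, f.1 (m, n) = unitsRep Δ E m (c n) - c (m * n) + c m) :
    ∃ x, inflation N x = H2.mk (unitsRep Δ E) f := by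
  classical
  let ρ := unitsRep Δ E
  have hmk : ∀ n ∈ N, ((n : Δ) : Δ ⧸ N) = 1 := fun n hn => (QuotientGroup.eq_one_iff n).2 hn
  have hsub : ∀ (f : Z2 ρ) (b : Δ → Additive Eˣ), ∃ f' : Z2 ρ, H2.mk ρ f = H2.mk ρ f' ∧
      ∀ g h, f'.1 (g, h) = f.1 (g, h) - (ρ g (b h) - b (g * h) + b g) := fun f b => by
    have hb : d1 ρ b ∈ Z2 ρ := ⟨.of_discrete _, fun g h j => by
      simp only [d1, map_add, map_sub, map_mul, mul_assoc]
      change ρ g (ρ h (b j)) - _ + _ + _ = ρ g (ρ h (b j)) - _ + _ + _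
      abel⟩
    refine ⟨f - ⟨_, hb⟩, (H2.mk_eq_mk_iff _ _).2 ⟨b, .of_discrete _, fun g h => ?_⟩,
      fun g h => rfl⟩
    change _ = f.1 (g, h) - (ρ g (b h) - b (g * h) + b g) + _
    abel
  -- first make `f` vanish on `N × N`
  obtain ⟨f1, hf1, hf1'⟩ := hsub f fun g => if hg : g ∈ N then c ⟨g, hg⟩ else 0
  have h1 : ∀ m ∈ N, ∀ n ∈ N, f1.1 (m, n) = 0 := fun m hm n hn => by
    rw [hf1', dif_pos hm, dif_pos hn, dif_pos (mul_mem hm hn), sub_eq_zero]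
    exact hc ⟨m, hm⟩ ⟨n, hn⟩
  -- then on `Δ × N`
  let r : Δ → Δ := fun g => (g : Δ ⧸ N).out
  have hr : ∀ g, (r g)⁻¹ * g ∈ N := fun g => QuotientGroup.eq.1 (by simp [r])
  have hrn : ∀ g, ∀ n ∈ N, r (g * n) = r g := fun g n hn => by
    simp only [r]
    rw [QuotientGroup.mk_mul, hmk n hn, mul_one]
  -- As `f1` vanishes on `N × N`, the cocycle identity at `(r g, (r g)⁻¹ * g, n)` shows that `f1 (g,
  -- n)` is a difference of values `f1 (r g, ·)`. This dictates the cochain.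
  obtain ⟨f2, hf2, hf2'⟩ := hsub f1 fun g => - f1.1 (r g, (r g)⁻¹ * g)
  have h2 : ∀ g, ∀ n ∈ N, f2.1 (g, n) = 0 := fun g n hn => by
    have hr1 : r n ∈ N := by
      have := mul_mem hn (inv_mem (hr n))
      rwa [mul_inv_rev, inv_inv, mul_inv_cancel_left] at this
    rw [hf2', h1 _ hr1 _ (hr n), hrn g n hn, ← mul_assoc, neg_zero, map_zero]
    have h3 := f1.2.2 (r g) ((r g)⁻¹ * g) n
    rw [h1 _ (hr g) _ hn, map_zero, zero_add, mul_inv_cancel_left] at h3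
    rw [h3]
    abel
  have h2R : ∀ g h, ∀ n ∈ N, f2.1 (g, h * n) = f2.1 (g, h) := fun g h n hn => by
    have := f2.2.2 g h n
    rwa [h2 _ n hn, h2 _ n hn, map_zero, zero_add, zero_add] at this
  have hconj : ∀ g, ∀ n ∈ N, g⁻¹ * n * g ∈ N := fun g n hn => by
    have := Subgroup.Normal.conj_mem (inferInstance : N.Normal) n hn g⁻¹
    rwa [inv_inv] at this
  have h2L : ∀ g h, ∀ n ∈ N, f2.1 (g, n * h) = f2.1 (g, h) := fun g h n hn => by
    rw [← h2R g h _ (hconj h n hn)]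
    group
  -- With the second argument fixed, `f2` is now a 1-cocycle of `N` in the first one, so Hilbert 90
  -- applies.
  have h3 : ∀ h, ∃ a : Additive Eˣ, ∀ n ∈ N, f2.1 (n, h) = ρ n a - a := fun h => by
    obtain ⟨a, ha⟩ := exists_of_cocycle_of_finite (Γ := N) (E := E) (fun n => f2.1 (n, h))
      fun m n => by
        have := f2.2.2 m n h
        rw [h2 m n n.2, add_zero, h2L _ _ n n.2] at this
        exact this.symm
    exact ⟨a, fun n hn => ha ⟨n, hn⟩⟩
  choose a ha using h3
  -- The cochain is zero on `N` and depends only on the coset, so that subtracting its coboundary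
  -- preserves the vanishing on `Δ × N` and creates vanishing on `N × Δ`.
  obtain ⟨f3, hf3, hf3'⟩ := hsub f2 fun g => if g ∈ N then 0 else a (r g)
  let b : Δ → Additive Eˣ := fun g => if g ∈ N then 0 else a (r g)
  have hbN : ∀ n ∈ N, b n = 0 := fun n hn => if_pos hn
  have hbR : ∀ g, ∀ n ∈ N, b (g * n) = b g := fun g n hn => by
    simp only [b, hrn g n hn, Subgroup.mul_mem_cancel_right N hn]
  have hbL : ∀ g, ∀ n ∈ N, b (n * g) = b g := fun g n hn => by
    rw [← hbR g _ (hconj g n hn)]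
    congr 1
    group
  have hb : ∀ h, ∀ n ∈ N, f2.1 (n, h) = ρ n (b h) - b h := fun h n hn => by
    by_cases hh : h ∈ N
    · rw [h2 n h hh, hbN h hh, map_zero, sub_zero]
    · have : b h = a (r h) := if_neg hh
      rw [this, ← ha _ n hn, ← h2R n (r h) _ (hr h), mul_inv_cancel_left]
  replace hf3' : ∀ g h, f3.1 (g, h) = f2.1 (g, h) - (ρ g (b h) - b (g * h) + b g) := hf3'
  have h4 : ∀ n ∈ N, ∀ h, f3.1 (n, h) = 0 := fun n hn h => by
    rw [hf3', hb h n hn, hbL h n hn, hbN n hn]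
    abel
  have h5 : ∀ g, ∀ n ∈ N, f3.1 (g, n) = 0 := fun g n hn => by
    rw [hf3', h2 g n hn, hbN n hn, hbR g n hn, map_zero]
    abel
  have h6 : ∀ g h, ∀ n ∈ N, f3.1 (g, h * n) = f3.1 (g, h) := fun g h n hn => by
    have := f3.2.2 g h n
    rwa [h5 _ n hn, h5 _ n hn, map_zero, zero_add, zero_add] at this
  have h7 : ∀ g h, ∀ n ∈ N, f3.1 (g * n, h) = f3.1 (g, h) := fun g h n hn => by
    have := f3.2.2 g n h
    rw [h4 n hn, h5 g n hn, map_zero, zero_add, add_zero] at this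
    rw [← this, ← h6 g h _ (hconj h n hn)]
    group
  -- Once `f3` vanishes as soon as one argument is in `N`, the cocycle identity also forces its
  -- values to be fixed by `N`. Thus it comes from the quotient and the fixed field.
  have h8 : ∀ g h, ∀ n ∈ N, ρ n (f3.1 (g, h)) = f3.1 (g, h) := fun g h n hn => by
    have := f3.2.2 n g h
    rw [h4 n hn, h4 n hn, add_zero, add_zero] at this
    rw [this, ← h7 g h _ (hconj g n hn)]
    group
  choose y hy using fun p : Δ × Δ => exists_fixedUnits N (f3.1 p) (h8 p.1 p.2)
  have hyq : ∀ g h : Δ, y ((g : Δ ⧸ N).out, (h : Δ ⧸ N).out) = y (g, h) := fun g h => by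
    apply fixedUnits_injective N
    rw [hy, hy, ← h7 _ _ _ (hr g), ← h6 _ _ _ (hr h), mul_inv_cancel_left, mul_inv_cancel_left]
  refine ⟨H2.mk _ ⟨fun p => y (p.1.out, p.2.out), ?_, ?_⟩, ?_⟩
  · have : DiscreteTopology (Δ ⧸ N) := inferInstance
    exact .of_discrete _
  · intro p q s
    induction p using QuotientGroup.induction_on with
    | H g =>
      induction q using QuotientGroup.induction_on with
      | H h =>
        induction s using QuotientGroup.induction_on with
        | H j =>
          apply fixedUnits_injective N
          simp only [← QuotientGroup.mk_mul, hyq, map_add, fixedUnits_unitsRep, hy]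
          exact f3.2.2 g h j
  · rw [hf1, hf2, hf3]
    refine congrArg (H2.mk _) (Subtype.ext (funext fun p => ?_))
    change fixedUnits N (y ((p.1 : Δ ⧸ N).out, (p.2 : Δ ⧸ N).out)) = _
    rw [hyq, hy]

end InflationRestriction

/-- A 2-cocycle of a finite cyclic group in a divisible trivial module is a coboundary. -/
lemma exists_coboundary_of_isCyclic {I M : Type*} [Group I] [Finite I] [IsCyclic I]
    [AddCommGroup M] (hM : ∀ n : ℕ, n ≠ 0 → ∀ x : M, ∃ y, n • y = x) (f : I × I → M)
    (hf : ∀ g h j, f (h, j) + f (g, h * j) = f (g * h, j) + f (g, h)) :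
    ∃ c : I → M, ∀ g h, f (g, h) = c h - c (g * h) + c g := by
  obtain ⟨t, ht⟩ := IsCyclic.exists_generator (α := I)
  have hn : orderOf t ≠ 0 := (orderOf_pos t).ne'
  obtain ⟨y, hy⟩ := hM _ hn (∑ l ∈ Finset.range (orderOf t), f (t ^ l, t))
  -- The values on powers of `t` forced by `f (t ^ i, t) = c t - c (t ^ (i + 1)) + c (t ^ i)` with
  -- `c t = y`. The initial value `f (1, t)` makes `c t = y` consistent, and the choice of `y` by
  -- divisibility closes the cycle at the order of `t`.
  let C : ℕ → M := fun i => f (1, t) + i • y - ∑ l ∈ Finset.range i, f (t ^ l, t)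
  have hC : ∀ i, C (i + 1) = C i + y - f (t ^ i, t) := fun i => by
    simp only [C, Finset.sum_range_succ, succ_nsmul]
    abel
  have hC0 : C 0 = f (1, t) := by simp [C]
  have hCn : C (orderOf t) = C 0 := by
    rw [hC0]
    simp [C, hy]
  have hex : ∀ x : I, ∃ i < orderOf t, t ^ i = x := fun x => by
    obtain ⟨i, hi⟩ := (mem_powers_iff_mem_zpowers).2 (ht x)
    exact ⟨i % orderOf t, Nat.mod_lt _ (orderOf_pos t), by rw [pow_mod_orderOf]; exact hi⟩
  choose i hi hti using hex
  have hiu : ∀ j < orderOf t, i (t ^ j) = j := fun j hj =>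
    pow_injOn_Iio_orderOf (hi _) hj (hti _)
  let c : I → M := fun x => C (i x)
  have hcs : ∀ x, c (x * t) = c x + y - f (x, t) := fun x => by
    have h1 : C (i x + 1) = c x + y - f (x, t) := by rw [hC, hti]
    rw [← h1]
    simp only [c]
    have h2 : x * t = t ^ (i x + 1) := by rw [pow_succ, hti]
    rcases (Nat.succ_le_of_lt (hi x)).lt_or_eq with h | h
    · rw [h2, hiu _ h]
    · rw [show i x + 1 = orderOf t from h] at h2 ⊢
      rw [h2, pow_orderOf_eq_one, hCn, ← pow_zero t, hiu 0 (orderOf_pos t)]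
  have hct : c t = y := by
    have h0 : c 1 = C 0 := by
      simp only [c]
      rw [← pow_zero t, hiu 0 (orderOf_pos t)]
    have := hcs 1
    rw [one_mul, h0, hC0] at this
    rw [this]
    abel
  refine ⟨c, ?_⟩
  let f' : I → I → M := fun g h => f (g, h) - (c h - c (g * h) + c g)
  have h1 : ∀ g, f' g t = 0 := fun g => by
    simp only [f', hcs, hct]
    abel
  -- The difference `f'` is again a cocycle and vanishes at `(g, t)` for all `g`. Hence it does not
  -- change when its second argument is multiplied by `t`.
  have h2 : ∀ g h, f' g (h * t) = f' g h := fun g h => by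
    have e1 := h1 h
    have e2 := h1 (g * h)
    have e3 := hf g h t
    simp only [f', mul_assoc] at e1 e2 e3 ⊢
    rw [← sub_eq_zero] at e3 ⊢
    have := congrArg₂ (· + ·) (congrArg₂ (· - ·) e3 e1) e2
    simp only [sub_zero, add_zero] at this
    rw [← this]
    abel
  have h3 : ∀ g (n : ℕ), f' g (t ^ n) = 0 := fun g n => by
    have h4 : ∀ n : ℕ, f' g (t ^ n) = f' g 1 := fun n => by
      induction n with
      | zero => rw [pow_zero]
      | succ n ih => rw [pow_succ, h2, ih]
    rw [h4 n, ← h4 1, pow_one, h1]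
  intro g h
  have := h3 g (i h)
  rw [hti] at this
  exact sub_eq_zero.1 this

/-! ### Continuity and Hilbert 90 for infinite Galois groups -/

section GaloisCocycle

variable {F Ω : Type*} [Field F] [Field Ω] [Algebra F Ω]

lemma isLocallyConstant_algEquiv_apply [Algebra.IsAlgebraic F Ω] (x : Ω) :
    IsLocallyConstant fun σ : Ω ≃ₐ[F] Ω => σ x := by
  rw [IsLocallyConstant.iff_exists_open]
  intro σ
  have : FiniteDimensional F (IntermediateField.adjoin F {x}) :=
    IntermediateField.adjoin.finiteDimensional (Algebra.IsIntegral.isIntegral x)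
  refine ⟨(fun τ => σ⁻¹ * τ) ⁻¹' ((IntermediateField.adjoin F {x}).fixingSubgroup :
    Set (Ω ≃ₐ[F] Ω)), (IntermediateField.fixingSubgroup_isOpen _).preimage (continuous_const_mul _),
    by simp [one_mem], fun τ hτ => ?_⟩
  have := (IntermediateField.mem_fixingSubgroup_iff _ _).1 hτ x
    (IntermediateField.mem_adjoin_simple_self F x)
  change σ.symm (τ x) = x at this
  rw [AlgEquiv.symm_apply_eq] at this
  exact this

lemma isLocallyConstant_unitsRep [Algebra.IsAlgebraic F Ω] (x : Additive Ωˣ) :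
    IsLocallyConstant fun σ : Ω ≃ₐ[F] Ω => unitsRep (Ω ≃ₐ[F] Ω) Ω σ x := by
  intro s
  have h1 := isLocallyConstant_algEquiv_apply (F := F) (x.toMul : Ω)
    ((fun y : Additive Ωˣ => (y.toMul : Ω)) '' s)
  convert h1 using 1
  ext σ
  simp only [Set.mem_preimage, Set.mem_image]
  refine ⟨fun h => ⟨_, h, rfl⟩, ?_⟩
  rintro ⟨y, hy, hy'⟩
  have : unitsRep (Ω ≃ₐ[F] Ω) Ω σ x = y := Additive.toMul.injective (Units.ext hy'.symm)
  rwa [this]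

/-- A map to a Galois group is continuous if it is pointwise locally constant. -/
lemma continuous_of_isLocallyConstant {X : Type*} [TopologicalSpace X] (f : X → (Ω ≃ₐ[F] Ω))
    (hf : ∀ y : Ω, IsLocallyConstant fun x => f x y) : Continuous f := by
  rw [continuous_iff_continuousAt]
  intro x
  rw [ContinuousAt, ← mul_one (f x), Filter.tendsto_def]
  intro s hs
  have hs' : (fun τ => f x * τ) ⁻¹' s ∈ nhds (1 : Ω ≃ₐ[F] Ω) :=
    (continuous_const_mul (f x)).continuousAt.preimage_mem_nhds (by simpa using hs)
  rw [krullTopology_mem_nhds_one_iff] at hs'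
  obtain ⟨L, hL, hLs⟩ := hs'
  -- A finite extension is finitely generated, so agreeing with `f x` on it is a condition at
  -- finitely many elements.
  obtain ⟨S, hS⟩ := IntermediateField.essFiniteType_iff.1 (inferInstance : Algebra.EssFiniteType F L)
  have hopen : (⋂ y ∈ S, {x' | f x' y = f x y}) ∈ nhds x := by
    rw [Filter.biInter_finset_mem]
    intro y _
    exact ((hf y).isOpen_fiber (f x y)).mem_nhds rfl
  refine Filter.mem_of_superset hopen fun x' hx' => ?_
  have : (f x)⁻¹ * f x' ∈ (L.fixingSubgroup : Set (Ω ≃ₐ[F] Ω)) := by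
    rw [SetLike.mem_coe, ← hS, IntermediateField.mem_fixingSubgroup_iff]
    intro y hy
    have hle : IntermediateField.adjoin F (S : Set Ω) ≤
        IntermediateField.fixedField (Subgroup.zpowers ((f x)⁻¹ * f x')) := by
      rw [IntermediateField.adjoin_le_iff]
      intro y hy
      rw [SetLike.mem_coe, IntermediateField.mem_fixedField_iff]
      intro g hg
      have hy1 : (f x)⁻¹ (f x' y) = y := by
        have : f x' y = f x y := Set.mem_iInter₂.1 hx' y hy
        rw [this]
        exact (f x).symm_apply_apply y
      have : g ∈ MulAction.stabilizer (Ω ≃ₐ[F] Ω) y := (Subgroup.zpowers_le.2 hy1) hg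
      exact this
    exact (IntermediateField.mem_fixedField_iff _ _).1 (hle hy) _ (Subgroup.mem_zpowers _)
  have h2 := hLs this
  rwa [Set.mem_preimage, mul_inv_cancel_left] at h2

/-- Hilbert's Theorem 90 for locally constant cocycles of a subgroup of a Galois group. -/
lemma exists_of_locallyConstant_cocycle {J : Type*} [Group J] [TopologicalSpace J]
    (φ : J →* (Ω ≃ₐ[F] Ω)) (hφ : Topology.IsInducing φ) (c : J → Additive Ωˣ)
    (hlc : IsLocallyConstant c)
    (hc : ∀ g h, c (g * h) = unitsRep (Ω ≃ₐ[F] Ω) Ω (φ g) (c h) + c g) :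
    ∃ a : Additive Ωˣ, ∀ g, c g = unitsRep (Ω ≃ₐ[F] Ω) Ω (φ g) a - a := by
  have h1 : c 1 = 0 := by
    have := hc 1 1
    rw [mul_one, map_one, map_one] at this
    exact left_eq_add.1 this
  -- The cocycle vanishes near 1, so it vanishes on the elements fixing some finite extension `L`.
  -- It then depends only on the restriction to `L`, for which there are finitely many
  -- possibilities.
  obtain ⟨V, hV, hVc⟩ : ∃ V ∈ nhds (1 : Ω ≃ₐ[F] Ω), φ ⁻¹' V ⊆ c ⁻¹' {0} := by
    have : c ⁻¹' {0} ∈ nhds (1 : J) := (hlc.isOpen_fiber 0).mem_nhds h1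
    rw [hφ.nhds_eq_comap, map_one] at this
    exact this
  obtain ⟨L, hL, hLV⟩ := (krullTopology_mem_nhds_one_iff _ _ _).1 hV
  let _ : MulSemiringAction J Ω := MulSemiringAction.compHom Ω φ
  have hcoc : ∀ g h, c (g * h) = unitsRep J Ω g (c h) + c g := hc
  have hfin : (Set.range fun (g : J) (x : L) => g • (algebraMap L Ω) x).Finite := by
    have h2 : (Set.range fun g : J => ((φ g : Ω ≃ₐ[F] Ω) : Ω →ₐ[F] Ω).comp L.val).Finite :=
      Set.toFinite _
    refine (h2.image fun (m : L →ₐ[F] Ω) (x : L) => m x).subset ?_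
    rintro _ ⟨g, rfl⟩
    exact ⟨_, ⟨g, rfl⟩, rfl⟩
  refine exists_of_cocycle (Γ := J) (E := Ω) (algebraMap L Ω) hfin c hcoc fun g h e => ?_
  have h3 : c (g⁻¹ * h) = 0 := hVc (hLV (by
    rw [SetLike.mem_coe, IntermediateField.mem_fixingSubgroup_iff]
    intro x hx
    have h4 : φ g x = φ h x := e ⟨x, hx⟩
    rw [map_mul, map_inv]
    change (φ g).symm (φ h x) = x
    rw [← h4, AlgEquiv.symm_apply_apply]))
  have h5 := hcoc g (g⁻¹ * h)
  rw [mul_inv_cancel_left, h3, map_zero, zero_add] at h5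
  exact h5.symm

end GaloisCocycle

/-! ### Valuation rings of an algebraic extension and primes of the integral closure -/

section IntegralClosure

open Polynomial

open scoped Pointwise

variable {E Ω : Type*} [Field E] [Field Ω] [Algebra E Ω]

/-- A valuation ring above `R` contains the integral closure of `R`. -/
lemma mem_of_isIntegral {R : Subring E} {A : ValuationSubring Ω}
    (hA : ∀ x : E, algebraMap E Ω x ∈ A ↔ x ∈ R) {x : Ω} (hx : IsIntegral R x) : x ∈ A := by
  let f : R →+* A := ((algebraMap E Ω).comp R.subtype).codRestrict A.toSubring
    fun r => (hA r).2 r.2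
  have h1 : IsIntegral A x := by
    obtain ⟨p, hp, hpx⟩ := hx
    refine ⟨p.map f, hp.map f, ?_⟩
    rw [eval₂_map]
    exact hpx
  obtain ⟨y, rfl⟩ := IsIntegrallyClosed.isIntegral_iff.1 h1
  exact y.2

/-- If `x ∈ A` is a root of a polynomial with integral coefficients, not all in the maximal ideal,
then `x` is a quotient of integral elements whose denominator is a unit of `A`. -/
lemma exists_integral_div_of_sum_eq_zero (B : Subring Ω) (A : ValuationSubring Ω)
    (hB : ∀ b ∈ B, b ∈ A) (hBi : ∀ x : Ω, IsIntegral B x → x ∈ B) {x : Ω} (hx : x ∈ A) (n : ℕ)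
    (a : ℕ → Ω) (ha : ∀ i, a i ∈ B) (h0 : ∑ i ∈ Finset.range (n + 1), a i * x ^ i = 0)
    (h1 : ∃ i ≤ n, A.valuation (a i) = 1) :
    ∃ b ∈ B, ∃ c ∈ B, A.valuation c = 1 ∧ c * x = b := by
  induction n generalizing a with
  | zero =>
    obtain ⟨i, hi, h⟩ := h1
    obtain rfl : i = 0 := by omega
    simp at h0
    rw [h0, map_zero] at h
    exact absurd h zero_ne_one
  | succ n ih =>
    -- The leading coefficient times a root is always integral. If that coefficient is a unit of
    -- `A`, this already writes `x` as the desired quotient.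
    have key : a (n + 1) * x ∈ B := by
      by_cases hn : a (n + 1) = 0
      · rw [hn, zero_mul]
        exact B.zero_mem
      let p : B[X] := ∑ i ∈ Finset.range (n + 2), C ⟨a i, ha i⟩ * X ^ i
      have hp : aeval x p = 0 := by
        simp only [p, map_sum, map_mul, aeval_C, map_pow, aeval_X]
        exact h0
      have hcoeff : ∀ j, p.coeff j = if j < n + 2 then ⟨a j, ha j⟩ else 0 := fun j => by
        simp [p, coeff_C_mul, coeff_X_pow]
      have hdeg : p.natDegree = n + 1 := by
        refine natDegree_eq_of_le_of_coeff_ne_zero ?_ ?_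
        · rw [natDegree_le_iff_coeff_eq_zero]
          intro N hN
          rw [hcoeff, if_neg (by omega)]
        · rw [hcoeff, if_pos (by omega)]
          exact fun h => hn (congrArg Subtype.val h)
      have := isIntegral_leadingCoeff_smul p x hp
      rw [leadingCoeff, hdeg, hcoeff, if_pos (by omega)] at this
      exact hBi _ this
    by_cases hu : A.valuation (a (n + 1)) = 1
    · exact ⟨_, key, _, ha _, hu, rfl⟩
    have hlt : A.valuation (a (n + 1) * x) < 1 := by
      have h2 : A.valuation (a (n + 1)) < 1 :=
        lt_of_le_of_ne ((A.valuation_le_one_iff _).2 (hB _ (ha _))) hu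
      rw [map_mul]
      exact mul_lt_one_of_lt_of_le h2 ((A.valuation_le_one_iff _).2 hx)
    -- Otherwise the two top terms are merged into one of lower degree. The term added to `a n` lies
    -- in the maximal ideal, so a unit among the coefficients survives.
    let a' : ℕ → Ω := fun i => if i = n then a (n + 1) * x + a n else a i
    refine ih a' (fun i => ?_) ?_ ?_
    · simp only [a']
      split_ifs
      · exact B.add_mem key (ha n)
      · exact ha i
    · rw [Finset.sum_range_succ, Finset.sum_range_succ] at h0
      rw [Finset.sum_range_succ]
      have h3 : ∑ i ∈ Finset.range n, a' i * x ^ i = ∑ i ∈ Finset.range n, a i * x ^ i :=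
        Finset.sum_congr rfl fun i hi => by
          simp only [a']
          rw [if_neg (Finset.mem_range.1 hi).ne]
      rw [h3]
      simp only [a', if_pos]
      rw [← h0]
      ring
    · obtain ⟨i, hi, h⟩ := h1
      have hi' : i ≤ n := by
        rcases hi.lt_or_eq with h' | h'
        · omega
        · rw [h'] at h
          exact absurd h hu
      refine ⟨i, hi', ?_⟩
      simp only [a']
      split_ifs with hin
      · rw [hin] at h
        rw [Valuation.map_add_eq_of_lt_right _ (by rwa [h])]
        exact h
      · exact h

variable (E) in
/-- An algebraic element is a root of a polynomial with coefficients in a given valuation ring, one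
of which is a unit. -/
lemma exists_sum_eq_zero [Algebra.IsAlgebraic E Ω] (A : ValuationSubring Ω) (x : Ω) :
    ∃ (n : ℕ) (a : ℕ → E), ∑ i ∈ Finset.range (n + 1), algebraMap E Ω (a i) * x ^ i = 0 ∧
      (∀ i, algebraMap E Ω (a i) ∈ A) ∧ ∃ i ≤ n, A.valuation (algebraMap E Ω (a i)) = 1 := by
  obtain ⟨p, hp0, hp⟩ := Algebra.IsAlgebraic.isAlgebraic (R := E) x
  -- Dividing by a coefficient of largest valuation makes all coefficients integral and this one
  -- equal to 1.
  obtain ⟨j, hj, hmax⟩ := Finset.exists_max_image (Finset.range (p.natDegree + 1))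
    (fun i => A.valuation (algebraMap E Ω (p.coeff i))) ⟨0, by simp⟩
  have hj0 : A.valuation (algebraMap E Ω (p.coeff j)) ≠ 0 := by
    have h1 := hmax p.natDegree (by simp)
    intro h2
    rw [h2, le_zero_iff, map_eq_zero, map_eq_zero] at h1
    exact hp0 (leadingCoeff_eq_zero.1 h1)
  have hjc : p.coeff j ≠ 0 := fun h => hj0 (by rw [h, map_zero, map_zero])
  refine ⟨p.natDegree, fun i => p.coeff i / p.coeff j, ?_, fun i => ?_, j, by
    simpa [Nat.lt_succ_iff] using hj, by simp [div_self hjc]⟩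
  · have h1 : ∑ i ∈ Finset.range (p.natDegree + 1), algebraMap E Ω (p.coeff i) * x ^ i = 0 := by
      rw [aeval_eq_sum_range] at hp
      simpa [Algebra.smul_def] using hp
    have h2 := congrArg (fun y => y / algebraMap E Ω (p.coeff j)) h1
    simp only [Finset.sum_div, zero_div] at h2
    rw [← h2]
    refine Finset.sum_congr rfl fun i _ => ?_
    rw [map_div₀]
    ring
  · rw [← A.valuation_le_one_iff, map_div₀, map_div₀, div_le_one₀ (zero_lt_iff.2 hj0)]
    by_cases hi : i ∈ Finset.range (p.natDegree + 1)
    · exact hmax i hi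
    · rw [coeff_eq_zero_of_natDegree_lt (by simpa using hi), map_zero, map_zero]
      exact zero_le

variable {R : Subring E}

/-- The action of the Galois group on the integral closure of a subring of the base field. -/
instance galIntegralClosureAction (R : Subring E) :
    MulSemiringAction (Ω ≃ₐ[E] Ω) (integralClosure R Ω) where
  smul g b := ⟨g b.1, b.2.map (g.toAlgHom.restrictScalars R)⟩
  one_smul _ := rfl
  mul_smul _ _ _ := rfl
  smul_zero g := Subtype.ext (map_zero g)
  smul_add g _ _ := Subtype.ext (map_add g _ _)
  smul_one g := Subtype.ext (map_one g)
  smul_mul g _ _ := Subtype.ext (map_mul g _ _)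

lemma coe_gal_smul (g : Ω ≃ₐ[E] Ω) (b : integralClosure R Ω) :
    ((g • b : integralClosure R Ω) : Ω) = g b := rfl

instance (R : Subring E) : SMulCommClass (Ω ≃ₐ[E] Ω) R (integralClosure R Ω) where
  smul_comm g r b := Subtype.ext (by
    rw [coe_gal_smul]
    change g (r • (b : Ω)) = r • g (b : Ω)
    rw [Algebra.smul_def, Algebra.smul_def, map_mul]
    congr 1
    exact g.commutes r)

/-- This form refers only to the ring and not to its value group, so maximal ideals of different
valuation rings can be compared. -/
lemma valuation_lt_one_iff_inv (A : ValuationSubring Ω) (x : Ω) :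
    A.valuation x < 1 ↔ x = 0 ∨ x⁻¹ ∉ A := by
  by_cases hx : x = 0
  · simp [hx]
  · have h0 : 0 < A.valuation x := zero_lt_iff.2 ((_root_.map_ne_zero _).2 hx)
    rw [← A.valuation_le_one_iff, map_inv₀, inv_le_one₀ h0, not_le]
    simp [hx]

section Center

variable {A A' : ValuationSubring Ω} (hA : ∀ x : E, algebraMap E Ω x ∈ A ↔ x ∈ R)
  (hA' : ∀ x : E, algebraMap E Ω x ∈ A' ↔ x ∈ R)

/-- The inclusion of the integral closure in a valuation ring. -/
def integralClosureTo : integralClosure R Ω →+* A :=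
  (integralClosure R Ω).val.toRingHom.codRestrict A.toSubring fun b => mem_of_isIntegral hA b.2

/-- The center of a valuation ring on the integral closure. -/
def center : Ideal (integralClosure R Ω) :=
  (IsLocalRing.maximalIdeal A).comap (integralClosureTo hA)

instance : (center hA).IsPrime := inferInstanceAs (Ideal.comap _ _).IsPrime

lemma mem_center (b : integralClosure R Ω) : b ∈ center hA ↔ A.valuation (b : Ω) < 1 :=
  A.valuation_lt_one_iff (integralClosureTo hA b)

include hA hA' in
lemma valuation_algebraMap_lt_one_iff (x : E) :
    A.valuation (algebraMap E Ω x) < 1 ↔ A'.valuation (algebraMap E Ω x) < 1 := by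
  rw [valuation_lt_one_iff_inv, valuation_lt_one_iff_inv, ← map_inv₀, hA, hA']

lemma center_under : (center hA).under R = (center hA').under R := by
  ext r
  rw [Ideal.mem_comap, Ideal.mem_comap, mem_center, mem_center]
  exact valuation_algebraMap_lt_one_iff hA hA' (r : E)

include hA in
lemma algebraMap_mem_smul_iff (σ : Ω ≃ₐ[E] Ω) (x : E) : algebraMap E Ω x ∈ σ • A ↔ x ∈ R := by
  rw [ValuationSubring.mem_pointwise_smul_iff_inv_smul_mem, ← hA]
  have : σ⁻¹ • algebraMap E Ω x = algebraMap E Ω x := σ⁻¹.commutes x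
  rw [this]

lemma valuation_smul_lt_one_iff (σ : Ω ≃ₐ[E] Ω) (x : Ω) :
    (σ • A).valuation x < 1 ↔ A.valuation (σ⁻¹ x) < 1 := by
  rw [valuation_lt_one_iff_inv, valuation_lt_one_iff_inv,
    ValuationSubring.mem_pointwise_smul_iff_inv_smul_mem, AlgEquiv.smul_def, map_inv₀,
    map_eq_zero]

lemma center_smul (σ : Ω ≃ₐ[E] Ω) :
    center (A := σ • A) (algebraMap_mem_smul_iff hA σ) = σ • center hA := by
  ext b
  rw [mem_center, Ideal.mem_pointwise_smul_iff_inv_smul_mem, mem_center, coe_gal_smul,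
    valuation_smul_lt_one_iff]

/-- The contraction of the center to `R` is maximal, because elements of `R` outside it are units of
`R`. A prime of an integral extension above a maximal ideal is maximal. -/
lemma center_isMaximal : (center hA).IsMaximal := by
  refine Ideal.isMaximal_of_isIntegral_of_isMaximal_comap (R := R) (center hA)
    (Ideal.isMaximal_iff.2 ⟨fun h1 => ?_, fun J r _ hr hrJ => ?_⟩)
  · have h2 : ((center hA).under R).IsPrime := inferInstance
    exact (Ideal.ne_top_iff_one _).1 h2.ne_top h1
  · have h1 : ¬ A.valuation (algebraMap E Ω (r : E)) < 1 := fun h =>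
      hr (Ideal.mem_comap.2 ((mem_center hA _).2 h))
    rw [valuation_lt_one_iff_inv, not_or, not_not, ← map_inv₀, hA] at h1
    have h2 : (⟨_, h1.2⟩ : R) * r = 1 := Subtype.ext
      (inv_mul_cancel₀ fun h0 => h1.1 (by rw [h0, map_zero]))
    rw [← h2]
    exact J.mul_mem_left _ hrJ

variable [Algebra.IsAlgebraic E Ω]

include hA in
/-- A valuation ring of an algebraic extension is a localization of the integral closure of its
restriction to the base field. -/
lemma exists_integral_div {x : Ω} (hx : x ∈ A) :
    ∃ b c : Ω, IsIntegral R b ∧ IsIntegral R c ∧ A.valuation c = 1 ∧ c * x = b := by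
  obtain ⟨n, a, h0, haA, h1⟩ := exists_sum_eq_zero E A x
  obtain ⟨b, hb, c, hc, h⟩ := exists_integral_div_of_sum_eq_zero
    (integralClosure R Ω).toSubring A (fun b hb => mem_of_isIntegral hA hb)
    (fun y hy => (isIntegral_trans (R := R) (A := integralClosure R Ω) y hy)) hx n
    (fun i => algebraMap E Ω (a i))
    (fun i => isIntegral_algebraMap (R := R) (x := ⟨a i, (hA _).1 (haA i)⟩)) h0 h1
  exact ⟨b, c, hb, hc, h⟩

include hA in
/-- Every residue class of a valuation ring contains an integral element. -/
lemma exists_integral_sub_lt {x : Ω} (hx : x ∈ A) :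
    ∃ b : Ω, IsIntegral R b ∧ A.valuation (x - b) < 1 := by
  obtain ⟨b, c, hb, hc, hc1, hcx⟩ := exists_integral_div hA hx
  have hcQ : (⟨c, hc⟩ : integralClosure R Ω) ∉ center hA := fun h =>
    ((mem_center hA _).1 h).ne hc1
  -- The center is maximal, so the denominator is invertible modulo it. Replacing division by `c` by
  -- multiplication with `d` changes `x` only by an element of the maximal ideal.
  obtain ⟨d, q, hq, hdq⟩ := Ideal.IsMaximal.exists_inv (center_isMaximal hA) hcQ
  refine ⟨d * b, d.2.mul hb, ?_⟩
  have h1 : (d : Ω) * c + q = 1 := congrArg Subtype.val hdq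
  have h2 : x - d * b = q * x := by
    rw [← hcx]
    linear_combination (-x) * h1
  rw [h2, map_mul]
  exact mul_lt_one_of_lt_of_le ((mem_center hA q).1 hq) ((A.valuation_le_one_iff _).2 hx)

include hA hA' in
-- An element of `A` is a quotient of integral elements with denominator a unit of `A`. The
-- hypothesis makes that denominator a unit of `A'` too.
lemma valuationSubring_le_of_center
    (h : ∀ b : Ω, IsIntegral R b → A'.valuation b < 1 → A.valuation b < 1) : A ≤ A' := by
  intro x hx
  obtain ⟨b, c, hb, hc, hc1, hcx⟩ := exists_integral_div hA hx
  have hcA' := (A'.valuation_le_one_iff _).2 (mem_of_isIntegral hA' hc)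
  have hc1' : A'.valuation c = 1 := by
    refine hcA'.eq_of_not_lt fun hlt => ?_
    have := h c hc hlt
    rw [hc1] at this
    exact lt_irrefl _ this
  rw [← A'.valuation_le_one_iff]
  have h2 := (A'.valuation_le_one_iff _).2 (mem_of_isIntegral hA' hb)
  rwa [← hcx, map_mul, hc1', one_mul] at h2

/-- Valuation rings above `R` with the same center on the integral closure of `R` agree. -/
lemma eq_of_center_eq (h : center hA = center hA') : A = A' := by
  refine le_antisymm (valuationSubring_le_of_center hA hA' fun b hb hlt => ?_)
    (valuationSubring_le_of_center hA' hA fun b hb hlt => ?_)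
  · rw [← mem_center hA ⟨b, hb⟩, h, mem_center]
    exact hlt
  · rw [← mem_center hA' ⟨b, hb⟩, ← h, mem_center]
    exact hlt

include hA hA' in
/-- If two valuation rings above `R` do not agree, there is an integral element in the maximal ideal
of the first that is a unit in the second. -/
lemma exists_of_ne (h : A ≠ A') :
    ∃ b : integralClosure R Ω, A.valuation (b : Ω) < 1 ∧ A'.valuation (b : Ω) = 1 := by
  by_contra! hne
  refine h (eq_of_center_eq hA hA' ((center_isMaximal hA).eq_of_le Ideal.IsPrime.ne_top'
    fun b hb => ?_))
  rw [mem_center] at hb ⊢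
  exact lt_of_le_of_ne ((A'.valuation_le_one_iff _).2 (mem_of_isIntegral hA' b.2)) (hne b hb)

end Center

section Transitivity

variable {A A' : ValuationSubring Ω} [IsGalois E Ω]

/-- The topology on the integral closure, for which the Galois group acts continuously. -/
instance : TopologicalSpace (integralClosure R Ω) := ⊥

instance : DiscreteTopology (integralClosure R Ω) := ⟨rfl⟩

instance : ContinuousSMul (Ω ≃ₐ[E] Ω) (integralClosure R Ω) where
  continuous_smul := by
    rw [continuous_prod_of_discrete_right]
    intro b
    have h := isLocallyConstant_algEquiv_apply (F := E) (b : Ω)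
    refine IsLocallyConstant.continuous fun s => ?_
    have := h (Subtype.val '' s)
    convert this using 1
    ext σ
    simp only [Set.mem_preimage, Set.mem_image]
    refine ⟨fun h => ⟨_, h, rfl⟩, ?_⟩
    rintro ⟨y, hy, hy'⟩
    have e : σ • b = y := Subtype.ext hy'.symm
    rwa [e]

/-- A fixed integral element lies in the base field and in `A`, hence in `R`. This is the input for
the theory of primes under a profinite group. -/
lemma isInvariant_integralClosure (hA : ∀ x : E, algebraMap E Ω x ∈ A ↔ x ∈ R) :
    Algebra.IsInvariant R (integralClosure R Ω) (Ω ≃ₐ[E] Ω) where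
  isInvariant b hb := by
    have h1 : (b : Ω) ∈ (⊥ : IntermediateField E Ω) := by
      rw [InfiniteGalois.mem_bot_iff_fixed]
      exact fun f => congrArg Subtype.val (hb f)
    obtain ⟨x, hx⟩ := IntermediateField.mem_bot.1 h1
    have h2 : x ∈ R := by
      rw [← hA, hx]
      exact mem_of_isIntegral hA b.2
    exact ⟨⟨x, h2⟩, Subtype.ext hx⟩

/-- Valuation rings above the same subring of the base field are conjugate. -/
lemma exists_smul_eq_of_galois (hA : ∀ x : E, algebraMap E Ω x ∈ A ↔ x ∈ R)
    (hA' : ∀ x : E, algebraMap E Ω x ∈ A' ↔ x ∈ R) : ∃ σ : Ω ≃ₐ[E] Ω, σ • A = A' := by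
  have := isInvariant_integralClosure hA
  -- Primes of the integral closure with the same contraction are conjugate, and a valuation ring is
  -- determined by its center.
  obtain ⟨σ, hσ⟩ := Algebra.IsInvariant.exists_smul_of_under_eq_of_profinite
    (A := R) (G := Ω ≃ₐ[E] Ω) (center hA) (center hA') (center_under hA hA')
  exact ⟨σ, eq_of_center_eq (algebraMap_mem_smul_iff hA σ) hA' ((center_smul hA σ).trans hσ.symm)⟩

/-- Automorphisms of the residue field are induced by elements of the decomposition group. -/
lemma exists_smul_eq_of_residue {k' : Type*} [Field k']
    (hA : ∀ x : E, algebraMap E Ω x ∈ A ↔ x ∈ R) (ψ : A →+* k') (hψ : Function.Surjective ψ)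
    (hψ0 : ∀ a : A, ψ a = 0 ↔ a ∈ IsLocalRing.maximalIdeal A) (τ : k' ≃+* k')
    (hτ : ∀ r : R, τ (ψ ⟨algebraMap E Ω r, (hA r).2 r.2⟩) = ψ ⟨algebraMap E Ω r, (hA r).2 r.2⟩) :
    ∃ σ : Ω ≃ₐ[E] Ω, σ • A = A ∧
      ∀ (x : Ω) (hx : x ∈ A) (hx' : σ x ∈ A), ψ ⟨σ x, hx'⟩ = τ (ψ ⟨x, hx⟩) := by
  have := isInvariant_integralClosure hA
  let P : Ideal R := (center hA).under R
  have : (center hA).LiesOver P := ⟨rfl⟩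
  let f : integralClosure R Ω →+* k' := ψ.comp (integralClosureTo hA)
  have hfk : RingHom.ker f = center hA := by
    ext b
    rw [RingHom.mem_ker]
    exact hψ0 _
  have hunit : ∀ (x : Ω) (hx : x ∈ A), A.valuation x = 1 → ψ ⟨x, hx⟩ ≠ 0 := fun x hx h1 h0 => by
    rw [hψ0, A.valuation_lt_one_iff] at h0
    exact h0.ne h1
  have hfrac : ∀ (x : Ω) (hx : x ∈ A), ∃ b c : integralClosure R Ω, f c ≠ 0 ∧
      (c : Ω) * x = b ∧ f c * ψ ⟨x, hx⟩ = f b := fun x hx => by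
    obtain ⟨b, c, hb, hc, hc1, hcx⟩ := exists_integral_div hA hx
    refine ⟨⟨b, hb⟩, ⟨c, hc⟩, hunit _ _ hc1, hcx, ?_⟩
    rw [RingHom.comp_apply, RingHom.comp_apply, ← map_mul]
    congr 1
    exact Subtype.ext hcx
  have hsurj : Function.Surjective f := by
    intro y
    obtain ⟨⟨x, hx⟩, rfl⟩ := hψ y
    obtain ⟨b, hb, hxb⟩ := exists_integral_sub_lt hA hx
    refine ⟨⟨b, hb⟩, (sub_eq_zero.1 ?_).symm⟩
    rw [RingHom.comp_apply, ← map_sub, hψ0, A.valuation_lt_one_iff]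
    exact hxb
  let e : (integralClosure R Ω ⧸ center hA) ≃+* k' :=
    (Ideal.quotEquivOfEq hfk.symm).trans (RingHom.quotientKerEquivOfSurjective hsurj)
  have he : ∀ b, e (Ideal.Quotient.mk _ b) = f b := fun b => rfl
  -- The automorphism `τ`, transported to the residue ring of the center; it is linear over the
  -- residue ring of `R` by `hτ`. It lifts to the stabilizer of the center, that is, to the
  -- decomposition group.
  let t : (integralClosure R Ω ⧸ center hA) ≃ₐ[R ⧸ P] (integralClosure R Ω ⧸ center hA) :=
    AlgEquiv.ofRingEquiv (f := (e.trans τ).trans e.symm) fun r => by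
      obtain ⟨r, rfl⟩ := Ideal.Quotient.mk_surjective r
      rw [RingEquiv.trans_apply, RingEquiv.trans_apply, RingEquiv.symm_apply_eq]
      exact hτ r
  obtain ⟨⟨σ, hσ⟩, hσt⟩ := Ideal.Quotient.stabilizerHom_surjective_of_profinite
    (G := Ω ≃ₐ[E] Ω) P (center hA) t
  have hσA : σ • A = A :=
    eq_of_center_eq (algebraMap_mem_smul_iff hA σ) hA ((center_smul hA σ).trans hσ)
  have hσf : ∀ b, f (σ • b) = τ (f b) := fun b => by
    have h1 := DFunLike.congr_fun hσt (Ideal.Quotient.mk _ b)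
    rw [Ideal.Quotient.stabilizerHom_apply] at h1
    have h2 := congrArg e h1
    change f (σ • b) = e (e.symm (τ (f b))) at h2
    rw [h2, RingEquiv.apply_symm_apply]
  refine ⟨σ, hσA, fun x hx hx' => ?_⟩
  obtain ⟨b, c, hc, hcx, hfcb⟩ := hfrac x hx
  have h1 : f (σ • c) * ψ ⟨σ x, hx'⟩ = f (σ • b) := by
    rw [RingHom.comp_apply, RingHom.comp_apply, ← map_mul]
    congr 1
    refine Subtype.ext ?_
    change σ (c : Ω) * σ x = σ (b : Ω)
    rw [← map_mul, hcx]
  rw [hσf, hσf, ← hfcb, map_mul] at h1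
  exact mul_left_cancel₀ ((_root_.map_ne_zero τ).2 hc) h1

end Transitivity

end IntegralClosure

/-! ### The fixed field of inertia has the value group of the base -/

section Unramified

open scoped Pointwise IntermediateField

variable {E Ω : Type*} [Field E] [Field Ω] [Algebra E Ω]

/-- The value group of an algebraic extension is torsion modulo that of the base field. -/
lemma exists_pow_valuation_eq [Algebra.IsAlgebraic E Ω] (A : ValuationSubring Ω) {x : Ω}
    (hx : x ≠ 0) : ∃ k : ℕ, k ≠ 0 ∧ ∃ t : E, t ≠ 0 ∧
      A.valuation x ^ k = A.valuation (algebraMap E Ω t) := by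
  classical
  obtain ⟨n, a, h0, -, i₀, hi₀, hai₀⟩ := exists_sum_eq_zero E A x
  have hvx : A.valuation x ≠ 0 := (map_ne_zero _).2 hx
  obtain ⟨j, hj, hmax⟩ := Finset.exists_max_image (Finset.range (n + 1))
    (fun i => A.valuation (algebraMap E Ω (a i) * x ^ i)) ⟨0, by simp⟩
  have hj0 : A.valuation (algebraMap E Ω (a j) * x ^ j) ≠ 0 := by
    have h1 := hmax i₀ (by simpa [Nat.lt_succ_iff] using hi₀)
    rw [map_mul, hai₀, one_mul, map_pow] at h1
    intro h2
    rw [h2, le_zero_iff] at h1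
    exact pow_ne_zero _ hvx h1
  -- A sum with a single term of largest valuation is not zero. Two terms of equal valuation give
  -- the relation between a power of `x` and an element of `E`.
  obtain ⟨i, hi, hij, hle⟩ : ∃ i ∈ Finset.range (n + 1), i ≠ j ∧
      A.valuation (algebraMap E Ω (a j) * x ^ j) ≤ A.valuation (algebraMap E Ω (a i) * x ^ i) := by
    by_contra! hlt
    have := A.valuation.map_sum_eq_of_lt hj fun i hi => hlt i (Finset.mem_sdiff.1 hi).1
      (by simpa using (Finset.mem_sdiff.1 hi).2)
    rw [h0, map_zero] at this
    exact hj0 this.symm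
  have heq := le_antisymm (hmax i hi) hle
  have hi0 := heq ▸ hj0
  have ne0 : ∀ l, A.valuation (algebraMap E Ω (a l) * x ^ l) ≠ 0 → a l ≠ 0 := fun l hl h =>
    hl (by rw [h, map_zero, zero_mul, map_zero])
  have key : ∀ l m, l < m → a l ≠ 0 → a m ≠ 0 →
      A.valuation (algebraMap E Ω (a l) * x ^ l) = A.valuation (algebraMap E Ω (a m) * x ^ m) →
      ∃ k : ℕ, k ≠ 0 ∧ ∃ t : E, t ≠ 0 ∧ A.valuation x ^ k = A.valuation (algebraMap E Ω t) := by
    intro l m hlm hl hm e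
    refine ⟨m - l, by omega, a l / a m, div_ne_zero hl hm, ?_⟩
    have hm' : A.valuation (algebraMap E Ω (a m)) ≠ 0 := by simpa using hm
    rw [map_div₀, map_div₀, eq_div_iff hm']
    rw [map_mul, map_mul, map_pow, map_pow] at e
    apply mul_right_cancel₀ (pow_ne_zero l hvx)
    rw [e, mul_right_comm, ← pow_add, Nat.sub_add_cancel hlm.le, mul_comm]
  rcases lt_or_gt_of_ne hij with h | h
  · exact key i j h (ne0 i hi0) (ne0 j hj0) heq
  · exact key j i h (ne0 j hj0) (ne0 i hi0) heq.symm

/-- Every value has a nonzero power in the value group of `E`, so the archimedean property passes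
from `E` to `Ω`. -/
lemma exists_pow_mul_lt_one [Algebra.IsAlgebraic E Ω] (A : ValuationSubring Ω)
    (harch : ∀ t s : E, A.valuation (algebraMap E Ω t) < 1 → ∃ N : ℕ,
      A.valuation (algebraMap E Ω t) ^ N * A.valuation (algebraMap E Ω s) < 1)
    (b w : Ω) (hb : A.valuation b < 1) : ∃ N : ℕ, A.valuation b ^ N * A.valuation w < 1 := by
  by_cases hb0 : b = 0
  · exact ⟨1, by simp [hb0]⟩
  by_cases hw0 : w = 0
  · exact ⟨1, by simp [hw0]⟩
  obtain ⟨k, hk, t, ht, hkt⟩ := exists_pow_valuation_eq (E := E) A hb0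
  obtain ⟨l, hl, s, hs, hls⟩ := exists_pow_valuation_eq (E := E) A hw0
  obtain ⟨N, hN⟩ := harch t s (by rw [← hkt]; exact pow_lt_one₀ zero_le hb hk)
  refine ⟨k * N, ?_⟩
  rw [← hkt, ← hls, ← pow_mul] at hN
  rw [← pow_lt_one_iff hl, mul_pow]
  refine lt_of_le_of_lt ?_ hN
  exact mul_le_mul_left (pow_le_of_le_one zero_le (pow_le_one₀ zero_le hb.le) hl) _

lemma valuation_apply_lt_one_iff {A : ValuationSubring Ω} {σ : Ω ≃ₐ[E] Ω} (hσ : σ • A = A) (x : Ω) :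
    A.valuation (σ x) < 1 ↔ A.valuation x < 1 := by
  conv_lhs => rw [← hσ]
  rw [valuation_smul_lt_one_iff]
  have : σ⁻¹ (σ x) = x := σ.symm_apply_apply x
  rw [this]

lemma apply_mem_iff {A : ValuationSubring Ω} {σ : Ω ≃ₐ[E] Ω} (hσ : σ • A = A) (x : Ω) :
    σ x ∈ A ↔ x ∈ A := by
  conv_lhs => rw [← hσ]
  exact ValuationSubring.smul_mem_pointwise_smul_iff

/-- An automorphism preserving `A` acts on the ordered value group. It fixes the values of `E`, some
nonzero power of every value is of this kind, and roots are unique in an ordered group. -/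
lemma valuation_apply_eq [Algebra.IsAlgebraic E Ω] {A : ValuationSubring Ω} {σ : Ω ≃ₐ[E] Ω}
    (hσ : σ • A = A) (x : Ω) : A.valuation (σ x) = A.valuation x := by
  by_cases hx : x = 0
  · rw [hx, map_zero]
  obtain ⟨k, hk, t, ht, hkt⟩ := exists_pow_valuation_eq (E := E) A hx
  have hle : ∀ a b : Ω, b ≠ 0 → (A.valuation a ≤ A.valuation b ↔ a / b ∈ A) := fun a b hb => by
    rw [← A.valuation_le_one_iff, map_div₀, div_le_one₀ (zero_lt_iff.2 ((map_ne_zero _).2 hb))]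
  have ht' : algebraMap E Ω t ≠ 0 := by simpa using ht
  refine (pow_left_inj₀ zero_le zero_le hk).1 ?_
  rw [hkt]
  rw [← map_pow] at hkt ⊢
  have hσt : σ (algebraMap E Ω t) = algebraMap E Ω t := σ.commutes t
  refine le_antisymm ?_ ?_
  · rw [hle _ _ ht', ← hσt, ← map_pow, ← map_div₀, apply_mem_iff hσ, ← hle _ _ ht', hkt]
  · rw [hle _ _ (pow_ne_zero k (by simpa using hx)), ← hσt, ← map_pow, ← map_div₀,
      apply_mem_iff hσ, ← hle _ _ (pow_ne_zero k hx), hkt]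

variable [IsGalois E Ω] {R : Subring E} {A : ValuationSubring Ω}

/-- An embedding of an intermediate field is induced by an element of the decomposition group if it
preserves the valuation ring. -/
lemma exists_decomposition_lift (M : IntermediateField E Ω) (τ : M →ₐ[E] Ω)
    (hτ : ∀ x : M, τ x ∈ A ↔ (x : Ω) ∈ A) : ∃ σ : Ω ≃ₐ[E] Ω, σ • A = A ∧ ∀ x : M, σ x = τ x := by
  -- An arbitrary extension of `τ` need not preserve `A`. But `A` and its image under the inverse
  -- lie above the same ring of `M`, so composition with an element of Gal(Ω/M) repairs this.
  let σ₀ : Ω ≃ₐ[E] Ω := AlgEquiv.ofBijective (τ.liftNormal Ω)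
    (Algebra.IsAlgebraic.algHom_bijective _)
  have hσ₀ : ∀ x : M, σ₀ x = τ x := fun x => AlgHom.liftNormal_commutes τ Ω x
  have h1 : ∀ x : M, algebraMap M Ω x ∈ A ↔ x ∈ (A.comap (algebraMap M Ω)).toSubring :=
    fun x => Iff.rfl
  have h2 : ∀ x : M, algebraMap M Ω x ∈ σ₀⁻¹ • A ↔ x ∈ (A.comap (algebraMap M Ω)).toSubring :=
    fun x => by
      rw [ValuationSubring.mem_pointwise_smul_iff_inv_smul_mem, inv_inv]
      exact (by rw [← hσ₀] : σ₀ x ∈ A ↔ τ x ∈ A).trans (hτ x)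
  obtain ⟨ρ, hρ⟩ := exists_smul_eq_of_galois h1 h2
  refine ⟨σ₀ * ρ.restrictScalars E, ?_, fun x => ?_⟩
  · rw [mul_smul]
    have : ρ.restrictScalars E • A = ρ • A := rfl
    rw [this, hρ, smul_inv_smul]
  · change σ₀ (ρ (algebraMap M Ω x)) = τ x
    rw [ρ.commutes]
    exact hσ₀ x

/-- If two elements of the decomposition group induce the same map on the residue field of an
intermediate field fixed by the inertia group, then they agree on this field. -/
lemma eq_of_residue_eq (M : IntermediateField E Ω)
    (hA : ∀ x : E, algebraMap E Ω x ∈ A ↔ x ∈ R)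
    (hfix : ∀ σ : Ω ≃ₐ[E] Ω, σ • A = A → (∀ x ∈ A, A.valuation (σ x - x) < 1) →
      ∀ y ∈ M, σ y = y)
    (δ : Ω ≃ₐ[E] Ω) (hδ : δ • A = A)
    (h : ∀ b : integralClosure R M, A.valuation (δ (b : M) - (b : M)) < 1) (y : Ω) (hy : y ∈ M) :
    δ y = y := by
  have hAM : ∀ x : E, algebraMap E M x ∈ A.comap (algebraMap M Ω) ↔ x ∈ R := hA
  have hM : ∀ x : M, (x : Ω) ∈ A → A.valuation (δ x - x) < 1 := fun x hx => by
    obtain ⟨b, c, hb, hc, hc1, hcx⟩ := exists_integral_div hAM (x := x) hx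
    have hc1' : A.valuation (c : Ω) = 1 := by
      have h1 : A.valuation (c : Ω) ≤ 1 := (A.valuation_le_one_iff _).2
        (mem_of_isIntegral hA (hc.map (IsScalarTower.toAlgHom R M Ω)))
      refine h1.eq_of_not_lt fun hlt => ?_
      rw [valuation_lt_one_iff_inv] at hlt
      have h2 : (A.comap (algebraMap M Ω)).valuation c < 1 := by
        rw [valuation_lt_one_iff_inv]
        refine hlt.imp (fun h => Subtype.ext h) fun h h' => h ?_
        have : algebraMap M Ω c⁻¹ ∈ A := h'
        rwa [map_inv₀] at this
      exact h2.ne hc1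
    have e : (c : Ω) * (δ x - x) = -((δ c - c) * δ x) + (δ b - b) := by
      have : (b : Ω) = c * x := by rw [← hcx]; rfl
      rw [this, map_mul]
      ring
    have h3 : A.valuation ((c : Ω) * (δ x - x)) < 1 := by
      rw [e]
      refine A.valuation.map_add_lt ?_ (h ⟨b, hb⟩)
      rw [Valuation.map_neg, map_mul]
      exact mul_lt_one_of_lt_of_le (h ⟨c, hc⟩)
        ((A.valuation_le_one_iff _).2 ((apply_mem_iff hδ _).2 hx))
    rwa [map_mul, hc1', one_mul] at h3
  let δ' : A.decompositionSubgroup E := ⟨δ, hδ⟩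
  let ψ := IsLocalRing.residue A
  have hres : ∀ a b : A, ψ a = ψ b ↔ A.valuation ((a : Ω) - b) < 1 := fun a b => by
    rw [← sub_eq_zero, ← map_sub, IsLocalRing.residue_eq_zero_iff, A.valuation_lt_one_iff]
    rfl
  have h1 : ∀ x : M, algebraMap M Ω x ∈ A ↔ x ∈ (A.comap (algebraMap M Ω)).toSubring :=
    fun x => Iff.rfl
  have hτ : ∀ a : A, MulSemiringAction.toRingEquiv (A.decompositionSubgroup E)
      (IsLocalRing.ResidueField A) δ' (ψ a) = ψ (δ' • a) := fun a =>
    (IsLocalRing.ResidueField.residue_smul (R := A) (A.decompositionSubgroup E) δ' a).symm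
  -- By `hM` the automorphism of the residue field of `A` induced by `δ` is the identity on the
  -- residue field of `M`. It is therefore induced by some `ρ` fixing `M`, and `δρ⁻¹` acts trivially
  -- on residues, so `hfix` applies to it.
  obtain ⟨ρ, hρA, hρ⟩ := exists_smul_eq_of_residue h1 ψ IsLocalRing.residue_surjective
    (fun a => IsLocalRing.residue_eq_zero_iff a)
    (MulSemiringAction.toRingEquiv (A.decompositionSubgroup E) (IsLocalRing.ResidueField A) δ')
    fun r => by
      rw [hτ, hres]
      exact hM r r.2
  have hε := hfix (δ * (ρ.restrictScalars E)⁻¹) (by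
    have : ρ.restrictScalars E • A = A := hρA
    rw [mul_smul, inv_smul_eq_iff.2 this.symm, hδ]) (fun x hx => by
      have hρ' : ρ • A = A := hρA
      obtain ⟨x', rfl⟩ := ρ.surjective x
      have hx' : x' ∈ A := (apply_mem_iff hρ' x').1 hx
      have h4 := hρ x' hx' hx
      rw [hτ, eq_comm, hres] at h4
      have h5 : (δ * (ρ.restrictScalars E)⁻¹) (ρ x') = δ x' :=
        congrArg δ (ρ.symm_apply_apply x')
      rw [h5]
      exact h4) y hy
  have h6 : (ρ.restrictScalars E)⁻¹ y = y := by
    change ρ.symm (algebraMap M Ω ⟨y, hy⟩) = _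
    rw [ρ.symm.commutes]
    rfl
  rwa [AlgEquiv.mul_apply, h6] at hε

/-- The extension of a discretely valued field fixed by an inertia group has the same value
group. -/
lemma exists_base_valuation_eq [IsAlgClosed Ω] (hA : ∀ x : E, algebraMap E Ω x ∈ A ↔ x ∈ R)
    (harch : ∀ t s : E, A.valuation (algebraMap E Ω t) < 1 → ∃ N : ℕ,
      A.valuation (algebraMap E Ω t) ^ N * A.valuation (algebraMap E Ω s) < 1)
    (y : Ω) (hy : y ≠ 0)
    (hfix : ∀ σ : Ω ≃ₐ[E] Ω, σ • A = A → (∀ x ∈ A, A.valuation (σ x - x) < 1) → σ y = y) :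
    ∃ t : E, A.valuation (algebraMap E Ω t) = A.valuation y := by
  classical
  -- The element of `E` will be the trace from `E(y)` of `z = c₁ ^ N * b * y`, chosen so that `Tr z
  -- / y` is a unit of `A`. The trace is a sum over embeddings of `M`. A high power of `c₁` makes
  -- the embeddings that move the place negligible; `b` is chosen such that the sum over the others
  -- does not vanish modulo the maximal ideal.
  let M : IntermediateField E Ω := E⟮y⟯
  have hyM : y ∈ M := IntermediateField.mem_adjoin_simple_self E y
  have : FiniteDimensional E M :=
    IntermediateField.adjoin.finiteDimensional (Algebra.IsIntegral.isIntegral y)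
  have hfixM : ∀ σ : Ω ≃ₐ[E] Ω, σ • A = A → (∀ x ∈ A, A.valuation (σ x - x) < 1) →
      ∀ z ∈ M, σ z = z := fun σ hσ hσ' z hz => by
    have hle : M ≤ IntermediateField.fixedField (Subgroup.zpowers σ) := by
      rw [IntermediateField.adjoin_simple_le_iff, IntermediateField.mem_fixedField_iff]
      intro g hg
      exact (Subgroup.zpowers_le.2
        (show σ ∈ MulAction.stabilizer (Ω ≃ₐ[E] Ω) y from hfix σ hσ hσ')) hg
    exact (IntermediateField.mem_fixedField_iff _ _).1 (hle hz) _ (Subgroup.mem_zpowers _)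
  let yM : M := ⟨y, hyM⟩
  let A₁ : ValuationSubring M := A.comap (algebraMap M Ω)
  have hA₁ : ∀ x : E, algebraMap E M x ∈ A₁ ↔ x ∈ R := hA
  have hcomap : ∀ (τ : M →ₐ[E] Ω) (x : M),
      (A.comap (τ : M →+* Ω)).valuation x < 1 ↔ A.valuation (τ x) < 1 := fun τ x => by
    rw [valuation_lt_one_iff_inv, valuation_lt_one_iff_inv, ← map_inv₀, map_eq_zero]
    rfl
  have hint : ∀ (τ : M →ₐ[E] Ω) (b : integralClosure R M), τ b ∈ A := fun τ b =>
    mem_of_isIntegral hA (b.2.map (τ.restrictScalars R))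
  let Loc : (M →ₐ[E] Ω) → Prop := fun τ => A.comap (τ : M →+* Ω) = A₁
  have hloc : ∀ τ, Loc τ → ∃ σ : Ω ≃ₐ[E] Ω, σ • A = A ∧ ∀ x : M, σ x = τ x := fun τ hτ =>
    exists_decomposition_lift M τ fun x => by
      have h1 : x ∈ A.comap (τ : M →+* Ω) ↔ x ∈ A₁ := by rw [hτ]
      exact h1
  have hid : Loc M.val := rfl
  -- an element which is a unit at the given place and vanishes at the others
  have hex : ∀ τ : M →ₐ[E] Ω, ∃ c : integralClosure R M, A.valuation (M.val c) = 1 ∧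
      (¬ Loc τ → A.valuation (τ c) < 1) := fun τ => by
    by_cases h : Loc τ
    · exact ⟨1, by simp, fun h' => absurd h h'⟩
    · obtain ⟨b, hb, hb'⟩ := exists_of_ne (A := A.comap (τ : M →+* Ω)) (A' := A₁)
        (fun x => by rw [← hA]; exact (by rw [← τ.commutes x]; rfl)) hA₁ h
      refine ⟨b, ?_, fun _ => (hcomap τ b).1 hb⟩
      refine ((A.valuation_le_one_iff _).2 (hint M.val b)).eq_of_not_lt fun hlt => ?_
      exact ((hcomap M.val b).2 hlt).ne hb'
  choose c hc hc' using hex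
  let c₁ : integralClosure R M := ∏ τ, c τ
  have hc₁ : A.valuation (M.val c₁) = 1 := by
    simp only [c₁, SubmonoidClass.coe_finsetProd, map_prod, hc,
      Finset.prod_const_one]
  have hc₁' : ∀ τ, ¬ Loc τ → A.valuation (τ c₁) < 1 := fun τ hτ => by
    have h1 : c₁ = c τ * ∏ τ' ∈ Finset.univ.erase τ, c τ' :=
      (Finset.mul_prod_erase _ _ (Finset.mem_univ τ)).symm
    rw [h1, MulMemClass.coe_mul, map_mul, map_mul]
    exact mul_lt_one_of_lt_of_le (hc' τ hτ) ((A.valuation_le_one_iff _).2 (hint τ _))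
  have hc₁l : ∀ τ, Loc τ → A.valuation (τ c₁) = 1 := fun τ hτ => by
    refine ((A.valuation_le_one_iff _).2 (hint τ c₁)).eq_of_not_lt fun hlt => ?_
    have h1 : (A.comap (τ : M →+* Ω)).valuation (c₁ : M) < 1 := (hcomap τ c₁).2 hlt
    have h2 : A₁.valuation (c₁ : M) < 1 := by
      rw [valuation_lt_one_iff_inv] at h1 ⊢
      rwa [show A.comap (τ : M →+* Ω) = A₁ from hτ] at h1
    exact ((hcomap M.val c₁).1 h2).ne hc₁
  -- This is where the base being archimedean enters: a power of the small number `τ c₁` outweighs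
  -- `τ y / y`, uniformly in the finitely many `τ`.
  have hN : ∃ N : ℕ, ∀ τ, ¬ Loc τ → A.valuation (τ c₁) ^ N * A.valuation (τ yM / y) < 1 := by
    have h1 : ∀ τ, ∃ N : ℕ, ¬ Loc τ → A.valuation (τ c₁) ^ N * A.valuation (τ yM / y) < 1 :=
      fun τ => by
        by_cases h : Loc τ
        · exact ⟨0, fun h' => absurd h h'⟩
        · obtain ⟨N, hN⟩ := exists_pow_mul_lt_one A harch (τ c₁) (τ yM / y) (hc₁' τ h)
          exact ⟨N, fun _ => hN⟩
    choose N hN using h1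
    refine ⟨∑ τ, N τ, fun τ hτ => lt_of_le_of_lt ?_ (hN τ hτ)⟩
    refine mul_le_mul_left (pow_le_pow_of_le_one zero_le (hc₁' τ hτ).le ?_) _
    exact Finset.single_le_sum (f := N) (fun _ _ => Nat.zero_le _) (Finset.mem_univ τ)
  obtain ⟨N, hN⟩ := hN
  have hu : ∀ τ, Loc τ → A.valuation (τ yM / y) = 1 := fun τ hτ => by
    obtain ⟨σ, hσ, hστ⟩ := hloc τ hτ
    rw [map_div₀, ← hστ, valuation_apply_eq hσ, div_self]
    exact (map_ne_zero _).2 hy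
  have hres : ∀ a b : A, IsLocalRing.residue A a = IsLocalRing.residue A b ↔
      A.valuation ((a : Ω) - b) < 1 := fun a b => by
    rw [← sub_eq_zero, ← map_sub, IsLocalRing.residue_eq_zero_iff, A.valuation_lt_one_iff]
    rfl
  -- Dedekind independence
  let χ : {τ // Loc τ} → (integralClosure R M →* IsLocalRing.ResidueField A) := fun τ =>
    ((IsLocalRing.residue A).comp ((τ.1 : M →+* Ω).comp
      (integralClosure R M).val.toRingHom |>.codRestrict A.toSubring (hint τ.1)) : _ →+* _)
  -- Different embeddings preserving the place have different reductions. Both extend to the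
  -- decomposition group, and `eq_of_residue_eq` shows that equal reductions imply equality at `y`.
  have hχ : Function.Injective χ := fun τ τ' h => by
    obtain ⟨σ, hσ, hστ⟩ := hloc τ.1 τ.2
    obtain ⟨σ', hσ', hστ'⟩ := hloc τ'.1 τ'.2
    have h1 := eq_of_residue_eq M hA hfixM (σ⁻¹ * σ')
      (by rw [mul_smul, hσ', inv_smul_eq_iff, hσ]) (fun b => by
        have h2 := DFunLike.congr_fun h b
        have h3 := (hres ⟨τ.1 b, hint τ.1 b⟩ ⟨τ'.1 b, hint τ'.1 b⟩).1 h2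
        rw [← valuation_apply_lt_one_iff hσ, map_sub]
        have h4 : σ ((σ⁻¹ * σ') ((b : M) : Ω)) = τ'.1 b := by
          rw [← hστ']
          exact σ.apply_symm_apply _
        rw [h4, hστ, Valuation.map_sub_swap]
        exact h3) y hyM
    have h5 : σ' y = σ y := by
      have := congrArg σ h1
      rw [← this]
      exact (σ.apply_symm_apply _).symm
    refine Subtype.ext (IntermediateField.algHom_ext_of_eq_adjoin E (s := {y}) rfl ?_)
    rintro _ rfl
    exact (hστ yM).symm.trans (h5.symm.trans (hστ' yM))
  have hunit : ∀ x (hx : x ∈ A), A.valuation x = 1 → IsLocalRing.residue A ⟨x, hx⟩ ≠ 0 :=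
    fun x hx h1 h2 => by
      rw [IsLocalRing.residue_eq_zero_iff, A.valuation_lt_one_iff] at h2
      exact h2.ne h1
  have humem : ∀ τ, Loc τ → τ yM / y ∈ A := fun τ hτ => (A.valuation_le_one_iff _).1 (hu τ hτ).le
  let w : {τ // Loc τ} → IsLocalRing.ResidueField A := fun τ =>
    IsLocalRing.residue A ⟨τ.1 c₁, hint τ.1 c₁⟩ ^ N *
      IsLocalRing.residue A ⟨τ.1 yM / y, humem τ.1 τ.2⟩
  obtain ⟨b, hb⟩ : ∃ b, ∑ τ, w τ * χ τ b ≠ 0 := by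
    by_contra! hP
    have hli := (linearIndependent_monoidHom (integralClosure R M)
      (IsLocalRing.ResidueField A)).comp χ hχ
    rw [Fintype.linearIndependent_iff] at hli
    have h1 := hli w (by
      funext b
      simpa using hP b) ⟨M.val, hid⟩
    exact mul_ne_zero (pow_ne_zero _ (hunit _ _ (hc₁l _ hid))) (hunit _ _ (hu _ hid)) h1
  let z : M := (c₁ : M) ^ N * b * yM
  refine ⟨Algebra.trace E M z, ?_⟩
  have htr : algebraMap E Ω (Algebra.trace E M z) / y = ∑ τ : M →ₐ[E] Ω, τ z / y := by
    rw [trace_eq_sum_embeddings Ω, Finset.sum_div]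
  have hz : ∀ τ : M →ₐ[E] Ω, τ z / y = τ c₁ ^ N * (τ yM / y) * τ b := fun τ => by
    simp only [z, map_mul, map_pow]
    ring
  have hsplit : ∑ τ : M →ₐ[E] Ω, τ z / y =
      ∑ τ ∈ Finset.univ.filter (fun τ => ¬ Loc τ), τ z / y + ∑ τ : {τ // Loc τ}, τ.1 z / y := by
    rw [← Finset.sum_filter_add_sum_filter_not Finset.univ Loc, add_comm]
    congr 1
    exact Finset.sum_subtype _ (by simp) _
  have hnl : A.valuation (∑ τ ∈ Finset.univ.filter (fun τ => ¬ Loc τ), τ z / y) < 1 := by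
    refine A.valuation.map_sum_lt one_ne_zero fun τ hτ => ?_
    rw [hz, map_mul, map_mul, map_pow]
    exact mul_lt_one_of_lt_of_le (hN τ (by simpa using hτ))
      ((A.valuation_le_one_iff _).2 (hint τ b))
  have hl : A.valuation (∑ τ : {τ // Loc τ}, τ.1 z / y) = 1 := by
    let q : A := ∑ τ : {τ // Loc τ}, ⟨τ.1 c₁, hint τ.1 c₁⟩ ^ N *
      ⟨τ.1 yM / y, humem τ.1 τ.2⟩ * ⟨τ.1 b, hint τ.1 b⟩
    have h1 : IsLocalRing.residue A q ≠ 0 := by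
      convert hb using 1
      simp only [q, map_sum, map_mul, map_pow]
      rfl
    have h2 : (q : Ω) = ∑ τ : {τ // Loc τ}, τ.1 z / y := by
      simp only [q, AddSubmonoidClass.coe_finsetSum, MulMemClass.coe_mul,
        SubmonoidClass.coe_pow, hz]
    rw [← h2]
    rw [Ne, IsLocalRing.residue_eq_zero_iff, A.valuation_lt_one_iff] at h1
    exact ((A.valuation_le_one_iff _).2 q.2).eq_of_not_lt h1
  have hfinal : A.valuation (algebraMap E Ω (Algebra.trace E M z) / y) = 1 := by
    rw [htr, hsplit, Valuation.map_add_eq_of_lt_right _ (by rwa [hl]), hl]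
  rw [map_div₀, div_eq_one_iff_eq ((map_ne_zero _).2 hy)] at hfinal
  exact hfinal

end Unramified

/-! ### Extension of a place to the algebraic closure -/

section Places

open Polynomial
open scoped Pointwise

/-- A homomorphism from a valuation ring of an algebraically closed field is surjective if the
target is integral over it. -/
lemma surjective_of_integral {Ω k' : Type*} [Field Ω] [IsAlgClosed Ω] [Field k']
    (A : ValuationSubring Ω) (ψ : A →+* k')
    (h : ∀ y : k', ∃ p : A[X], p.Monic ∧ p.eval₂ ψ y = 0) : Function.Surjective ψ := by
  intro y
  obtain ⟨p, hp, hpy⟩ := h y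
  clear h
  induction hn : p.natDegree generalizing p with
  | zero =>
    rw [hp.natDegree_eq_zero.1 hn, eval₂_one] at hpy
    exact absurd hpy one_ne_zero
  | succ n ih =>
    have hdeg : (p.map (algebraMap A Ω)).degree ≠ 0 := by
      rw [hp.degree_map, degree_eq_natDegree hp.ne_zero, hn]
      exact_mod_cast Nat.succ_ne_zero n
    -- A monic polynomial splits over `Ω` and its roots are integral, so they lie in `A`. Roots are
    -- removed one by one until `y` is the image of one of them.
    obtain ⟨r, hr⟩ := IsAlgClosed.exists_root _ hdeg
    have hri : IsIntegral A r := ⟨p, hp, by rwa [IsRoot, eval_map] at hr⟩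
    obtain ⟨r', rfl⟩ := IsIntegrallyClosed.isIntegral_iff.1 hri
    have hr' : p.IsRoot r' := by
      refine Subtype.val_injective ?_
      have h1 : (p.map (algebraMap A Ω)).eval (algebraMap A Ω r') = 0 := hr
      rw [eval_map_algebraMap, aeval_algebraMap_apply] at h1
      exact h1
    obtain ⟨q, hq⟩ := dvd_iff_isRoot.2 hr'
    have hqm : q.Monic := (monic_X_sub_C r').of_mul_monic_left (hq ▸ hp)
    rw [hq, eval₂_mul, mul_eq_zero, eval₂_sub, eval₂_X, eval₂_C, sub_eq_zero] at hpy
    rcases hpy with h | h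
    · exact ⟨r', h.symm⟩
    · refine ih q hqm h ?_
      have := congrArg natDegree hq
      rw [(monic_X_sub_C r').natDegree_mul hqm, natDegree_X_sub_C] at this
      omega

variable {K Ω κ κbar : Type*} [Field K] [Field Ω] [Field κ] [Field κbar] [Algebra K Ω]
  [Algebra κ κbar] (O : Subring K) (red : O →+* κ)

/-- `O` is a valuation ring with residue field `κ`. -/
structure IsReduction : Prop where
  mem_or_inv_mem : ∀ x : K, x ∈ O ∨ x⁻¹ ∈ O
  surjective : Function.Surjective red
  eq_zero_iff : ∀ x : O, red x = 0 ↔ (x : K) = 0 ∨ (x : K)⁻¹ ∉ O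

variable {O red}

/-- The valuation subring with underlying ring `O`. -/
def IsReduction.valuationSubring (h : IsReduction O red) : ValuationSubring K :=
  { O with mem_or_inv_mem' := h.mem_or_inv_mem }

lemma IsReduction.mem_valuationSubring (h : IsReduction O red) (x : K) :
    x ∈ h.valuationSubring ↔ x ∈ O := Iff.rfl

lemma IsReduction.red_eq_zero_iff (h : IsReduction O red) (x : O) :
    red x = 0 ↔ h.valuationSubring.valuation (x : K) < 1 := by
  rw [valuation_lt_one_iff_inv, h.eq_zero_iff, h.mem_valuationSubring]

/-- The place of the algebraic closure extending a given one. -/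
lemma IsReduction.exists_extension [IsAlgClosed Ω] [Algebra.IsAlgebraic K Ω] [IsAlgClosed κbar]
    [Algebra.IsAlgebraic κ κbar] (h : IsReduction O red) :
    ∃ (A : ValuationSubring Ω) (hA : ∀ x : K, algebraMap K Ω x ∈ A ↔ x ∈ O) (ψ : A →+* κbar),
      (∀ a, ψ a = 0 ↔ a ∈ IsLocalRing.maximalIdeal A) ∧
      ∀ x : O, ψ ⟨algebraMap K Ω x, (hA x).2 x.2⟩ = algebraMap κ κbar (red x) := by
  let V := h.valuationSubring
  -- A valuation ring of `Ω` dominating `V`. Domination, rather than mere inclusion, yields that its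
  -- restriction to `K` is no larger than `O`.
  obtain ⟨A, hA, hloc⟩ := IsLocalRing.exists_factor_valuationRing
    ((algebraMap K Ω).comp V.subtype)
  have hA' : ∀ x : K, algebraMap K Ω x ∈ A ↔ x ∈ O := fun x => by
    refine ⟨fun hx => ?_, fun hx => hA ⟨x, hx⟩⟩
    by_contra hxO
    have hx0 : x ≠ 0 := fun h0 => hxO (h0 ▸ O.zero_mem)
    have hxi : x⁻¹ ∈ O := (h.mem_or_inv_mem x).resolve_left hxO
    let y : V := ⟨x⁻¹, hxi⟩
    have hu : IsUnit y := by
      refine hloc.map_nonunit y (IsUnit.of_mul_eq_one ⟨_, hx⟩ (Subtype.ext ?_))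
      change algebraMap K Ω x⁻¹ * algebraMap K Ω x = 1
      rw [← map_mul, inv_mul_cancel₀ hx0, map_one]
    obtain ⟨z, hz⟩ := hu.exists_right_inv
    have hz' : x⁻¹ * (z : K) = 1 := congrArg Subtype.val hz
    rw [inv_mul_eq_one₀ hx0] at hz'
    exact hxO (hz' ▸ z.2)
  let f : O →+* IsLocalRing.ResidueField A := (IsLocalRing.residue A).comp
    (((algebraMap K Ω).comp O.subtype).codRestrict A.toSubring fun x => (hA' x).2 x.2)
  have hf : ∀ x : O, f x = 0 ↔ A.valuation (algebraMap K Ω x) < 1 := fun x => by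
    rw [RingHom.comp_apply, IsLocalRing.residue_eq_zero_iff, A.valuation_lt_one_iff]
    rfl
  have hval : ∀ x : O, red x = 0 ↔ f x = 0 := fun x => by
    rw [hf, h.eq_zero_iff, valuation_lt_one_iff_inv, ← map_inv₀, hA', map_eq_zero]
  let ι : κ →+* IsLocalRing.ResidueField A := RingHom.liftOfSurjective red h.surjective
    ⟨f, fun x hx => (hval x).1 hx⟩
  have hι : ∀ x, ι (red x) = f x := fun x =>
    RingHom.liftOfRightInverse_comp_apply _ _ _ ⟨f, fun x hx => (hval x).1 hx⟩ x
  let : Algebra κ (IsLocalRing.ResidueField A) := ι.toAlgebra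
  -- Each residue class of `A` contains an element integral over `O`, whose equation can be reduced.
  -- Being algebraic, the residue field of `A` embeds in `κbar` over `κ`.
  have : Algebra.IsAlgebraic κ (IsLocalRing.ResidueField A) := ⟨fun y => by
    obtain ⟨⟨x, hx⟩, rfl⟩ := IsLocalRing.residue_surjective y
    obtain ⟨b, ⟨p, hp, hpb⟩, hxb⟩ := exists_integral_sub_lt hA' hx
    have hbA : b ∈ A := mem_of_isIntegral hA' ⟨p, hp, hpb⟩
    have e : IsLocalRing.residue A ⟨x, hx⟩ = IsLocalRing.residue A ⟨b, hbA⟩ := by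
      rw [← sub_eq_zero, ← map_sub, IsLocalRing.residue_eq_zero_iff, A.valuation_lt_one_iff]
      exact hxb
    rw [e]
    refine IsIntegral.isAlgebraic ⟨p.map red, hp.map red, ?_⟩
    rw [eval₂_map]
    have e2 : (algebraMap κ (IsLocalRing.ResidueField A)).comp red = f := RingHom.ext hι
    rw [e2]
    have e3 : p.eval₂ (((algebraMap K Ω).comp O.subtype).codRestrict A.toSubring
        fun x => (hA' x).2 x.2 : O →+* A) ⟨b, hbA⟩ = 0 := by
      refine Subtype.ext ?_
      change A.subtype _ = _
      rw [hom_eval₂]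
      exact hpb
    have e4 := congrArg (IsLocalRing.residue A) e3
    rw [map_zero, hom_eval₂] at e4
    exact e4⟩
  let j : IsLocalRing.ResidueField A →ₐ[κ] κbar := IsAlgClosed.lift
  refine ⟨A, hA', j.toRingHom.comp (IsLocalRing.residue A), fun a => ?_, fun x => ?_⟩
  · rw [RingHom.comp_apply, ← IsLocalRing.residue_eq_zero_iff]
    exact map_eq_zero j
  · have h1 := j.commutes (red x)
    rw [← h1]
    change j (f x) = j (ι (red x))
    rw [hι]

end Places

/-! ### Conjugacy of places, and the Galois group of the residue field -/

section PlaceConjugation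

open Polynomial
open scoped Pointwise

variable {F Ω k' : Type*} [Field F] [Field Ω] [Field k'] [Algebra F Ω] {R : Subring F}

/-- A place of `Ω` above `R`, given by a valuation ring and a reduction map. -/
structure IsPlaceOver (f : R →+* k') (A : ValuationSubring Ω) (ψ : A →+* k') : Prop where
  mem_iff : ∀ x : F, algebraMap F Ω x ∈ A ↔ x ∈ R
  eq_zero_iff : ∀ a : A, ψ a = 0 ↔ a ∈ IsLocalRing.maximalIdeal A
  apply_algebraMap : ∀ x : R, ψ ⟨algebraMap F Ω x, (mem_iff x).2 x.2⟩ = f x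

variable {f : R →+* k'} {A A' : ValuationSubring Ω} {ψ : A →+* k'} {ψ' : A' →+* k'}

lemma IsPlaceOver.surjective [IsAlgClosed Ω] (h : IsPlaceOver f A ψ) (hf : f.IsIntegral) :
    Function.Surjective ψ := by
  refine surjective_of_integral A ψ fun y => ?_
  obtain ⟨p, hp, hpy⟩ := hf y
  let j : R →+* A := ((algebraMap F Ω).comp R.subtype).codRestrict A.toSubring
    fun r => (h.mem_iff r).2 r.2
  have hj : ψ.comp j = f := RingHom.ext h.apply_algebraMap
  exact ⟨p.map j, hp.map j, by rwa [eval₂_map, hj]⟩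

lemma smul_mem_valuationSubring {g : Ω ≃ₐ[F] Ω} (hg : g • A = A') {x : Ω} (hx : x ∈ A) :
    g x ∈ A' := by
  rw [← hg]
  exact ValuationSubring.smul_mem_pointwise_smul g x A hx

lemma valuation_lt_one_iff_of_smul_eq {g : Ω ≃ₐ[F] Ω} (hg : g • A = A') (x : Ω) :
    A'.valuation (g x) < 1 ↔ A.valuation x < 1 := by
  subst hg
  rw [valuation_smul_lt_one_iff]
  have : g⁻¹ (g x) = x := g.symm_apply_apply x
  rw [this]

/-- Places above the same ring are conjugate. -/
lemma IsPlaceOver.exists_conj [IsAlgClosed Ω] [IsGalois F Ω] (h : IsPlaceOver f A ψ)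
    (h' : IsPlaceOver f A' ψ') (hf : f.IsIntegral) :
    ∃ (g : Ω ≃ₐ[F] Ω) (_ : g • A = A'), ∀ x (hx : x ∈ A) (hx' : g x ∈ A'),
      ψ' ⟨g x, hx'⟩ = ψ ⟨x, hx⟩ := by
  -- Conjugation is done in two stages: first the valuation rings are matched, then the reduction
  -- maps, by an element of the decomposition group.
  obtain ⟨σ, hσ⟩ := exists_smul_eq_of_galois h.mem_iff h'.mem_iff
  have hs := h.surjective hf
  have hs' := h'.surjective hf
  let s : A →+* A' := (((σ : Ω ≃+* Ω) : Ω →+* Ω).comp A.subtype).codRestrict A'.toSubring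
    fun x => smul_mem_valuationSubring hσ x.2
  have hker : ∀ x : A, ψ x = 0 ↔ ψ' (s x) = 0 := fun x => by
    rw [h.eq_zero_iff, h'.eq_zero_iff, A.valuation_lt_one_iff, A'.valuation_lt_one_iff]
    exact (valuation_lt_one_iff_of_smul_eq hσ _).symm
  have hss : Function.Surjective (ψ'.comp s) := by
    intro y
    obtain ⟨a, rfl⟩ := hs' y
    have ha : σ⁻¹ (a : Ω) ∈ A := by
      have h1 : (a : Ω) ∈ σ • A := by
        rw [hσ]
        exact a.2
      exact ValuationSubring.mem_pointwise_smul_iff_inv_smul_mem.1 h1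
    refine ⟨⟨σ⁻¹ a, ha⟩, congrArg ψ' (Subtype.ext ?_)⟩
    exact σ.apply_symm_apply (a : Ω)
  let e₁ := RingHom.quotientKerEquivOfSurjective hs
  let e₂ := RingHom.quotientKerEquivOfSurjective hss
  have hk : RingHom.ker (ψ'.comp s) = RingHom.ker ψ := by
    ext x
    exact (hker x).symm
  -- The discrepancy between the two reduction maps, which have the same kernel and are both
  -- surjective.
  let τ : k' ≃+* k' := (e₂.symm.trans (Ideal.quotEquivOfEq hk)).trans e₁
  have hτ : ∀ x : A, τ (ψ' (s x)) = ψ x := fun x => by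
    have : e₂.symm (ψ' (s x)) = Ideal.Quotient.mk _ x := by
      rw [RingEquiv.symm_apply_eq]
      rfl
    change e₁ (Ideal.quotEquivOfEq hk (e₂.symm _)) = _
    rw [this]
    rfl
  obtain ⟨σ', hσ', hψσ'⟩ := exists_smul_eq_of_residue h'.mem_iff ψ' hs' h'.eq_zero_iff τ
    fun r => by
      rw [h'.apply_algebraMap]
      have h1 := hτ ⟨algebraMap F Ω r, (h.mem_iff r).2 r.2⟩
      rw [h.apply_algebraMap, ← h'.apply_algebraMap] at h1
      rw [← h'.apply_algebraMap]
      refine Eq.trans (congrArg (fun z => τ (ψ' z)) (Subtype.ext ?_)) h1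
      exact (σ.commutes r).symm
  refine ⟨σ' * σ, by rw [mul_smul, hσ, hσ'], fun x hx hx' => ?_⟩
  rw [← hτ ⟨x, hx⟩]
  exact hψσ' (σ x) (smul_mem_valuationSubring hσ hx) hx'

lemma mem_inertiaSubgroup_iff (h : ∀ a : A, ψ a = 0 ↔ a ∈ IsLocalRing.maximalIdeal A)
    (d : A.decompositionSubgroup F) :
    d ∈ A.inertiaSubgroup F ↔ ∀ a : A, ψ (d • a) = ψ a := by
  rw [ValuationSubring.inertiaSubgroup, MonoidHom.mem_ker]
  have key : ∀ a : A, ψ (d • a) = ψ a ↔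
      d • IsLocalRing.residue A a = IsLocalRing.residue A a := fun a => by
    rw [← IsLocalRing.ResidueField.residue_smul, ← sub_eq_zero, ← map_sub, h,
      ← IsLocalRing.residue_eq_zero_iff, map_sub, sub_eq_zero]
  constructor
  · intro hd a
    rw [key]
    exact RingEquiv.congr_fun hd _
  · intro hd
    ext y
    obtain ⟨a, rfl⟩ := IsLocalRing.residue_surjective y
    exact (key a).1 (hd a)

lemma valuation_sub_lt_one_of_mem_inertiaSubgroup
    (h : ∀ a : A, ψ a = 0 ↔ a ∈ IsLocalRing.maximalIdeal A)
    {σ : Ω ≃ₐ[F] Ω} (hσ : σ • A = A) (hx : ∀ x ∈ A, A.valuation (σ x - x) < 1) :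
    (⟨σ, hσ⟩ : A.decompositionSubgroup F) ∈ A.inertiaSubgroup F := by
  rw [mem_inertiaSubgroup_iff h]
  intro a
  rw [← sub_eq_zero, ← map_sub, h, A.valuation_lt_one_iff]
  exact hx a a.2

/-- For each `x`, whether `σ x` lies in `A` is a locally constant condition on `σ`. Closedness makes
the decomposition group compact in a Galois extension, as needed for `continuous_galHom`. -/
lemma isClosed_decompositionSubgroup [Algebra.IsAlgebraic F Ω] (A : ValuationSubring Ω) :
    IsClosed (A.decompositionSubgroup F : Set (Ω ≃ₐ[F] Ω)) := by
  have h : (A.decompositionSubgroup F : Set (Ω ≃ₐ[F] Ω)) =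
      ⋂ x : Ω, {σ | σ x ∈ A ↔ x ∈ A} := by
    ext σ
    rw [Set.mem_iInter]
    refine ⟨fun hσ x => apply_mem_iff hσ x, fun hσ => ?_⟩
    refine MulAction.mem_stabilizer_iff.2 (ValuationSubring.ext _ _ fun y => ?_)
    rw [ValuationSubring.mem_pointwise_smul_iff_inv_smul_mem]
    have h1 : σ (σ⁻¹ y) ∈ A ↔ σ⁻¹ y ∈ A := hσ (σ⁻¹ y)
    have h2 : σ (σ⁻¹ y) = y := σ.apply_symm_apply y
    rw [h2] at h1
    exact h1.symm
  rw [h]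
  refine isClosed_iInter fun x => ?_
  have h1 := isLocallyConstant_algEquiv_apply (F := F) x
  simpa using (h1.comp fun y => (y ∈ A ↔ x ∈ A)).isClosed_fiber True

section Existence

variable {κ κbar : Type*} [Field κ] [Field κbar] [Algebra κ κbar]
  {φ : R →+* κ} {χ : A →+* κbar}

lemma IsPlaceOver.mk_eq_mk (h : IsPlaceOver ((algebraMap κ κbar).comp φ) A χ)
    {σ : κbar ≃ₐ[κ] κbar} {d d' : A.decompositionSubgroup F}
    (hd : ∀ a : A, χ (d • a) = σ (χ a)) :
    (d : A.decompositionSubgroup F ⧸ A.inertiaSubgroup F) = d' ↔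
      ∀ a : A, χ (d' • a) = σ (χ a) := by
  rw [QuotientGroup.eq, mem_inertiaSubgroup_iff h.eq_zero_iff]
  constructor
  · intro h1 a
    rw [← h1 a, ← hd, mul_smul, smul_inv_smul]
  · intro h1 a
    apply σ.injective
    rw [← hd, ← h1, mul_smul, smul_inv_smul]

variable [IsAlgClosed Ω] [IsGalois F Ω]

lemma IsPlaceOver.exists_decomposition (h : IsPlaceOver ((algebraMap κ κbar).comp φ) A χ)
    (hf : ((algebraMap κ κbar).comp φ).IsIntegral) (σ : κbar ≃ₐ[κ] κbar) :
    ∃ d : A.decompositionSubgroup F, ∀ a : A, χ (d • a) = σ (χ a) := by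
  obtain ⟨d, hd, hd'⟩ := exists_smul_eq_of_residue h.mem_iff χ (h.surjective hf) h.eq_zero_iff
    σ.toRingEquiv fun r => by
      rw [h.apply_algebraMap]
      exact σ.commutes _
  exact ⟨⟨d, hd⟩, fun a => hd' a a.2 _⟩

/-- The homomorphism from the Galois group of the residue field to the quotient of the
decomposition group by the inertia group. -/
noncomputable def IsPlaceOver.galHom (h : IsPlaceOver ((algebraMap κ κbar).comp φ) A χ)
    (hf : ((algebraMap κ κbar).comp φ).IsIntegral) :
    (κbar ≃ₐ[κ] κbar) →* (A.decompositionSubgroup F ⧸ A.inertiaSubgroup F) where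
  toFun σ := ((h.exists_decomposition hf σ).choose : A.decompositionSubgroup F)
  map_one' := ((h.mk_eq_mk (h.exists_decomposition hf 1).choose_spec).2
    fun a => by rw [one_smul]; rfl)
  map_mul' σ τ := by
    rw [← QuotientGroup.mk_mul]
    refine (h.mk_eq_mk (h.exists_decomposition hf (σ * τ)).choose_spec).2 fun a => ?_
    rw [mul_smul, (h.exists_decomposition hf σ).choose_spec,
      (h.exists_decomposition hf τ).choose_spec]
    rfl

lemma IsPlaceOver.mk_eq_galHom (h : IsPlaceOver ((algebraMap κ κbar).comp φ) A χ)
    (hf : ((algebraMap κ κbar).comp φ).IsIntegral) (σ : κbar ≃ₐ[κ] κbar)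
    (d : A.decompositionSubgroup F) :
    (d : A.decompositionSubgroup F ⧸ A.inertiaSubgroup F) = h.galHom hf σ ↔
      ∀ a : A, χ (d • a) = σ (χ a) := by
  rw [eq_comm]
  exact h.mk_eq_mk (h.exists_decomposition hf σ).choose_spec

/-- A closed graph argument. The preimage of a closed set is the projection of a closed set of
compatible pairs, along the compact decomposition group. -/
lemma IsPlaceOver.continuous_galHom [Algebra.IsAlgebraic κ κbar]
    (h : IsPlaceOver ((algebraMap κ κbar).comp φ) A χ)
    (hf : ((algebraMap κ κbar).comp φ).IsIntegral) : Continuous (h.galHom hf) := by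
  rw [continuous_iff_isClosed]
  intro Z hZ
  have hcpt : CompactSpace (A.decompositionSubgroup F) :=
    isCompact_iff_compactSpace.1 (isClosed_decompositionSubgroup A).isCompact
  let T : Set ((κbar ≃ₐ[κ] κbar) × A.decompositionSubgroup F) :=
    {p | ∀ a : A, χ (p.2 • a) = p.1 (χ a)} ∩ {p | QuotientGroup.mk p.2 ∈ Z}
  have hT : IsClosed T := by
    refine IsClosed.inter ?_ (hZ.preimage (continuous_quotient_mk'.comp continuous_snd))
    rw [Set.ofPred_forall]
    refine isClosed_iInter fun a => ?_
    have h1 : IsLocallyConstant fun p : (κbar ≃ₐ[κ] κbar) × A.decompositionSubgroup F =>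
        p.1 (χ a) :=
      (isLocallyConstant_algEquiv_apply (F := κ) (χ a)).comp_continuous continuous_fst
    have h2 : IsLocallyConstant fun p : (κbar ≃ₐ[κ] κbar) × A.decompositionSubgroup F =>
        (p.2 : Ω ≃ₐ[F] Ω) (a : Ω) :=
      (isLocallyConstant_algEquiv_apply (F := F) (a : Ω)).comp_continuous
        (continuous_subtype_val.comp continuous_snd)
    have h3 : IsLocallyConstant fun p : (κbar ≃ₐ[κ] κbar) × A.decompositionSubgroup F =>
        χ (p.2 • a) := by
      rw [IsLocallyConstant.iff_exists_open] at h2 ⊢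
      intro p
      obtain ⟨U, hU, hp, h⟩ := h2 p
      exact ⟨U, hU, hp, fun x hx => congrArg χ (Subtype.ext (h x hx))⟩
    simpa [sub_eq_zero] using (h3.sub h1).isClosed_fiber 0
  convert isClosedMap_fst_of_compactSpace T hT using 1
  ext σ
  constructor
  · intro hσ
    obtain ⟨d, hd⟩ := h.exists_decomposition hf σ
    refine ⟨(σ, d), ⟨hd, ?_⟩, rfl⟩
    rw [Set.mem_ofPred_eq, (h.mk_eq_galHom hf σ d).2 hd]
    exact hσ
  · rintro ⟨⟨σ', d⟩, ⟨hd, hdZ⟩, rfl⟩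
    rw [Set.mem_ofPred_eq, (h.mk_eq_galHom hf σ' d).2 hd] at hdZ
    exact hdZ

/-- A place with the resulting identification of Galois groups. -/
noncomputable def IsPlaceOver.toPlace [Algebra.IsAlgebraic κ κbar]
    (h : IsPlaceOver ((algebraMap κ κbar).comp φ) A χ)
    (hf : ((algebraMap κ κbar).comp φ).IsIntegral) : Place (κbar := κbar) Ω φ where
  A := A
  mem_iff := h.mem_iff
  ψ := χ
  ψ_eq_zero_iff := h.eq_zero_iff
  ψ_algebraMap := h.apply_algebraMap
  θ := ⟨h.galHom hf, h.continuous_galHom hf⟩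
  θ_spec σ d hd := (h.mk_eq_galHom hf σ d).1 hd

end Existence

end PlaceConjugation

/-! ### Normalized valuations under restriction and unramified extension -/

section NormalizedValuations

variable {F K : Type*} [Field F] [Field K]

lemma IsNormVal.normVal_eq {O : Subring F} {v : Additive Fˣ →+ ℤ} (hv : IsNormVal O v) :
    normVal O = v := by
  have h : ∃ v, IsNormVal O v := ⟨v, hv⟩
  rw [normVal, dif_pos h]
  exact h.choose_spec.unique hv

lemma IsNormVal.eq_zero_iff {O : Subring F} {v : Additive Fˣ →+ ℤ} (hv : IsNormVal O v)
    (x : Fˣ) : v (Additive.ofMul x) = 0 ↔ (x : F) ∈ O ∧ (x : F)⁻¹ ∈ O := by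
  have h := hv.2 x⁻¹
  rw [ofMul_inv, map_neg, Units.val_inv_eq_inv_val] at h
  rw [hv.2 x, h]
  omega

lemma IsNormVal.mem_or_inv_mem {O : Subring F} {v : Additive Fˣ →+ ℤ} (hv : IsNormVal O v)
    (x : F) : x ∈ O ∨ x⁻¹ ∈ O := by
  by_cases hx : x = 0
  · exact Or.inl (hx ▸ O.zero_mem)
  have h1 := hv.2 (Units.mk0 x hx)
  have h2 := hv.2 (Units.mk0 x hx)⁻¹
  rw [ofMul_inv, map_neg, Units.val_inv_eq_inv_val] at h2
  rw [Units.val_mk0] at h1 h2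
  rw [h1, h2]
  omega

/-- The restriction of a discrete valuation to a subfield, over which the field is algebraic. -/
lemma IsNormVal.exists_restrict [Algebra F K] [Algebra.IsAlgebraic F K] {O : Subring K}
    {v : Additive Kˣ →+ ℤ} (hv : IsNormVal O v) (R : Subring F)
    (hR : ∀ x : F, algebraMap F K x ∈ O ↔ x ∈ R) : ∃ w, IsNormVal R w := by
  let A : ValuationSubring K := { O with mem_or_inv_mem' := hv.mem_or_inv_mem }
  let u : Additive Fˣ →+ ℤ := v.comp (Units.map (algebraMap F K : F →* K)).toAdditive
  obtain ⟨π, hπ⟩ := hv.1 1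
  obtain ⟨j, hj, t, ht, hjt⟩ := exists_pow_valuation_eq (E := F) A π.toMul.ne_zero
  -- The restricted valuation is not zero: some nonzero power of a uniformizer of `K` has the value
  -- of an element `t` of `F`.
  have hu : ∃ s, u s ≠ 0 := by
    refine ⟨Additive.ofMul (Units.mk0 t ht), fun h0 => ?_⟩
    have h1 : v (j • π) = 0 := by
      have h2 : v (j • π - (Units.map (algebraMap F K : F →* K)).toAdditive
          (Additive.ofMul (Units.mk0 t ht))) = 0 := by
        refine (hv.eq_zero_iff ((π.toMul ^ j) * (Units.map (algebraMap F K : F →* K)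
          (Units.mk0 t ht))⁻¹)).2 ?_
        have ht' : algebraMap F K t ≠ 0 := (map_ne_zero _).2 ht
        have h3 : A.valuation ((π.toMul : K) ^ j * (algebraMap F K t)⁻¹) = 1 := by
          rw [map_mul, map_pow, hjt, map_inv₀, mul_inv_cancel₀ ((map_ne_zero _).2 ht')]
        constructor
        · refine (A.valuation_le_one_iff _).1 ?_
          simpa using h3.le
        · refine (A.valuation_le_one_iff _).1 ?_
          have := congrArg (·⁻¹) h3
          simp only [inv_one, ← map_inv₀] at this
          simpa using this.le
      rw [map_sub, sub_eq_zero] at h2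
      exact h2.trans h0
    rw [map_nsmul, hπ] at h1
    exact hj (by simpa using h1)
  -- The image is a nonzero subgroup nℤ; division by `|n|` normalizes the restriction, while its
  -- sign, and with it the valuation ring, is unchanged.
  obtain ⟨n, hn⟩ := Int.subgroup_cyclic u.range
  have hdvd : ∀ x, n ∣ u x := fun x => by
    have : u x ∈ u.range := ⟨x, rfl⟩
    rw [hn, AddSubgroup.mem_closure_singleton] at this
    obtain ⟨z, hz⟩ := this
    exact ⟨z, by rw [← hz, smul_eq_mul, mul_comm]⟩
  obtain ⟨x₀, hx₀⟩ : n ∈ u.range := by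
    rw [hn]
    exact AddSubgroup.subset_closure rfl
  have hn0 : n ≠ 0 := by
    rintro rfl
    obtain ⟨s, hs⟩ := hu
    exact hs (zero_dvd_iff.1 (hdvd s))
  have hpos : 0 < |n| := abs_pos.2 hn0
  have hdvd' : ∀ x, |n| ∣ u x := fun x => (abs_dvd _ _).2 (hdvd x)
  let w : Additive Fˣ →+ ℤ := AddMonoidHom.mk' (fun x => u x / |n|) fun a b => by
    rw [map_add, Int.add_ediv_of_dvd_left (hdvd' a)]
  refine ⟨w, fun z => ?_, fun x => ?_⟩
  · have hw : ∃ y, w y = 1 := by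
      rcases abs_choice n with h | h
      · exact ⟨x₀, by change u x₀ / |n| = 1; rw [h, hx₀, Int.ediv_self hn0]⟩
      · refine ⟨-x₀, ?_⟩
        change u (-x₀) / |n| = 1
        rw [map_neg, hx₀, ← h, Int.ediv_self hpos.ne']
    obtain ⟨y, hy⟩ := hw
    exact ⟨z • y, by rw [map_zsmul, hy, smul_eq_mul, mul_one]⟩
  · rw [← hR]
    refine (hv.2 (Units.map (algebraMap F K : F →* K) x)).trans ?_
    change 0 ≤ u (Additive.ofMul x) ↔ 0 ≤ u (Additive.ofMul x) / |n|
    obtain ⟨c, hc⟩ := hdvd' (Additive.ofMul x)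
    rw [hc, Int.mul_ediv_cancel_left _ hpos.ne', mul_nonneg_iff_of_pos_left hpos]

variable {Ω : Type*} [Field Ω] [Algebra F Ω] {R : Subring F} {w : Additive Fˣ →+ ℤ}
  {A : ValuationSubring Ω}

lemma IsNormVal.valuation_le_iff (hw : IsNormVal R w)
    (hA : ∀ x : F, algebraMap F Ω x ∈ A ↔ x ∈ R) (s t : Fˣ) :
    A.valuation (algebraMap F Ω s) ≤ A.valuation (algebraMap F Ω t) ↔
      w (Additive.ofMul t) ≤ w (Additive.ofMul s) := by
  have ht : algebraMap F Ω t ≠ 0 := (map_ne_zero _).2 t.ne_zero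
  rw [← sub_nonneg (a := w (Additive.ofMul s)), ← map_sub, ← ofMul_div, ← hw.2, ← hA, ← A.valuation_le_one_iff,
    Units.val_div_eq_div_val, map_div₀, map_div₀,
    div_le_one₀ (zero_lt_iff.2 ((map_ne_zero _).2 ht))]

lemma IsNormVal.exists_pow_mul_lt_one (hw : IsNormVal R w)
    (hA : ∀ x : F, algebraMap F Ω x ∈ A ↔ x ∈ R) (t s : F)
    (ht : A.valuation (algebraMap F Ω t) < 1) :
    ∃ N : ℕ, A.valuation (algebraMap F Ω t) ^ N * A.valuation (algebraMap F Ω s) < 1 := by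
  by_cases ht0 : t = 0
  · exact ⟨1, by simp [ht0]⟩
  by_cases hs0 : s = 0
  · exact ⟨1, by simp [hs0]⟩
  let t' := Units.mk0 t ht0
  let s' := Units.mk0 s hs0
  have h1 : ∀ x : Fˣ, A.valuation (algebraMap F Ω x) < 1 ↔ 0 < w (Additive.ofMul x) := fun x => by
    have := hw.valuation_le_iff hA 1 x
    rw [Units.val_one, map_one, map_one, ofMul_one, map_zero] at this
    rw [← not_le, this, not_le]
  have h2 : 0 < w (Additive.ofMul t') := (h1 t').1 ht
  refine ⟨(w (Additive.ofMul s')).natAbs + 1, ?_⟩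
  have h3 := (h1 (t' ^ ((w (Additive.ofMul s')).natAbs + 1) * s')).2 (by
    rw [ofMul_mul, ofMul_pow, map_add, map_nsmul, nsmul_eq_mul]
    have h4 : -w (Additive.ofMul s') ≤ (w (Additive.ofMul s')).natAbs := by omega
    have h5 : (0 : ℤ) ≤ (w (Additive.ofMul s')).natAbs := by omega
    push_cast only [Nat.cast_add, Nat.cast_one]
    nlinarith [mul_le_mul_of_nonneg_left (Int.add_one_le_iff.2 h2) h5])
  simpa [t', s'] using h3

/-- The normalized valuation of a field with the same value group as the base field. -/
lemma IsNormVal.exists_extend {M : Type*} [Field M] (hw : IsNormVal R w)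
    (hA : ∀ x : F, algebraMap F Ω x ∈ A ↔ x ∈ R) (i : F →+* M) (j : M →+* Ω)
    (hij : ∀ x, j (i x) = algebraMap F Ω x)
    (h : ∀ y : M, y ≠ 0 → ∃ t : F, A.valuation (algebraMap F Ω t) = A.valuation (j y)) :
    ∃ u, IsNormVal (A.toSubring.comap j) u ∧
      ∀ x : Fˣ, u (Additive.ofMul (Units.map (i : F →* M) x)) = w (Additive.ofMul x) := by
  have h' : ∀ y : Additive Mˣ, ∃ t : Fˣ,
      A.valuation (algebraMap F Ω t) = A.valuation (j (y.toMul : M)) := fun y => by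
    obtain ⟨t, ht⟩ := h y.toMul y.toMul.ne_zero
    have ht0 : t ≠ 0 := by
      rintro rfl
      rw [map_zero, map_zero, eq_comm, map_eq_zero, map_eq_zero] at ht
      exact y.toMul.ne_zero ht
    exact ⟨Units.mk0 t ht0, ht⟩
  choose T hT using h'
  -- The representatives in `F` were chosen arbitrarily; `w` depends only on their valuation, so the
  -- extension is well defined and additive.
  have key : ∀ s t : Fˣ, A.valuation (algebraMap F Ω s) = A.valuation (algebraMap F Ω t) →
      w (Additive.ofMul s) = w (Additive.ofMul t) := fun s t hst =>
    le_antisymm ((hw.valuation_le_iff hA t s).1 hst.ge) ((hw.valuation_le_iff hA s t).1 hst.le)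
  let u : Additive Mˣ →+ ℤ := AddMonoidHom.mk' (fun y => w (Additive.ofMul (T y))) fun a b => by
    rw [← map_add, ← ofMul_mul]
    apply key
    rw [hT, Units.val_mul, map_mul, map_mul, hT, hT, ← map_mul, ← map_mul, toMul_add,
      Units.val_mul]
  have hu : ∀ x : Fˣ, u (Additive.ofMul (Units.map (i : F →* M) x)) = w (Additive.ofMul x) :=
    fun x => key _ _ (by
      rw [hT]
      change A.valuation (j (i x)) = _
      rw [hij])
  refine ⟨u, ⟨fun z => ?_, fun y => ?_⟩, hu⟩
  · obtain ⟨x, hx⟩ := hw.1 z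
    exact ⟨_, (hu x.toMul).trans hx⟩
  · rw [Subring.mem_comap]
    change j y ∈ A ↔ 0 ≤ w (Additive.ofMul (T (Additive.ofMul y)))
    rw [← hw.2, ← hA, ← A.valuation_le_one_iff, ← A.valuation_le_one_iff, hT]
    rfl

end NormalizedValuations

/-! ### Naturality of inflation and of the valuation map -/

noncomputable section Naturality

variable {Δ Δ' E E' : Type*} [Group Δ] [Field E] [MulSemiringAction Δ E] [Group Δ'] [Field E']
  [MulSemiringAction Δ' E'] [TopologicalSpace Δ] [TopologicalSpace Δ']

/-- The homomorphism of unit groups given by a homomorphism of rings. -/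
def unitsMap (m : E →+* E') : Additive Eˣ →+ Additive E'ˣ := (Units.map (m : E →* E')).toAdditive

lemma unitsMap_unitsRep {m : E →+* E'} {s : Δ' →ₜ* Δ} (hm : ∀ d x, m (s d • x) = d • m x) (d : Δ')
    (x : Additive Eˣ) :
    unitsMap m (unitsRep Δ E (s d) x) = unitsRep Δ' E' d (unitsMap m x) :=
  Additive.toMul.injective (Units.ext (hm d (x.toMul : E)))

/-- The map on `H²` of unit groups given by a compatible pair of homomorphisms. -/
def unitsH2 (s : Δ' →ₜ* Δ) (m : E →+* E') (hm : ∀ d x, m (s d • x) = d • m x) :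
    H2 (unitsRep Δ E) →+ H2 (unitsRep Δ' E') :=
  H2.map s (unitsMap m) (unitsMap_unitsRep hm)

/-- Both sides are induced by the same homomorphism `Δ' → Δ ⧸ N` and the same map of coefficients.
-/
lemma inflation_unitsH2 (N : Subgroup Δ) [N.Normal] (N' : Subgroup Δ') [N'.Normal] (s : Δ' →ₜ* Δ)
    (m : E →+* E') (hm : ∀ d x, m (s d • x) = d • m x) (sbar : (Δ' ⧸ N') →ₜ* (Δ ⧸ N))
    (hsbar : ∀ d : Δ', sbar d = (s d : Δ ⧸ N))
    (mbar : FixedPoints.subfield N E →+* FixedPoints.subfield N' E')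
    (hmbar : ∀ x, (mbar x : E') = m x) (hmbar' : ∀ q x, mbar (sbar q • x) = q • mbar x)
    (γ : H2 (unitsRep (Δ ⧸ N) (FixedPoints.subfield N E))) :
    inflation N' (unitsH2 sbar mbar hmbar' γ) = unitsH2 s m hm (inflation N γ) := by
  let q : Δ' →ₜ* Δ ⧸ N := ContinuousMonoidHom.comp ⟨QuotientGroup.mk' N, continuous_quotient_mk'⟩ s
  have hq : ∀ d x, unitsMap (m.comp (FixedPoints.subfield N E).subtype)
      (unitsRep (Δ ⧸ N) (FixedPoints.subfield N E) (q d) x) =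
      unitsRep Δ' E' d (unitsMap (m.comp (FixedPoints.subfield N E).subtype) x) := fun d x =>
    Additive.toMul.injective (Units.ext (hm d ((x.toMul : FixedPoints.subfield N E) : E)))
  have hx : ∀ x, (Units.map ((FixedPoints.subfield N' E').subtype : _ →* E')).toAdditive
      (unitsMap mbar x) = unitsMap (m.comp (FixedPoints.subfield N E).subtype) x := fun x =>
    Additive.toMul.injective (Units.ext (hmbar (x.toMul : FixedPoints.subfield N E)))
  refine (H2.map_map _ _ _ _ _ _ q (unitsMap (m.comp (FixedPoints.subfield N E).subtype)) hq
    hsbar hx γ).trans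
    (H2.map_map _ _ _ _ _ _ q (unitsMap (m.comp (FixedPoints.subfield N E).subtype)) hq
      (fun _ => rfl) (fun _ => rfl) γ).symm

/-- Compatibility needs `m` to preserve normalized valuations exactly; with ramification the two
sides would differ by the ramification index. -/
lemma map_valH2_unitsH2 {Γ Γ' Λ : Type*} [Group Γ] [Group Γ'] [Group Λ] [TopologicalSpace Γ]
    [TopologicalSpace Γ'] [TopologicalSpace Λ] [MulSemiringAction Γ E] [MulSemiringAction Γ' E']
    (s : Γ' →ₜ* Γ) (m : E →+* E') (hm : ∀ d x, m (s d • x) = d • m x)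
    (O : Subring E) (hO : ∀ (g : Γ), ∀ x ∈ O, g • x ∈ O)
    (O' : Subring E') (hO' : ∀ (g : Γ'), ∀ x ∈ O', g • x ∈ O')
    (hv : ∀ x, normVal O' (unitsMap m x) = normVal O x) (θ : Λ →ₜ* Γ') (τ : Λ →ₜ* Γ)
    (hθ : ∀ σ, s (θ σ) = τ σ) (γ : H2 (unitsRep Γ E)) :
    H2.map (ρ' := trivRep Λ ℤ) θ (AddMonoidHom.id ℤ) (fun _ _ => rfl)
      (valH2 O' hO' (unitsH2 s m hm γ)) =
    H2.map (ρ' := trivRep Λ ℤ) τ (AddMonoidHom.id ℤ) (fun _ _ => rfl) (valH2 O hO γ) := by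
  have h1 : ∀ g x, normVal O (unitsRep Γ E (s g) x) = normVal O x :=
    fun g x => normVal_smul O hO (s g) x
  have h2 : ∀ g x, normVal O (unitsRep Γ E (τ g) x) = normVal O x :=
    fun g x => normVal_smul O hO (τ g) x
  have h3 : valH2 O' hO' (unitsH2 s m hm γ) =
      H2.map (ρ' := trivRep Γ' ℤ) s (normVal O) h1 γ :=
    H2.map_map _ _ _ _ _ _ _ _ _ (fun _ => rfl) hv γ
  have h4 : H2.map (ρ' := trivRep Λ ℤ) θ (AddMonoidHom.id ℤ) (fun _ _ => rfl)
      (H2.map (ρ' := trivRep Γ' ℤ) s (normVal O) h1 γ) =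
      H2.map (ρ' := trivRep Λ ℤ) τ (normVal O) h2 γ :=
    H2.map_map _ _ _ _ _ _ _ _ _ hθ (fun _ => rfl) γ
  rw [h3, h4]
  exact (H2.map_map _ _ _ _ _ _ _ _ _ (fun _ => rfl) (fun _ => rfl) γ).symm

/-- Surjectivity of the valuation on the smaller field expresses that there is no ramification. The
restriction is then itself normalized, and uniqueness applies. -/
lemma IsNormVal.normVal_unitsMap {O : Subring E} {O' : Subring E'} {u : Additive E'ˣ →+ ℤ}
    (hu : IsNormVal O' u) (m : E →+* E') (hm : ∀ x, m x ∈ O' ↔ x ∈ O)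
    (hs : ∀ z, ∃ x, u (unitsMap m x) = z) (x : Additive Eˣ) :
    normVal O' (unitsMap m x) = normVal O x := by
  have hu' : IsNormVal O (u.comp (unitsMap m)) := ⟨hs, fun y => by
    rw [← hm]
    exact hu.2 (Units.map (m : E →* E') y)⟩
  rw [hu.normVal_eq, hu'.normVal_eq]
  rfl

end Naturality

/-! ### The residue in terms of a lift to the quotient by inertia -/

noncomputable section ResidueComputation

set_option linter.unusedSectionVars false

open Polynomial
open scoped Pointwise

variable {K Ω κ κbar H : Type*} [Field K] [Field Ω] [Algebra K Ω] [Field κ] [Field κbar]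
  [Algebra κ κbar] [Algebra.IsAlgebraic K Ω] [Algebra.IsAlgebraic κ κbar]
  [Group H] [Finite H] [TopologicalSpace H]
  [MulSemiringAction H K] [MulSemiringAction H κ]
  {O : Subring K} {red : O →+* κ}

/-- The reduction map on a subfield over which `K` is algebraic is integral. -/
lemma IsReduction.isIntegral_restrict (hred : IsReduction O red)
    (F : Subfield K) [Algebra.IsAlgebraic F K]
    (φ : O.comap F.subtype →+* FixedPoints.subfield H κ)
    (hφ : ∀ x, (φ x : κ) = red ⟨x.1, x.2⟩) :
    ((algebraMap (FixedPoints.subfield H κ) κbar).comp φ).IsIntegral := by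
  let f : O.comap F.subtype →+* κ := (FixedPoints.subfield H κ).subtype.comp φ
  have hf : f.IsIntegral := by
    intro z
    obtain ⟨⟨x, hx⟩, rfl⟩ := hred.surjective z
    obtain ⟨b, ⟨p, hp, hpb⟩, hxb⟩ := exists_integral_sub_lt (E := F) (R := O.comap F.subtype)
      (A := hred.valuationSubring) (fun y => Iff.rfl) hx
    have hbO : b ∈ O := mem_of_isIntegral (E := F) (R := O.comap F.subtype)
      (A := hred.valuationSubring) (fun y => Iff.rfl) ⟨p, hp, hpb⟩
    have e : red ⟨x, hx⟩ = red ⟨b, hbO⟩ := by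
      rw [← sub_eq_zero, ← map_sub, hred.red_eq_zero_iff]
      exact hxb
    let j : O.comap F.subtype →+* O := (F.subtype.comp (O.comap F.subtype).subtype).codRestrict O
      fun x => x.2
    have hj : red.comp j = f := RingHom.ext fun y => (hφ y).symm
    refine ⟨p, hp, ?_⟩
    have h1 : p.eval₂ j ⟨b, hbO⟩ = 0 := by
      refine Subtype.ext ?_
      change O.subtype _ = _
      rw [hom_eval₂]
      exact hpb
    rw [e, ← hj, ← hom_eval₂, h1, map_zero]
  have hg : (algebraMap κ κbar).IsIntegral := fun y => Algebra.IsIntegral.isIntegral y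
  exact hf.trans _ _ hg

variable [IsAlgClosed Ω] [FaithfulSMul H K]

section Decomposition

variable (hred : IsReduction O red) {v : Additive Kˣ →+ ℤ} (hv : IsNormVal O v)
  (hO : ∀ (h : H), ∀ x ∈ O, h • x ∈ O)
  (hequiv : ∀ (h : H) (x : O), red ⟨h • (x : K), hO h x x.2⟩ = h • red x)
  {F : Subfield K} (hF : F ≤ FixedPoints.subfield H K) [Normal F K]
  (hstab : ∀ h : K ≃ₐ[F] K, (∀ x ∈ O, h x ∈ O) → ∃ d : H, ∀ x, h x = d • x)
  {φ : O.comap F.subtype →+* FixedPoints.subfield H κ}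
  (hφ : ∀ x, (φ x : κ) = red ⟨x.1, x.2⟩)

section Conj

variable {A₀ : ValuationSubring Ω} (hA₀ : ∀ x : K, algebraMap K Ω x ∈ A₀ ↔ x ∈ O)
  {A : ValuationSubring Ω} {g : Ω ≃ₐ[F] Ω} (hg : g • A₀ = A)

include hA₀ hg hstab in
-- Conjugated back by `g`, an element of the decomposition group of `A` preserves `A₀`. Its
-- restriction to `K` then preserves `O`, so by `hstab` it is given by an element of `H` and fixes
-- `K^H`. In this way the decomposition group reaches `H`, even when `F` is smaller than `K^H`.
lemma conj_mem_fixing (d : A.decompositionSubgroup F) (x : FixedPoints.subfield H K) :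
    (g⁻¹ * (d : Ω ≃ₐ[F] Ω) * g) (algebraMap K Ω x) = algebraMap K Ω x := by
  let σ : Ω ≃ₐ[F] Ω := g⁻¹ * d * g
  have hσ : σ • A₀ = A₀ := by
    have hd : (d : Ω ≃ₐ[F] Ω) • A = A := d.2
    rw [mul_smul, mul_smul, hg, hd, ← hg, inv_smul_smul]
  obtain ⟨h, hh⟩ := hstab (AlgEquiv.restrictNormal σ K) fun y hy => by
    rw [← hA₀, AlgEquiv.restrictNormal_commutes, apply_mem_iff hσ, hA₀]
    exact hy
  change σ _ = _
  rw [← AlgEquiv.restrictNormal_commutes, hh]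
  exact congrArg _ (x.2 h)

/-- Conjugation by `g⁻¹`, from the decomposition group of `g • A₀` to the Galois group of the
fixed field. -/
def conjDecomposition : A.decompositionSubgroup F →ₜ* (Ω ≃ₐ[FixedPoints.subfield H K] Ω) where
  toFun d := { (g⁻¹ * (d : Ω ≃ₐ[F] Ω) * g) with
    commutes' := conj_mem_fixing hstab hA₀ hg d }
  map_one' := by
    ext x
    change g⁻¹ (g x) = x
    exact g.symm_apply_apply x
  map_mul' d e := by
    ext x
    change g⁻¹ ((d : Ω ≃ₐ[F] Ω) ((e : Ω ≃ₐ[F] Ω) (g x))) =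
      g⁻¹ ((d : Ω ≃ₐ[F] Ω) (g (g⁻¹ ((e : Ω ≃ₐ[F] Ω) (g x)))))
    have : ∀ y, g (g⁻¹ y) = y := g.apply_symm_apply
    rw [this]
  continuous_toFun := by
    have : Algebra.IsAlgebraic F Ω := Algebra.IsAlgebraic.trans F K Ω
    refine continuous_of_isLocallyConstant _ fun x => ?_
    exact ((isLocallyConstant_algEquiv_apply (F := F) (g x)).comp_continuous
      continuous_subtype_val).comp (g⁻¹ : Ω ≃ₐ[F] Ω)

lemma conjDecomposition_apply (d : A.decompositionSubgroup F) (x : Ω) :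
    g (conjDecomposition hstab hA₀ hg d x) = (d : Ω ≃ₐ[F] Ω) (g x) :=
  g.apply_symm_apply _

/-- The homomorphism from the decomposition group of `g • A₀` to `H`. -/
def decompositionToGroup : A.decompositionSubgroup F →ₜ* H :=
  (galToGroup Ω H).comp (conjDecomposition hstab hA₀ hg)

lemma decompositionToGroup_smul (d : A.decompositionSubgroup F) (x : K) :
    g (algebraMap K Ω (decompositionToGroup hstab hA₀ hg d • x)) =
      (d : Ω ≃ₐ[F] Ω) (g (algebraMap K Ω x)) := by
  have h := galToGroup_smul Ω H (conjDecomposition hstab hA₀ hg d) x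
  refine (congrArg g h).trans ?_
  exact conjDecomposition_apply hstab hA₀ hg d _

variable {χ : A →+* κbar} {χ₀ : A₀ →+* κbar}
  (hχ₀ : ∀ x : O, χ₀ ⟨algebraMap K Ω x, (hA₀ x).2 x.2⟩ = algebraMap κ κbar (red x))
  (hχ : ∀ x (hx : x ∈ A₀), χ ⟨g x, smul_mem_valuationSubring hg hx⟩ = χ₀ ⟨x, hx⟩)

include hχ₀ hχ hequiv in
lemma algebraMap_decompositionToGroup_smul (d : A.decompositionSubgroup F) (x : O) :
    algebraMap κ κbar (decompositionToGroup hstab hA₀ hg d • red x) =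
      χ (d • (⟨g (algebraMap K Ω x), smul_mem_valuationSubring hg ((hA₀ x).2 x.2)⟩ : A)) := by
  rw [← hequiv, ← hχ₀, ← hχ]
  exact congrArg χ (Subtype.ext (decompositionToGroup_smul hstab hA₀ hg d x))

include hχ₀ hχ hequiv hred in
-- An inertia element acts trivially on the residues of `A`, among which are the residues of `O`,
-- and these fill `κ`.
lemma decompositionToGroup_mem_ker (hχz : ∀ a : A, χ a = 0 ↔ a ∈ IsLocalRing.maximalIdeal A)
    {d : A.decompositionSubgroup F} (hd : d ∈ A.inertiaSubgroup F) :
    decompositionToGroup hstab hA₀ hg d ∈ (MulSemiringAction.toRingAut H κ).ker := by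
  rw [MonoidHom.mem_ker]
  ext z
  obtain ⟨x, rfl⟩ := hred.surjective z
  apply (algebraMap κ κbar).injective
  refine (algebraMap_decompositionToGroup_smul hO hequiv hstab hA₀ hg hχ₀ hχ d x).trans ?_
  rw [(mem_inertiaSubgroup_iff hχz d).1 hd, hχ _ ((hA₀ x).2 x.2), hχ₀]
  rfl

variable (hsN : ∀ d ∈ A.inertiaSubgroup F,
  decompositionToGroup hstab hA₀ hg d ∈ (MulSemiringAction.toRingAut H κ).ker)

/-- The homomorphism from the quotient of the decomposition group by the inertia group. -/
def decompositionToQuot [DiscreteTopology H] :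
    (A.decompositionSubgroup F ⧸ A.inertiaSubgroup F) →ₜ*
      H ⧸ (MulSemiringAction.toRingAut H κ).ker :=
  { QuotientGroup.map _ _ (decompositionToGroup hstab hA₀ hg).toMonoidHom hsN with
    continuous_toFun := continuous_quot_lift _
      ((continuous_of_discreteTopology (f := (QuotientGroup.mk :
        H → H ⧸ (MulSemiringAction.toRingAut H κ).ker))).comp
        (decompositionToGroup hstab hA₀ hg).continuous_toFun) }

lemma decompositionToQuot_mk [DiscreteTopology H] (d : A.decompositionSubgroup F) :
    decompositionToQuot hstab hA₀ hg hsN (d : A.decompositionSubgroup F ⧸ A.inertiaSubgroup F) =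
      decompositionToGroup hstab hA₀ hg d := rfl

/-- The embedding of fixed fields of inertia groups given by conjugation. -/
def conjFixed : FixedPoints.subfield (MulSemiringAction.toRingAut H κ).ker K →+*
    FixedPoints.subfield (A.inertiaSubgroup F) Ω :=
  (((g : Ω ≃+* Ω) : Ω →+* Ω).comp
      ((algebraMap K Ω).comp (Subfield.subtype _))).codRestrict
      (FixedPoints.subfield (A.inertiaSubgroup F) Ω).toSubring fun x i => by
        refine (decompositionToGroup_smul hstab hA₀ hg i x).symm.trans ?_
        exact congrArg (fun z => g (algebraMap K Ω z)) (x.2 ⟨_, hsN i i.2⟩)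

lemma coe_conjFixed (x : FixedPoints.subfield (MulSemiringAction.toRingAut H κ).ker K) :
    (conjFixed hstab hA₀ hg hsN x : Ω) = g (algebraMap K Ω x) := rfl

lemma conjFixed_smul [DiscreteTopology H] (q : A.decompositionSubgroup F ⧸ A.inertiaSubgroup F)
    (x : FixedPoints.subfield (MulSemiringAction.toRingAut H κ).ker K) :
    conjFixed hstab hA₀ hg hsN (decompositionToQuot hstab hA₀ hg hsN q • x) =
      q • conjFixed hstab hA₀ hg hsN x := by
  induction q using QuotientGroup.induction_on with
  | H d => exact Subtype.ext (decompositionToGroup_smul hstab hA₀ hg d x)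

lemma unitsRep_conjDecomposition (d : A.decompositionSubgroup F) (x : Additive Ωˣ) :
    unitsRep (Ω ≃ₐ[F] Ω) Ω g (unitsRep (Ω ≃ₐ[FixedPoints.subfield H K] Ω) Ω
        (conjDecomposition hstab hA₀ hg d) x) =
      unitsRep (A.decompositionSubgroup F) Ω d (unitsRep (Ω ≃ₐ[F] Ω) Ω g x) :=
  Additive.toMul.injective (Units.ext (conjDecomposition_apply hstab hA₀ hg d _))

lemma unitsRep_galIncl_conjDecomposition (hF : F ≤ FixedPoints.subfield H K)
    (d : A.decompositionSubgroup F) (x : Additive Ωˣ) :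
    unitsRep (Ω ≃ₐ[F] Ω) Ω g (unitsRep (Ω ≃ₐ[F] Ω) Ω
        ((galIncl hF).comp (conjDecomposition hstab hA₀ hg) d) x) =
      unitsRep (A.decompositionSubgroup F) Ω d (unitsRep (Ω ≃ₐ[F] Ω) Ω g x) :=
  Additive.toMul.injective (Units.ext (conjDecomposition_apply hstab hA₀ hg d _))

/-- Conjugation by `g` acts trivially on cohomology. Hence the restriction to the decomposition
group of `A` factors through the restriction to `K^H`, where the class is known. -/
lemma map_subtype_eq_map_conjDecomposition (hF : F ≤ FixedPoints.subfield H K) (α : Br F Ω) :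
    H2.map (ρ' := unitsRep (A.decompositionSubgroup F) Ω)
        ⟨(A.decompositionSubgroup F).subtype, continuous_subtype_val⟩
        (AddMonoidHom.id _) (fun _ _ => rfl) α =
      H2.map (conjDecomposition hstab hA₀ hg) (unitsRep (Ω ≃ₐ[F] Ω) Ω g)
        (unitsRep_conjDecomposition hstab hA₀ hg) (brRes hF α) := by
  have h1 := H2.map_conj ((galIncl hF).comp (conjDecomposition hstab hA₀ hg))
    (unitsRep (Ω ≃ₐ[F] Ω) Ω g) (ρ' := unitsRep (A.decompositionSubgroup F) Ω)
    (unitsRep_galIncl_conjDecomposition hstab hA₀ hg hF)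
    ⟨(A.decompositionSubgroup F).subtype, continuous_subtype_val⟩
        (AddMonoidHom.id _) (fun _ _ => rfl) g (fun d => by
          ext x
          exact (conjDecomposition_apply hstab hA₀ hg d x).symm) (fun x => rfl) α
  rw [← h1]
  exact (H2.map_map (galIncl hF) (AddMonoidHom.id _) (fun _ _ => rfl)
    (conjDecomposition hstab hA₀ hg) (unitsRep (Ω ≃ₐ[F] Ω) Ω g)
    (unitsRep_conjDecomposition hstab hA₀ hg)
    ((galIncl hF).comp (conjDecomposition hstab hA₀ hg))
    (unitsRep (Ω ≃ₐ[F] Ω) Ω g) (unitsRep_galIncl_conjDecomposition hstab hA₀ hg hF)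
    (fun _ => rfl) (fun _ => rfl) α).symm

lemma map_conjDecomposition_fixedInflation (z : H2 (unitsRep H K)) :
    H2.map (conjDecomposition hstab hA₀ hg) (unitsRep (Ω ≃ₐ[F] Ω) Ω g)
        (unitsRep_conjDecomposition hstab hA₀ hg) (fixedInflation Ω H z) =
      unitsH2 (decompositionToGroup hstab hA₀ hg)
        (((g : Ω ≃+* Ω) : Ω →+* Ω).comp (algebraMap K Ω))
        (decompositionToGroup_smul hstab hA₀ hg) z :=
  H2.map_map _ _ _ _ _ _ _ _ _ (fun _ => rfl) (fun _ => rfl) z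

lemma inflation_conjH2 [DiscreteTopology H]
    (γ : H2 (unitsRep (H ⧸ (MulSemiringAction.toRingAut H κ).ker)
      (FixedPoints.subfield (MulSemiringAction.toRingAut H κ).ker K))) :
    inflation (A.inertiaSubgroup F) (unitsH2 (decompositionToQuot hstab hA₀ hg hsN)
      (conjFixed hstab hA₀ hg hsN) (conjFixed_smul hstab hA₀ hg hsN) γ) =
      unitsH2 (decompositionToGroup hstab hA₀ hg)
        (((g : Ω ≃+* Ω) : Ω →+* Ω).comp (algebraMap K Ω))
        (decompositionToGroup_smul hstab hA₀ hg) (inflation _ γ) :=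
  inflation_unitsH2 _ _ _ _ _ _ (decompositionToQuot_mk hstab hA₀ hg hsN) _
    (coe_conjFixed hstab hA₀ hg hsN) _ γ

include hv in
-- By `exists_base_valuation_eq` the fixed field of inertia in `Ω` has the same value group as `F`.
-- An element of `F` of prescribed value keeps this value there, and it lies in the image of the
-- smaller fixed field, so the embedding is unramified.
lemma normVal_conjFixed [IsGalois F Ω] (hF : F ≤ FixedPoints.subfield H K)
    (hχz : ∀ a : A, χ a = 0 ↔ a ∈ IsLocalRing.maximalIdeal A)
    (hA : ∀ x : F, algebraMap F Ω x ∈ A ↔ x ∈ O.comap F.subtype)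
    (x : Additive (FixedPoints.subfield (MulSemiringAction.toRingAut H κ).ker K)ˣ) :
    normVal (A.toSubring.comap (FixedPoints.subfield (A.inertiaSubgroup F) Ω).subtype)
      (unitsMap (conjFixed hstab hA₀ hg hsN) x) =
    normVal (O.comap (FixedPoints.subfield (MulSemiringAction.toRingAut H κ).ker K).subtype) x := by
  obtain ⟨w, hw⟩ := hv.exists_restrict (F := F) (O.comap F.subtype) fun x => Iff.rfl
  let i : F →+* FixedPoints.subfield (MulSemiringAction.toRingAut H κ).ker K :=
    F.subtype.codRestrict (FixedPoints.subfield (MulSemiringAction.toRingAut H κ).ker K).toSubring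
      fun y n => hF y.2 n
  have hij : ∀ y, (conjFixed hstab hA₀ hg hsN (i y) : Ω) = algebraMap F Ω y := fun y =>
    g.commutes y
  obtain ⟨u, hu, hui⟩ := hw.exists_extend hA ((conjFixed hstab hA₀ hg hsN).comp i)
    (FixedPoints.subfield (A.inertiaSubgroup F) Ω).subtype hij fun y hy =>
      exists_base_valuation_eq hA (hw.exists_pow_mul_lt_one hA) (y : Ω)
        (fun h => hy (Subtype.ext h)) fun σ hσ hσ' => y.2
          ⟨_, valuation_sub_lt_one_of_mem_inertiaSubgroup hχz hσ hσ'⟩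
  refine hu.normVal_unitsMap _ (fun y => ?_) (fun z => ?_) x
  · rw [Subring.mem_comap, Subring.mem_comap, Subfield.subtype_apply, Subfield.subtype_apply,
      coe_conjFixed, ← hA₀, ← hg]
    exact ValuationSubring.smul_mem_pointwise_smul_iff
  · obtain ⟨t, ht⟩ := hw.1 z
    exact ⟨unitsMap i t, (hui t.toMul).trans ht⟩

include hred hequiv hχ₀ hχ in
-- Elements of the quotient of `H` by the kernel of its action on `κ` are determined by that action,
-- and both sides act on `κ` as `σ` does.
lemma decompositionToQuot_eq_galToQuot [DiscreteTopology H]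
    (θ : (κbar ≃ₐ[FixedPoints.subfield H κ] κbar) →ₜ*
      (A.decompositionSubgroup F ⧸ A.inertiaSubgroup F))
    (hθ : ∀ σ (d : A.decompositionSubgroup F),
      (d : A.decompositionSubgroup F ⧸ A.inertiaSubgroup F) = θ σ → ∀ a : A, χ (d • a) = σ (χ a))
    (σ : κbar ≃ₐ[FixedPoints.subfield H κ] κbar) :
    decompositionToQuot hstab hA₀ hg hsN (θ σ) = galToQuot κbar H σ := by
  obtain ⟨d, hd⟩ := QuotientGroup.mk_surjective (θ σ)
  obtain ⟨h, hh⟩ := QuotientGroup.mk_surjective (galToQuot κbar H σ)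
  rw [← hd, decompositionToQuot_mk, ← hh, QuotientGroup.eq, MonoidHom.mem_ker]
  ext z
  obtain ⟨x, rfl⟩ := hred.surjective z
  change ((decompositionToGroup hstab hA₀ hg d)⁻¹ * h) • red x = red x
  rw [mul_smul, inv_smul_eq_iff]
  apply (algebraMap κ κbar).injective
  rw [algebraMap_decompositionToGroup_smul hO hequiv hstab hA₀ hg hχ₀ hχ, hθ σ d hd,
    hχ _ ((hA₀ x).2 x.2), hχ₀]
  exact galToQuot_eq κbar H σ h hh.symm (red x)

include hv hred hequiv hχ₀ hχ in
lemma map_fixedValH2_conjH2 [DiscreteTopology H] [IsGalois F Ω]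
    (hF : F ≤ FixedPoints.subfield H K)
    (hχz : ∀ a : A, χ a = 0 ↔ a ∈ IsLocalRing.maximalIdeal A)
    (hA : ∀ x : F, algebraMap F Ω x ∈ A ↔ x ∈ O.comap F.subtype)
    (θ : (κbar ≃ₐ[FixedPoints.subfield H κ] κbar) →ₜ*
      (A.decompositionSubgroup F ⧸ A.inertiaSubgroup F))
    (hθ : ∀ σ (d : A.decompositionSubgroup F),
      (d : A.decompositionSubgroup F ⧸ A.inertiaSubgroup F) = θ σ → ∀ a : A, χ (d • a) = σ (χ a))
    (γ : H2 (unitsRep (H ⧸ (MulSemiringAction.toRingAut H κ).ker)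
      (FixedPoints.subfield (MulSemiringAction.toRingAut H κ).ker K))) :
    H2.map (ρ' := trivRep (κbar ≃ₐ[FixedPoints.subfield H κ] κbar) ℤ) θ (AddMonoidHom.id ℤ)
        (fun _ _ => rfl)
        (fixedValH2 (A.inertiaSubgroup F) A.toSubring (decomposition_smul_mem A)
          (unitsH2 (decompositionToQuot hstab hA₀ hg hsN)
            (conjFixed hstab hA₀ hg hsN) (conjFixed_smul hstab hA₀ hg hsN) γ)) =
      H2.map (galToQuot κbar H) (AddMonoidHom.id ℤ) (fun _ _ => rfl)
            (fixedValH2 (MulSemiringAction.toRingAut H κ).ker O hO γ) :=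
  map_valH2_unitsH2 _ _ _ _ _ _ _ (normVal_conjFixed hv hstab hA₀ hg hsN hF hχz hA) _ _
    (decompositionToQuot_eq_galToQuot hred hO hequiv hstab hA₀ hg hχ₀ hχ hsN θ hθ) γ

set_option maxHeartbeats 1000000 in
include hv hred hequiv hχ₀ hχ hstab in
/-- The class computing the residue at a place of the algebraic closure. -/
lemma exists_inflation_eq_and_map_eq [DiscreteTopology H] [IsGalois F Ω]
    (hF : F ≤ FixedPoints.subfield H K)
    (hχz : ∀ a : A, χ a = 0 ↔ a ∈ IsLocalRing.maximalIdeal A)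
    (hA : ∀ x : F, algebraMap F Ω x ∈ A ↔ x ∈ O.comap F.subtype)
    (θ : (κbar ≃ₐ[FixedPoints.subfield H κ] κbar) →ₜ*
      (A.decompositionSubgroup F ⧸ A.inertiaSubgroup F))
    (hθ : ∀ σ (d : A.decompositionSubgroup F),
      (d : A.decompositionSubgroup F ⧸ A.inertiaSubgroup F) = θ σ → ∀ a : A, χ (d • a) = σ (χ a))
    (α : Br F Ω)
    (γ : H2 (unitsRep (H ⧸ (MulSemiringAction.toRingAut H κ).ker)
      (FixedPoints.subfield (MulSemiringAction.toRingAut H κ).ker K)))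
    (hγ : fixedInflation Ω H (inflation _ γ) = brRes hF α) :
    ∃ a : H2 (unitsRep (A.decompositionSubgroup F ⧸ A.inertiaSubgroup F)
      (FixedPoints.subfield (A.inertiaSubgroup F) Ω)), inflation (A.inertiaSubgroup F) a =
      H2.map (ρ' := unitsRep (A.decompositionSubgroup F) Ω)
        ⟨(A.decompositionSubgroup F).subtype, continuous_subtype_val⟩
        (AddMonoidHom.id _) (fun _ _ => rfl) α ∧
      H2.map (ρ' := trivRep (κbar ≃ₐ[FixedPoints.subfield H κ] κbar) ℤ) θ (AddMonoidHom.id ℤ)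
        (fun _ _ => rfl)
        (fixedValH2 (A.inertiaSubgroup F) A.toSubring (decomposition_smul_mem A) a) =
      H2.map (galToQuot κbar H) (AddMonoidHom.id ℤ) (fun _ _ => rfl)
            (fixedValH2 (MulSemiringAction.toRingAut H κ).ker O hO γ) := by
  have hsN : ∀ d ∈ A.inertiaSubgroup F, decompositionToGroup hstab hA₀ hg d ∈
      (MulSemiringAction.toRingAut H κ).ker := fun d hd =>
    decompositionToGroup_mem_ker hred hO hequiv hstab hA₀ hg hχ₀ hχ hχz hd
  -- The image of `γ` is the class sought: its inflation is the conjugated inflation of `γ`, which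
  -- by `hγ` is the restriction of `α`.
  have h1 := inflation_conjH2 hstab hA₀ hg hsN γ
  rw [← map_conjDecomposition_fixedInflation, hγ, ← map_subtype_eq_map_conjDecomposition] at h1
  exact ⟨_, h1, map_fixedValH2_conjH2 hred hv hO hequiv hstab hA₀ hg hχ₀ hχ hsN hF hχz
    hA θ hθ γ⟩

end Conj

end Decomposition

/-- Hilbert 90 holds for continuous cocycles of the inertia group. Injectivity makes the class `a`
in `IsResidue` unique for a given place. -/
lemma inflation_inertia_injective {F : Type*} [Field F] [Algebra F Ω] [IsGalois F Ω]
    (A : ValuationSubring Ω) :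
    Function.Injective (inflation (E := Ω) (A.inertiaSubgroup F)) := by
  refine inflation_injective _ (fun c hc hc' => ?_) fun a =>
    (isLocallyConstant_unitsRep (F := F) a).comp_continuous continuous_subtype_val
  exact exists_of_locallyConstant_cocycle ((A.decompositionSubgroup F).subtype.comp
    (A.inertiaSubgroup F).subtype) (Topology.IsInducing.subtypeVal.comp
      Topology.IsInducing.subtypeVal) c hc hc'

set_option maxHeartbeats 1000000 in
/-- The residue of a class whose restriction to the fixed field of the decomposition group is
inflated from the quotient by the inertia group. -/
theorem isResidue_iff [DiscreteTopology H] [IsAlgClosed κbar]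
    (hred : IsReduction O red) {v : Additive Kˣ →+ ℤ} (hv : IsNormVal O v)
    (hO : ∀ (h : H), ∀ x ∈ O, h • x ∈ O)
    (hequiv : ∀ (h : H) (x : O), red ⟨h • (x : K), hO h x x.2⟩ = h • red x)
    {F : Subfield K} (hF : F ≤ FixedPoints.subfield H K) [Normal F K] [IsGalois F Ω]
    (hstab : ∀ h : K ≃ₐ[F] K, (∀ x ∈ O, h x ∈ O) → ∃ d : H, ∀ x, h x = d • x)
    {φ : O.comap F.subtype →+* FixedPoints.subfield H κ}
    (hφ : ∀ x, (φ x : κ) = red ⟨x.1, x.2⟩) (α : Br F Ω)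
    (γ : H2 (unitsRep (H ⧸ (MulSemiringAction.toRingAut H κ).ker)
      (FixedPoints.subfield (MulSemiringAction.toRingAut H κ).ker K)))
    (hγ : fixedInflation Ω H (inflation _ γ) = brRes hF α)
    (r : H1QZ (κbar ≃ₐ[FixedPoints.subfield H κ] κbar)) :
    IsResidue φ α r ↔ bockstein r = H2.map (galToQuot κbar H) (AddMonoidHom.id ℤ)
      (fun _ _ => rfl) (fixedValH2 (MulSemiringAction.toRingAut H κ).ker O hO γ) := by
  -- A reference place above `O` itself, and not merely above `O ∩ F`; every place occurring in
  -- `IsResidue` is a conjugate of it.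
  obtain ⟨A₀, hA₀, χ₀, hχ₀z, hχ₀⟩ := hred.exists_extension (Ω := Ω) (κbar := κbar)
  have hint := hred.isIntegral_restrict (κbar := κbar) F φ hφ
  have hP₀ : IsPlaceOver ((algebraMap (FixedPoints.subfield H κ) κbar).comp φ) A₀ χ₀ :=
    ⟨fun x => hA₀ x, hχ₀z, fun x => (hχ₀ ⟨x.1, x.2⟩).trans
      (congrArg (algebraMap κ κbar) (hφ x).symm)⟩
  -- The same formula is proved at every place, since `IsResidue` leaves the choice of the place
  -- open. One direction of the equivalence uses the given place, the other the reference place.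
  have key : ∀ P : Place (κbar := κbar) Ω φ, ∃ a : H2 (unitsRep
      (P.A.decompositionSubgroup F ⧸ P.A.inertiaSubgroup F)
      (FixedPoints.subfield (P.A.inertiaSubgroup F) Ω)), inflation (P.A.inertiaSubgroup F) a =
      H2.map (ρ' := unitsRep (P.A.decompositionSubgroup F) Ω)
        ⟨(P.A.decompositionSubgroup F).subtype, continuous_subtype_val⟩
        (AddMonoidHom.id _) (fun _ _ => rfl) α ∧
      H2.map (ρ' := trivRep (κbar ≃ₐ[FixedPoints.subfield H κ] κbar) ℤ) P.θ (AddMonoidHom.id ℤ)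
        (fun _ _ => rfl)
        (fixedValH2 (P.A.inertiaSubgroup F) P.A.toSubring (decomposition_smul_mem P.A) a) =
      H2.map (galToQuot κbar H) (AddMonoidHom.id ℤ) (fun _ _ => rfl)
            (fixedValH2 (MulSemiringAction.toRingAut H κ).ker O hO γ) := fun P => by
    have hP : IsPlaceOver ((algebraMap (FixedPoints.subfield H κ) κbar).comp φ) P.A P.ψ :=
      ⟨P.mem_iff, P.ψ_eq_zero_iff, P.ψ_algebraMap⟩
    obtain ⟨g, hg, hχ⟩ := hP₀.exists_conj hP hint
    replace hχ : ∀ x (hx : x ∈ A₀), P.ψ ⟨g x, smul_mem_valuationSubring hg hx⟩ = χ₀ ⟨x, hx⟩ :=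
      fun x hx => hχ x hx _
    exact exists_inflation_eq_and_map_eq hred hv hO hequiv hstab hA₀ hg hχ₀ hχ hF P.ψ_eq_zero_iff
      P.mem_iff P.θ P.θ_spec α γ hγ
  constructor
  · rintro ⟨P, a, ha, hr⟩
    obtain ⟨a', ha', h⟩ := key P
    rw [hr, ← h, inflation_inertia_injective P.A (ha.trans ha'.symm)]
  · intro hr
    have : Algebra.IsAlgebraic (FixedPoints.subfield H κ) κbar :=
      Algebra.IsAlgebraic.trans (FixedPoints.subfield H κ) κ κbar
    obtain ⟨a, ha, h⟩ := key (hP₀.toPlace hint)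
    exact ⟨_, a, ha, hr.trans h.symm⟩

end ResidueComputation

/-! ### Sections of a sheaf as morphisms from the free sheaf -/

noncomputable section FreeSheaf

open CategoryTheory AlgebraicGeometry Opposite Limits

variable {G : Type u} [Group G]

/-- The free abelian presheaf generated by a `G`-scheme. -/
abbrev freePresheaf (Y : Action Scheme.{u} G) : (Action Scheme.{u} G)ᵒᵖ ⥤ AddCommGrpCat.{u + 1} :=
  ((Functor.whiskeringRight _ _ _).obj AddCommGrpCat.free).obj (uliftYoneda.{u + 1}.obj Y)

/-- The universal section of `ℤ[Y]` over `Y`. -/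
def univSection (Y : Action Scheme.{u} G) : Sec (freeSheaf.obj Y) Y :=
  (toSheafify (equivEtale G) (freePresheaf Y)).app (op Y) (FreeAbelianGroup.of (ULift.up (𝟙 Y)))

/-- The section given by a morphism `ℤ[Y] → F`. -/
def homSection {F : EqSheaf G} {Y : Action Scheme.{u} G} (h : freeSheaf.obj Y ⟶ F) : Sec F Y :=
  Sec.map h (univSection Y)

lemma homSection_comp {F F' : EqSheaf G} {Y : Action Scheme.{u} G} (h : freeSheaf.obj Y ⟶ F)
    (m : F ⟶ F') : homSection (h ≫ m) = Sec.map m (homSection h) := rfl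

lemma homSection_sub {F : EqSheaf G} {Y : Action Scheme.{u} G} (h h' : freeSheaf.obj Y ⟶ F) :
    homSection (h - h') = homSection h - homSection h' := rfl

lemma sec_map_res {F F' : EqSheaf G} (m : F ⟶ F') {Y Y' : Action Scheme.{u} G} (f : Y' ⟶ Y)
    (s : Sec F Y) : Sec.map m (Sec.res f s) = Sec.res f (Sec.map m s) :=
  DFunLike.congr_fun (congrArg AddCommGrpCat.Hom.hom (m.hom.naturality f.op)) s

lemma sec_res_res {F : EqSheaf G} {Y Y' Y'' : Action Scheme.{u} G} (f : Y' ⟶ Y) (f' : Y'' ⟶ Y')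
    (s : Sec F Y) : Sec.res f' (Sec.res f s) = Sec.res (f' ≫ f) s := by
  rw [Sec.res, Sec.res, Sec.res, op_comp, F.obj.map_comp]
  rfl

lemma homSection_freeSheaf_map {Y Y' : Action Scheme.{u} G} (f : Y' ⟶ Y) :
    Sec.map (freeSheaf.map f) (univSection Y') = Sec.res f (univSection Y) := by
  have h1 : toSheafify (equivEtale G) (freePresheaf Y') ≫ (freeSheaf.map f).hom =
      ((Functor.whiskeringRight _ _ _).obj AddCommGrpCat.free).map (uliftYoneda.{u + 1}.map f) ≫
        toSheafify (equivEtale G) (freePresheaf Y) :=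
    toSheafify_naturality _ _ |>.symm
  have h2 := DFunLike.congr_fun (congrArg AddCommGrpCat.Hom.hom (NatTrans.congr_app h1 (op Y')))
    (FreeAbelianGroup.of (ULift.up (𝟙 Y')))
  have h3 := DFunLike.congr_fun (congrArg AddCommGrpCat.Hom.hom
    ((toSheafify (equivEtale G) (freePresheaf Y)).naturality f.op))
    (FreeAbelianGroup.of (ULift.up (𝟙 Y)))
  refine h2.trans (Eq.trans ?_ h3)
  refine congrArg ((toSheafify (equivEtale G) (freePresheaf Y)).app (op Y')) ?_
  change FreeAbelianGroup.map _ (FreeAbelianGroup.of _) =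
    FreeAbelianGroup.map _ (FreeAbelianGroup.of _)
  refine (FreeAbelianGroup.map_of_apply _).trans
    (Eq.trans (congrArg FreeAbelianGroup.of ?_) (FreeAbelianGroup.map_of_apply _).symm)
  refine ULift.down_injective ?_
  exact (Category.id_comp f).trans (Category.comp_id f).symm

lemma homSection_map_comp {F : EqSheaf G} {Y Y' : Action Scheme.{u} G} (f : Y' ⟶ Y)
    (h : freeSheaf.obj Y ⟶ F) : homSection (freeSheaf.map f ≫ h) = Sec.res f (homSection h) := by
  rw [homSection, homSection, ← sec_map_res, ← homSection_freeSheaf_map]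
  rfl

/-- A morphism from a sheafification is determined on the presheaf, a homomorphism from a free group
on its generators, and each generator is a restriction of the universal section. -/
lemma homSection_injective {F : EqSheaf G} {Y : Action Scheme.{u} G} :
    Function.Injective (homSection (F := F) (Y := Y)) := by
  intro h h' e
  have key : ∀ m : freeSheaf.obj Y ⟶ F, ∀ (V : (Action Scheme.{u} G)ᵒᵖ) (f : V.unop ⟶ Y),
      m.hom.app V ((toSheafify (equivEtale G) (freePresheaf Y)).app V
        (FreeAbelianGroup.of (ULift.up f))) = Sec.res f (homSection m) := fun m V f => by
    rw [homSection, ← sec_map_res]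
    have h3 := DFunLike.congr_fun (congrArg AddCommGrpCat.Hom.hom
      ((toSheafify (equivEtale G) (freePresheaf Y)).naturality f.op))
      (FreeAbelianGroup.of (ULift.up (𝟙 Y)))
    refine Eq.trans ?_ (congrArg (Sec.map m) h3)
    have h4 : ((freePresheaf Y).map f.op).hom (FreeAbelianGroup.of (ULift.up (𝟙 Y))) =
        FreeAbelianGroup.of (ULift.up f) :=
      (FreeAbelianGroup.map_of_apply _).trans (congrArg FreeAbelianGroup.of
        (ULift.down_injective (Category.comp_id f)))
    exact congrArg (fun z => m.hom.app V ((toSheafify (equivEtale G) (freePresheaf Y)).app V z))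
      h4.symm
  refine Sheaf.hom_ext (sheafify_hom_ext (equivEtale G) (P := freePresheaf Y) _ _ F.property ?_)
  ext V : 2
  refine AddCommGrpCat.hom_ext (FreeAbelianGroup.lift_ext _ _ fun f => ?_)
  exact (key h V f.down).trans ((congrArg (Sec.res f.down) e).trans (key h' V f.down).symm)

lemma homSection_sectionHom {F : EqSheaf G} {Y : Action Scheme.{u} G} (s : Sec F Y) :
    homSection (sectionHom s) = s := by
  obtain ⟨η, h, hη⟩ : ∃ η : freePresheaf Y ⟶ F.obj, sectionHom s =
      ((sheafificationAdjunction (equivEtale G) AddCommGrpCat.{u + 1}).homEquiv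
        (freePresheaf Y) F).symm η ∧ η.app (op Y) (FreeAbelianGroup.of (ULift.up (𝟙 Y))) = s := by
    refine ⟨_, rfl, (FreeAbelianGroup.lift_apply_of _ _).trans ?_⟩
    change F.obj.map (𝟙 _) s = s
    rw [F.obj.map_id]
    rfl
  have h2 : toSheafify (equivEtale G) (freePresheaf Y) ≫ (sectionHom s).hom = η :=
    (Adjunction.homEquiv_unit _ _ _ _).symm.trans
      ((Equiv.eq_symm_apply _).1 h)
  exact (DFunLike.congr_fun (congrArg AddCommGrpCat.Hom.hom
    (NatTrans.congr_app h2 (op Y))) (FreeAbelianGroup.of (ULift.up (𝟙 Y)))).trans hη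

lemma sectionHom_comp {F F' : EqSheaf G} {Y : Action Scheme.{u} G} (s : Sec F Y) (m : F ⟶ F') :
    sectionHom s ≫ m = sectionHom (Sec.map m s) := by
  apply homSection_injective
  rw [homSection_comp, homSection_sectionHom, homSection_sectionHom]

lemma map_comp_sectionHom {F : EqSheaf G} {Y Y' : Action Scheme.{u} G} (f : Y' ⟶ Y)
    (s : Sec F Y) : freeSheaf.map f ≫ sectionHom s = sectionHom (Sec.res f s) := by
  apply homSection_injective
  rw [homSection_map_comp, homSection_sectionHom, homSection_sectionHom]

lemma sectionHom_sub {F : EqSheaf G} {Y : Action Scheme.{u} G} (s s' : Sec F Y) :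
    sectionHom (s - s') = sectionHom s - sectionHom s' := by
  apply homSection_injective
  rw [homSection_sub, homSection_sectionHom, homSection_sectionHom, homSection_sectionHom]

end FreeSheaf

/-! ### Exactness on sections, and local sections of 𝔾ₘ -/

noncomputable section Exactness

open CategoryTheory AlgebraicGeometry Opposite Limits

variable {G : Type u} [Group G]

lemma sec_map_injective {F F' : EqSheaf G} (i : F ⟶ F') [Mono i] (Y : Action Scheme.{u} G) :
    Function.Injective (Sec.map i (Y := Y)) := by
  have h1 : Mono ((sheafToPresheaf _ _).map i) := inferInstance
  have h2 : Mono (i.hom.app (op Y)) := (NatTrans.mono_iff_mono_app _).1 h1 (op Y)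
  exact (AddCommGrpCat.mono_iff_injective _).1 h2

/-- Taking sections is left exact. -/
lemma exists_sec_map_eq {S : ShortComplex (EqSheaf G)} (hS : S.ShortExact)
    {Y : Action Scheme.{u} G} (x : Sec S.X₂ Y) (hx : Sec.map S.g x = 0) :
    ∃ y : Sec S.X₁ Y, Sec.map S.f y = x := by
  have := hS.mono_f
  let E : EqSheaf G ⥤ AddCommGrpCat.{u + 1} :=
    sheafToPresheaf _ _ ⋙ (evaluation _ _).obj (op Y)
  have hE : (S.map E).Exact := hS.exact.map_of_mono_of_preservesKernel E inferInstance inferInstance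
  exact (ShortComplex.ab_exact_iff _).1 hE x hx

lemma exists_locally_sec_map_eq {F F' : EqSheaf G} (q : F ⟶ F') [Epi q]
    {Y : Action Scheme.{u} G} (x : Sec F' Y) :
    ∃ S ∈ equivEtale G Y, ∀ ⦃Z⦄ (f : Z ⟶ Y), S f → ∃ y : Sec F Z, Sec.map q y = Sec.res f x := by
  have h : Sheaf.IsLocallySurjective q := (Sheaf.isLocallySurjective_iff_epi' _ _).2 inferInstance
  exact ⟨_, Presheaf.imageSieve_mem _ q.hom x, fun Z f hf => hf⟩

/-- `Gm` is a sheafification, so its sections are invariant units only locally. No use is made of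
the presheaf being a sheaf already. -/
lemma exists_locally_gmSection_eq {Y : Action Scheme.{u} G} (x : Sec (Gm G) Y) :
    ∃ S ∈ equivEtale G Y, ∀ ⦃Z⦄ (f : Z ⟶ Y), S f → ∃ y : invUnits Z, gmSection y = Sec.res f x := by
  have : Presheaf.IsLocallySurjective (equivEtale G)
    (toSheafify (equivEtale G) (gmPresheaf (G := G))) := inferInstance
  refine ⟨_, Presheaf.imageSieve_mem _ (toSheafify (equivEtale G) gmPresheaf) x, fun Z f hf => ?_⟩
  obtain ⟨⟨y⟩, hy⟩ := hf
  exact ⟨y.toMul, hy⟩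

lemma gmSection_res {Y Z : Action Scheme.{u} G} (f : Z ⟶ Y) (x : invUnits Y) :
    Sec.res f (gmSection x) = gmSection (invUnitsMap f x) :=
  (DFunLike.congr_fun (congrArg AddCommGrpCat.Hom.hom
    ((toSheafify (equivEtale G) (gmPresheaf (G := G))).naturality f.op)) _).symm

lemma gmSection_mul {Y : Action Scheme.{u} G} (x y : invUnits Y) :
    gmSection (x * y) = gmSection x + gmSection y :=
  map_add ((toSheafify (equivEtale G) (gmPresheaf (G := G))).app (op Y)).hom _ _

lemma exists_locally_eq_of_gmSection_eq {Y : Action Scheme.{u} G} (x y : invUnits Y)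
    (h : gmSection x = gmSection y) :
    ∃ S ∈ equivEtale G Y, ∀ ⦃Z⦄ (f : Z ⟶ Y), S f → invUnitsMap f x = invUnitsMap f y := by
  have : Presheaf.IsLocallyInjective (equivEtale G)
    (toSheafify (equivEtale G) (gmPresheaf (G := G))) := inferInstance
  refine ⟨_, Presheaf.equalizerSieve_mem (equivEtale G)
    (toSheafify (equivEtale G) gmPresheaf) (X := op Y) (ULift.up (Additive.ofMul x))
    (ULift.up (Additive.ofMul y)) h, fun Z f hf => ?_⟩
  exact congrArg (fun z : ULift (Additive (invUnits Z)) => z.down.toMul) hf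

end Exactness

/-! ### Comparison of edge classes in an injective resolution -/

noncomputable section EdgeClasses

open CategoryTheory AlgebraicGeometry Opposite Limits

/-- A morphism to an injective object extends to short exact sequences. -/
lemma exists_hom_of_injective {C : Type*} [Category C] [Abelian C] {S T : ShortComplex C}
    (hS : S.ShortExact) [Injective T.X₂] (a : S.X₁ ⟶ T.X₁) : ∃ f : S ⟶ T, f.τ₁ = a := by
  have := hS.mono_f
  have := hS.epi_g
  let b : S.X₂ ⟶ T.X₂ := Injective.factorThru (a ≫ T.f) S.f
  have hb : S.f ≫ b = a ≫ T.f := Injective.comp_factorThru _ _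
  have hz : S.f ≫ b ≫ T.g = 0 := by rw [reassoc_of% hb, T.zero, comp_zero]
  exact ⟨⟨a, b, hS.exact.desc (b ≫ T.g) hz, hb.symm, (hS.exact.g_desc _ hz).symm⟩, rfl⟩

lemma exists_injective_shortExact {C : Type*} [Category C] [Abelian C] [EnoughInjectives C]
    (X : C) : ∃ (J Q : C) (i : X ⟶ J) (q : J ⟶ Q) (w : i ≫ q = 0),
      (ShortComplex.mk i q w).ShortExact ∧ Injective J :=
  ⟨_, _, Injective.ι X, cokernel.π (Injective.ι X), cokernel.condition _,
    { exact := ShortComplex.exact_cokernel _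
      mono_f := inferInstance
      epi_g := inferInstance }, inferInstance⟩

variable {G : Type u} [Group G]

lemma sec_res_sub {F : EqSheaf G} {Y Y' : Action Scheme.{u} G} (f : Y' ⟶ Y) (s t : Sec F Y) :
    Sec.res f (s - t) = Sec.res f s - Sec.res f t := map_sub (F.obj.map f.op).hom _ _

lemma sec_res_add {F : EqSheaf G} {Y Y' : Action Scheme.{u} G} (f : Y' ⟶ Y) (s t : Sec F Y) :
    Sec.res f (s + t) = Sec.res f s + Sec.res f t := map_add (F.obj.map f.op).hom _ _

lemma sec_map_sub {F F' : EqSheaf G} (m : F ⟶ F') {Y : Action Scheme.{u} G} (s t : Sec F Y) :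
    Sec.map m (s - t) = Sec.map m s - Sec.map m t := map_sub (m.hom.app (op Y)).hom _ _

lemma sec_map_add {F F' : EqSheaf G} (m : F ⟶ F') {Y : Action Scheme.{u} G} (s t : Sec F Y) :
    Sec.map m (s + t) = Sec.map m s + Sec.map m t := map_add (m.hom.app (op Y)).hom _ _

/-- Exact sequences `0 → F → I → Q → 0` and `0 → Q → I' → Q' → 0`. -/
structure TwoStep (F : EqSheaf G) where
  {I Q I' Q' : EqSheaf G}
  {i : F ⟶ I}
  {q : I ⟶ Q}
  {w : i ≫ q = 0}
  hS : (ShortComplex.mk i q w).ShortExact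
  {i' : Q ⟶ I'}
  {q' : I' ⟶ Q'}
  {w' : i' ≫ q' = 0}
  hS' : (ShortComplex.mk i' q' w').ShortExact

namespace TwoStep

variable {F : EqSheaf G} (T : TwoStep F) {Y Y' U U' : Action Scheme.{u} G}

/-- The class in `H²` obtained from a section by two connecting homomorphisms. -/
def cls (s : Sec T.Q' Y) : StackH F 2 Y :=
  ((Abelian.Ext.mk₀ (sectionHom s)).comp T.hS'.extClass (zero_add 1)).comp T.hS.extClass
    (one_add_one_eq_two)

lemma cls_res (g : Y' ⟶ Y) (s : Sec T.Q' Y) :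
    T.cls (Sec.res g s) = StackH.pullback g (T.cls s) := by
  rw [cls, cls, StackH.pullback, ← map_comp_sectionHom, ← Abelian.Ext.mk₀_comp_mk₀,
    Abelian.Ext.comp_assoc _ _ _ (zero_add 0) (zero_add 1) (by rfl),
    Abelian.Ext.comp_assoc _ _ _ (zero_add 1) (one_add_one_eq_two) (by rfl)]

lemma exists_lift_of_cls_eq [Injective T.I] (s s' : Sec T.Q' Y) (h : T.cls s = T.cls s') :
    ∃ t : Sec T.I' Y, Sec.map T.q' t = s - s' := by
  have h1 : (Abelian.Ext.mk₀ (sectionHom (s - s'))).comp T.hS'.extClass (zero_add 1) = 0 := by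
    have h2 : ((Abelian.Ext.mk₀ (sectionHom (s - s'))).comp T.hS'.extClass (zero_add 1)).comp
        T.hS.extClass (one_add_one_eq_two) = 0 := by
      rw [cls, cls, ← sub_eq_zero] at h
      rw [sectionHom_sub, ← h]
      simp [sub_eq_add_neg, Abelian.Ext.mk₀_add, Abelian.Ext.mk₀_neg]
    obtain ⟨x, hx⟩ := Abelian.Ext.covariant_sequence_exact₃ _ T.hS _ one_add_one_eq_two h2
    rw [← hx, Abelian.Ext.eq_zero_of_injective x, Abelian.Ext.zero_comp]
  obtain ⟨x, hx⟩ := Abelian.Ext.covariant_sequence_exact₃ _ T.hS' _ (zero_add 1) h1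
  obtain ⟨m, rfl⟩ := (Abelian.Ext.mk₀_bijective _ _).2 x
  rw [Abelian.Ext.mk₀_comp_mk₀] at hx
  have h2 := (Abelian.Ext.mk₀_bijective _ _).1 hx
  refine ⟨homSection m, ?_⟩
  rw [← homSection_sectionHom (s - s'), ← h2]
  rfl

/-- The relations defining the edge map. -/
structure IsCochain {Γ : Type*} [Group Γ] (p : U ⟶ Y) (R : Γ → (U ⟶ U)) (f : Γ × Γ → Sec F U)
    (e : Γ → Sec T.I U) (e' : Sec T.I' U) (s : Sec T.Q' Y) : Prop where
  map_i : ∀ γ δ, Sec.map T.i (f (γ, δ)) = Sec.res (R γ) (e δ) - e (γ * δ) + e γ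
  map_i' : ∀ γ, Sec.map T.i' (Sec.map T.q (e γ)) = Sec.res (R γ) e' - e'
  res_p : Sec.res p s = Sec.map T.q' e'

variable {T}

lemma IsCochain.pullback {Γ Γ' : Type*} [Group Γ] [Group Γ'] {p : U ⟶ Y} {R : Γ → (U ⟶ U)}
    {f : Γ × Γ → Sec F U} {e : Γ → Sec T.I U} {e' : Sec T.I' U} {s : Sec T.Q' Y}
    (H : T.IsCochain p R f e e' s) (π : Γ' →* Γ) (p' : U' ⟶ Y') (R' : Γ' → (U' ⟶ U'))
    (h : U' ⟶ U) (g : Y' ⟶ Y) (hR : ∀ σ, R' σ ≫ h = h ≫ R (π σ)) (hp : h ≫ p = p' ≫ g) :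
    T.IsCochain p' R' (fun x => Sec.res h (f (π x.1, π x.2))) (fun σ => Sec.res h (e (π σ)))
      (Sec.res h e') (Sec.res g s) where
  map_i γ δ := by
    rw [sec_map_res, H.map_i, sec_res_res, hR, ← sec_res_res, ← map_mul]
    rw [sec_res_add, sec_res_sub]
  map_i' γ := by
    rw [sec_map_res, sec_map_res, H.map_i', sec_res_res, hR, ← sec_res_res]
    exact map_sub (T.I'.obj.map h.op).hom _ _
  res_p := by
    rw [sec_map_res, ← H.res_p, sec_res_res, sec_res_res, hp]

end TwoStep

lemma exists_injective_twoStep (F : EqSheaf G) :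
    ∃ T : TwoStep F, Injective T.I ∧ Injective T.I' := by
  obtain ⟨J, Q, i, q, w, hS, hJ⟩ := exists_injective_shortExact F
  obtain ⟨J', Q', i', q', w', hS', hJ'⟩ := exists_injective_shortExact Q
  exact ⟨⟨hS, hS'⟩, hJ, hJ'⟩

/-- The definition allows arbitrary exact sequences. They map to any sequences with injective middle
terms, and naturality of extension classes keeps `c`. Two edge classes can therefore be studied in
the same resolution. -/
lemma IsEdgeClass.exists_isCochain {Γ : Type*} [Group Γ] {F : EqSheaf G}
    {Y U : Action Scheme.{u} G} {p : U ⟶ Y} {R : Γ → (U ⟶ U)} {f : Γ × Γ → Sec F U}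
    {c : StackH F 2 Y} (h : IsEdgeClass p R f c) (T : TwoStep F) [Injective T.I]
    [Injective T.I'] : ∃ e e' s, T.IsCochain p R f e e' s ∧ T.cls s = c := by
  obtain ⟨I, Q, I', Q', i, q, w, hS, i', q', w', hS', e, e', s, h1, h2, h3, rfl⟩ := h
  have : Injective (ShortComplex.mk T.i T.q T.w).X₂ := ‹Injective T.I›
  have : Injective (ShortComplex.mk T.i' T.q' T.w').X₂ := ‹Injective T.I'›
  obtain ⟨a, ha⟩ := exists_hom_of_injective (T := ShortComplex.mk T.i T.q T.w) hS (𝟙 F)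
  obtain ⟨b, hb⟩ := exists_hom_of_injective (T := ShortComplex.mk T.i' T.q' T.w') hS' a.τ₃
  have ha1 : i ≫ a.τ₂ = T.i := by
    have := a.comm₁₂
    rw [ha] at this
    exact this.symm.trans (Category.id_comp _)
  have ha2 : a.τ₂ ≫ T.q = q ≫ a.τ₃ := a.comm₂₃
  have hb1 : a.τ₃ ≫ T.i' = i' ≫ b.τ₂ := by
    have := b.comm₁₂
    rw [hb] at this
    exact this
  have hb2 : b.τ₂ ≫ T.q' = q' ≫ b.τ₃ := b.comm₂₃
  have hsec : ∀ {A B C : EqSheaf G} (m : A ⟶ B) (m' : B ⟶ C) {Z : Action Scheme.{u} G}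
    (x : Sec A Z), Sec.map m' (Sec.map m x) = Sec.map (m ≫ m') x := fun _ _ _ _ => rfl
  refine ⟨fun γ => Sec.map a.τ₂ (e γ), Sec.map b.τ₂ e', Sec.map b.τ₃ s, ⟨fun γ δ => ?_, fun γ => ?_,
    ?_⟩, ?_⟩
  · refine (congrArg (fun m => Sec.map m (f (γ, δ))) ha1).symm.trans ?_
    rw [← hsec, h1, sec_map_add, sec_map_sub, sec_map_res]
  · rw [hsec, hsec, ← Category.assoc, ha2, Category.assoc, hb1, ← hsec, ← hsec, h2, sec_map_sub,
      sec_map_res]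
  · rw [hsec, hb2, ← hsec, ← h3, sec_map_res]
  · have n1 := ShortComplex.ShortExact.extClass_naturality hS T.hS a
    have n2 := ShortComplex.ShortExact.extClass_naturality hS' T.hS' b
    rw [ha, Abelian.Ext.comp_mk₀_id] at n1
    rw [TwoStep.cls, ← sectionHom_comp, ← Abelian.Ext.mk₀_comp_mk₀,
      Abelian.Ext.comp_assoc _ _ _ (zero_add 0) (zero_add 1) (by rfl), ← n2, n1, hb]
    rw [← Abelian.Ext.comp_assoc _ _ _ (zero_add 1) (add_zero 1) (by rfl),
      Abelian.Ext.comp_assoc _ _ _ (add_zero 1) (zero_add 1) (by rfl)]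

/-- Cocycles with the same image under the edge map become cohomologous after a refinement of the
covering. -/
lemma TwoStep.IsCochain.exists_coboundary {F : EqSheaf G} {T : TwoStep F} [Injective T.I]
    {Γ : Type*} [Group Γ] {Y U V : Action Scheme.{u} G} {p : U ⟶ Y} {R : Γ → (U ⟶ U)}
    {f₁ f₂ : Γ × Γ → Sec F U} {e₁ e₂ : Γ → Sec T.I U} {x₁ x₂ : Sec T.I' V} {s₁ s₂ : Sec T.Q' Y}
    {h : U ⟶ V} {pV : V ⟶ Y} (hV : h ≫ pV = p) (hp : ∀ σ, R σ ≫ p = p)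
    (hR : ∀ σ τ, R (σ * τ) = R σ ≫ R τ)
    (H₁ : T.IsCochain p R f₁ e₁ (Sec.res h x₁) s₁) (H₂ : T.IsCochain p R f₂ e₂ (Sec.res h x₂) s₂)
    (h₁ : Sec.res pV s₁ = Sec.map T.q' x₁) (h₂ : Sec.res pV s₂ = Sec.map T.q' x₂)
    (hs : T.cls s₁ = T.cls s₂) (Φ : ∀ V', (U ⟶ V') → Prop)
    (hΦ : ∀ S ∈ equivEtale G V, ∃ (V' : Action Scheme.{u} G) (g : V' ⟶ V) (h' : U ⟶ V'),
      S g ∧ h' ≫ g = h ∧ Φ V' h') :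
    ∃ (V' : Action Scheme.{u} G) (h' : U ⟶ V') (u : Sec T.I V') (c : Γ → Sec F U), Φ V' h' ∧
      (∀ σ, Sec.map T.i (c σ) = e₁ σ - e₂ σ - (Sec.res (R σ ≫ h') u - Sec.res h' u)) ∧
      ∀ σ τ, f₁ (σ, τ) - f₂ (σ, τ) = Sec.res (R σ) (c τ) - c (σ * τ) + c σ := by
  obtain ⟨t, ht⟩ := T.exists_lift_of_cls_eq s₁ s₂ hs
  -- After correction by `t`, the difference of the two degree-zero cochains comes from `Q`. This
  -- takes place over `V`, and not only over `U`.
  obtain ⟨y, hy⟩ := exists_sec_map_eq T.hS' (x₁ - x₂ - Sec.res pV t) (by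
    change Sec.map T.q' _ = 0
    rw [sec_map_sub, sec_map_sub, ← h₁, ← h₂, sec_map_res, ht, sec_res_sub, sub_self])
  change Sec.map T.i' y = _ at hy
  have : Epi T.q := T.hS.epi_g
  have : Mono T.i := T.hS.mono_f
  have : Mono T.i' := T.hS'.mono_f
  obtain ⟨S, hS, hSy⟩ := exists_locally_sec_map_eq T.q y
  -- A lift of `y` from `Q` to `I` exists only after a covering of `V`; the hypothesis `hΦ` supplies
  -- a factorization of `U → V` through that covering with the property `Φ`, which later serves to
  -- make the resulting cochain continuous.
  obtain ⟨V', g, h', hg, hh', hΦ'⟩ := hΦ S hS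
  obtain ⟨u, hu⟩ := hSy g hg
  -- The difference of the two 1-cochains minus the coboundary of the lift `u` dies in `Q`, so it
  -- comes from `F`.
  have hc : ∀ σ, ∃ c : Sec F U,
      Sec.map T.i c = e₁ σ - e₂ σ - (Sec.res (R σ ≫ h') u - Sec.res h' u) := fun σ => by
    refine exists_sec_map_eq T.hS _ ?_
    change Sec.map T.q _ = 0
    apply sec_map_injective T.i' U
    have e0 : Sec.map T.i' (0 : Sec T.Q U) = 0 := map_zero (T.i'.hom.app (op U)).hom
    rw [e0, sec_map_sub, sec_map_sub, sec_map_sub, sec_map_sub, sec_map_sub, sec_map_sub,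
      H₁.map_i', H₂.map_i']
    simp only [sec_map_res, hu, hy, sec_res_sub, sec_res_res, Category.assoc, hh', hV, hp]
    abel
  choose c hc using hc
  refine ⟨V', h', u, c, hΦ', hc, fun σ τ => sec_map_injective T.i U ?_⟩
  rw [sec_map_sub, H₁.map_i, H₂.map_i, sec_map_add, sec_map_sub, sec_map_res, hc, hc, hc]
  simp only [sec_res_sub, sec_res_res, hR, Category.assoc]
  abel

end EdgeClasses

/-! ### Lifting field-valued points along coverings -/

noncomputable section FieldPoints

open CategoryTheory AlgebraicGeometry Opposite Limits

/-- The morphism of spectra given by a ring homomorphism. -/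
abbrev specMap {A B : Type u} [CommRing A] [CommRing B] (f : A →+* B) :
    Spec (.of B) ⟶ Spec (.of A) := Spec.map (CommRingCat.ofHom f)

lemma specMap_comp {A B C : Type u} [CommRing A] [CommRing B] [CommRing C] (f : A →+* B)
    (g : B →+* C) : specMap (g.comp f) = specMap g ≫ specMap f := by
  rw [specMap, CommRingCat.ofHom_comp, Spec.map_comp]

/-- Points with values in a field lift along morphisms of finite type after a finite extension. -/
lemma exists_lift_point {V Y : Scheme.{u}} (f : V ⟶ Y) [LocallyOfFiniteType f] {W : Type u}
    [Field W] (y : Spec (.of W) ⟶ Y) (v : V) (x : Spec (.of W)) (hv : f v = y x) :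
    ∃ (W' : Type u) (_ : Field W') (φ : W →+* W') (z : Spec (.of W') ⟶ V),
      φ.Finite ∧ z ≫ f = specMap φ ≫ y := by
  obtain ⟨p, -, -⟩ := Scheme.Pullback.exists_preimage_pullback v x hv
  obtain ⟨R, j, hj, q, rfl⟩ : ∃ (R : CommRingCat.{u}) (j : Spec R ⟶ pullback f y),
      IsOpenImmersion j ∧ ∃ q, j q = p := by
    obtain ⟨q, hq⟩ := (pullback f y).affineCover.covers p
    exact ⟨_, (pullback f y).affineCover.f _, (pullback f y).affineCover.map_prop _, q, hq⟩
  obtain ⟨φ, hφ⟩ := Spec.map_surjective (j ≫ pullback.snd f y)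
  have hft : LocallyOfFiniteType (Spec.map φ) := by
    rw [hφ]
    infer_instance
  have hft' : φ.hom.FiniteType := (HasRingHomProperty.Spec_iff (P := @LocallyOfFiniteType)).1 hft
  have : Nontrivial R := by
    by_contra h
    rw [not_nontrivial_iff_subsingleton] at h
    exact (PrimeSpectrum.isEmpty_iff_subsingleton.2 h).false q
  -- The fibre over the given point is nonempty and of finite type over the field `W`. By Zariski's
  -- lemma a closed point of an affine piece is defined over a finite extension.
  obtain ⟨m, hm⟩ := Ideal.exists_maximal R
  let _ : Field (R ⧸ m) := Ideal.Quotient.field m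
  let ψ : W →+* R ⧸ m := (Ideal.Quotient.mk m).comp φ.hom
  have hψ : ψ.FiniteType := (RingHom.FiniteType.of_surjective _ Ideal.Quotient.mk_surjective).comp hft'
  refine ⟨R ⧸ m, inferInstance, ψ, specMap (Ideal.Quotient.mk m) ≫ j ≫ pullback.fst f y, ?_, ?_⟩
  · algebraize [ψ]
    exact finite_of_finite_type_of_isJacobsonRing W (R ⧸ m)
  · rw [Category.assoc, Category.assoc, pullback.condition, ← Category.assoc j, ← hφ,
      ← Category.assoc]
    congr 1
    exact (specMap_comp φ.hom (Ideal.Quotient.mk m)).symm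

section Induced

variable {G : Type u} [Group G]

variable (G) in
/-- The `G`-scheme `G × T` induced from a scheme `T`. -/
def ind (T : Scheme.{u}) : Action Scheme.{u} G := prodGroup (Action.trivial G T)

/-- The inclusion of the component with index `t`. -/
def indInc (T : Scheme.{u}) (t : G) : T ⟶ (ind G T).V := sigmaι (Action.trivial G T) t

variable (G) in
/-- The inclusion of the component with index `1`. -/
abbrev indι (T : Scheme.{u}) : T ⟶ (ind G T).V := indInc T 1

lemma indInc_act (T : Scheme.{u}) (t g : G) :
    indInc T t ≫ act (ind G T) g = indInc T (g * t) :=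
  (ι_sigmaAct (Action.trivial G T) g t).trans (Category.id_comp _)

lemma ind_scheme_hom_ext {T Z : Scheme.{u}} {f f' : (ind G T).V ⟶ Z}
    (h : ∀ t, indInc T t ≫ f = indInc T t ≫ f') : f = f' :=
  Sigma.hom_ext _ _ h

/-- The morphism given by its components. -/
def indDesc {T Z : Scheme.{u}} (f : G → (T ⟶ Z)) : (ind G T).V ⟶ Z := Sigma.desc f

lemma indInc_indDesc {T Z : Scheme.{u}} (f : G → (T ⟶ Z)) (t : G) :
    indInc T t ≫ indDesc f = f t := Sigma.ι_desc _ _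

lemma act_comm {Y Z : Action Scheme.{u} G} (f : Y ⟶ Z) (g : G) :
    act Y g ≫ f.hom = f.hom ≫ act Z g := f.comm g

/-- `G` permutes the components of the induced scheme transitively, so an equivariant morphism is
determined on the component of 1. -/
lemma ind_hom_ext {T : Scheme.{u}} {Z : Action Scheme.{u} G} {f f' : ind G T ⟶ Z}
    (h : indι G T ≫ f.hom = indι G T ≫ f'.hom) : f = f' := by
  refine Action.Hom.ext (ind_scheme_hom_ext fun t => ?_)
  rw [← mul_one t, ← indInc_act, Category.assoc, Category.assoc, act_comm, act_comm,
    ← Category.assoc, h, Category.assoc]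

/-- The equivariant morphism given by a morphism of schemes. -/
def indHom {T : Scheme.{u}} {Z : Action Scheme.{u} G} (y : T ⟶ Z.V) : ind G T ⟶ Z where
  hom := indDesc fun t => y ≫ act Z t
  comm g := by
    refine ind_scheme_hom_ext fun t => ?_
    change indInc T t ≫ act (ind G T) g ≫ _ = indInc T t ≫ _ ≫ act Z g
    rw [← Category.assoc, indInc_act, indInc_indDesc, ← Category.assoc, indInc_indDesc, act_mul,
      Category.assoc]

lemma indι_indHom {T : Scheme.{u}} {Z : Action Scheme.{u} G} (y : T ⟶ Z.V) :
    indι G T ≫ (indHom y).hom = y := by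
  refine (indInc_indDesc _ _).trans ?_
  rw [act_one, Category.comp_id]

lemma indInc_indHom {T : Scheme.{u}} {Z : Action Scheme.{u} G} (y : T ⟶ Z.V) (t : G) :
    indInc T t ≫ (indHom y).hom = y ≫ act Z t := indInc_indDesc _ _

lemma indHom_comp {T : Scheme.{u}} {Z Z' : Action Scheme.{u} G} (y : T ⟶ Z.V) (f : Z ⟶ Z') :
    indHom y ≫ f = indHom (y ≫ f.hom) := by
  apply ind_hom_ext
  rw [indι_indHom, Action.comp_hom, ← Category.assoc, indι_indHom]

/-- The morphism of induced schemes given by a morphism of schemes. -/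
abbrev indMap {T T' : Scheme.{u}} (f : T ⟶ T') : ind G T ⟶ ind G T' := indHom (f ≫ indι G T')

lemma indMap_indHom {T T' : Scheme.{u}} (f : T ⟶ T') {Z : Action Scheme.{u} G} (y : T' ⟶ Z.V) :
    indMap f ≫ indHom y = indHom (f ≫ y) := by
  rw [indHom_comp, Category.assoc, indι_indHom]

end Induced

/-- The sieves containing a lift of every point with values in a field after a finite extension. -/
def LiftsFieldPoints {G : Type u} [Group G] (Y : Action Scheme.{u} G) (S : Sieve Y) : Prop :=
  ∀ (W : Type u) [Field W] (y : Spec (.of W) ⟶ Y.V), ∃ (W' : Type u) (_ : Field W')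
    (φ : W →+* W') (Z : Action Scheme.{u} G) (f : Z ⟶ Y) (z : Spec (.of W') ⟶ Z.V),
    φ.Finite ∧ S f ∧ z ≫ f.hom = specMap φ ≫ y

/-- The property holds for étale coverings and is inherited under the operations generating the
topology, because finite extensions compose. -/
lemma liftsFieldPoints_of_mem {G : Type u} [Group G] {Y : Action Scheme.{u} G} {S : Sieve Y}
    (hS : S ∈ equivEtale G Y) : LiftsFieldPoints Y S := by
  change Precoverage.Saturate _ _ _ at hS
  induction hS with
  | of Y S hS =>
    intro W _ y
    obtain ⟨x⟩ : Nonempty (Spec (.of W)) := inferInstance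
    obtain ⟨h1, h2⟩ := hS
    obtain ⟨Z₀, g₀, hg, v, hv⟩ := h1 (y x)
    obtain ⟨hg⟩ := hg
    obtain ⟨hg'⟩ := hg
    rename_i Z₂ g
    have hE : Etale g.hom := h2 (Presieve.map.of hg')
    obtain ⟨W', _, φ, z, hφ, hz⟩ := exists_lift_point g.hom y v x hv
    exact ⟨W', inferInstance, φ, Z₂, g, z, hφ, Sieve.le_generate _ _ _ hg', hz⟩
  | top Y =>
    intro W _ y
    refine ⟨W, inferInstance, RingHom.id W, Y, 𝟙 Y, y, RingHom.Finite.id W, trivial, ?_⟩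
    have : specMap (RingHom.id W) = 𝟙 _ := Spec.map_id _
    rw [this, Category.id_comp]
    exact Category.comp_id _
  | pullback Y S _ Y' f ih =>
    intro W _ y
    obtain ⟨W', _, φ, Z, g, z, hφ, hg, hz⟩ := ih W (y ≫ f.hom)
    -- A member of the pulled-back sieve must be a `G`-scheme over `Y'`. The one induced from the
    -- point itself will do: its morphism to `Y` factors through the member found there.
    refine ⟨W', inferInstance, φ, ind G (Spec (.of W')), indHom (specMap φ ≫ y), indι G _, hφ, ?_,
      indι_indHom _⟩
    have h : indHom (specMap φ ≫ y) ≫ f = indHom z ≫ g := by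
      rw [indHom_comp, indHom_comp, hz, Category.assoc]
    change S _
    rw [h]
    exact S.downward_closed hg _
  | transitive Y S R _ _ ih ih' =>
    intro W _ y
    obtain ⟨W', _, φ, Z, f, z, hφ, hf, hz⟩ := ih W y
    obtain ⟨W'', _, φ', Z', f', z', hφ', hf', hz'⟩ := ih' hf W' z
    refine ⟨W'', inferInstance, φ'.comp φ, Z', f' ≫ f, z', hφ'.comp hφ, hf', ?_⟩
    rw [Action.comp_hom, ← Category.assoc, hz', Category.assoc, hz, specMap_comp, Category.assoc]

end FieldPoints

/-! ### Sections of 𝔾ₘ at an induced geometric point, and Galois cocycles -/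

noncomputable section GenericPoint

open CategoryTheory AlgebraicGeometry Opposite Limits

variable {G : Type u} [Group G]

/-- The value of an invariant invertible function at a point with values in a field. -/
def evAt {Z : Action Scheme.{u} G} {W : Type u} [Field W] (y : Spec (.of W) ⟶ Z.V) :
    invUnits Z →* Wˣ :=
  (Units.map ((y.appTop ≫ (Scheme.ΓSpecIso (.of W)).hom).hom : Γ(Z.V, ⊤) →* W)).comp
    (invUnits Z).subtype

lemma coe_evAt {Z : Action Scheme.{u} G} {W : Type u} [Field W] (y : Spec (.of W) ⟶ Z.V)
    (x : invUnits Z) : (evAt y x : W) =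
      (Scheme.ΓSpecIso (.of W)).hom.hom (y.appTop.hom ((x : Γ(Z.V, ⊤)ˣ) : Γ(Z.V, ⊤))) := rfl

lemma evAt_comp_hom {Z Z' : Action Scheme.{u} G} {W : Type u} [Field W]
    (y : Spec (.of W) ⟶ Z'.V) (f : Z' ⟶ Z) (x : invUnits Z) :
    evAt (y ≫ f.hom) x = evAt y (invUnitsMap f x) := by
  refine Units.ext ?_
  rw [coe_evAt, coe_evAt, Scheme.Hom.comp_appTop]
  rfl

lemma evAt_comp_act {Z : Action Scheme.{u} G} {W : Type u} [Field W]
    (y : Spec (.of W) ⟶ Z.V) (g : G) (x : invUnits Z) :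
    evAt (y ≫ act Z g) x = evAt y x := by
  refine Units.ext ?_
  rw [coe_evAt, coe_evAt, Scheme.Hom.comp_appTop]
  exact congrArg (fun u : Γ(Z.V, ⊤)ˣ =>
    (Scheme.ΓSpecIso (.of W)).hom.hom (y.appTop.hom (u : Γ(Z.V, ⊤)))) (x.2 g)

lemma evAt_specMap_comp {Z : Action Scheme.{u} G} {W W' : Type u} [Field W] [Field W']
    (φ : W →+* W') (y : Spec (.of W) ⟶ Z.V) (x : invUnits Z) :
    evAt (specMap φ ≫ y) x = Units.map (φ : W →* W') (evAt y x) := by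
  refine Units.ext ?_
  rw [coe_evAt, Scheme.Hom.comp_appTop]
  exact RingHom.congr_fun (congrArg CommRingCat.Hom.hom
    (Scheme.ΓSpecIso_naturality (CommRingCat.ofHom φ))) _

/-- The two functions agree on a covering, the point lifts to it over an extension of `W`, and
values may be compared there since field homomorphisms are injective. -/
lemma evAt_eq_of_gmSection_eq {Z : Action Scheme.{u} G} {W : Type u} [Field W]
    (y : Spec (.of W) ⟶ Z.V) (x x' : invUnits Z) (h : gmSection x = gmSection x') :
    evAt y x = evAt y x' := by
  obtain ⟨S, hS, hS'⟩ := exists_locally_eq_of_gmSection_eq x x' h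
  obtain ⟨W', _, φ, Z', f, z, -, hf, hz⟩ := liftsFieldPoints_of_mem hS W y
  have h1 : ∀ x, Units.map (φ : W →* W') (evAt y x) = evAt z (invUnitsMap f x) := fun x => by
    rw [← evAt_specMap_comp, ← hz, evAt_comp_hom]
  have h2 : Units.map (φ : W →* W') (evAt y x) = Units.map (φ : W →* W') (evAt y x') := by
    rw [h1, h1, hS' f hf]
  exact Units.ext (φ.injective (congrArg Units.val h2))

section Geometric

variable {Ω : Type u} [Field Ω] [IsAlgClosed Ω]

/-- A finite extension of an algebraically closed field is trivial, so the lift needs no extension.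
-/
lemma exists_lift_geometricPoint {Z : Action Scheme.{u} G} {S : Sieve Z}
    (hS : S ∈ equivEtale G Z) (y : Spec (.of Ω) ⟶ Z.V) :
    ∃ (Z' : Action Scheme.{u} G) (f : Z' ⟶ Z) (z : Spec (.of Ω) ⟶ Z'.V), S f ∧ z ≫ f.hom = y := by
  obtain ⟨W', _, φ, Z', f, z, hφ, hf, hz⟩ := liftsFieldPoints_of_mem hS Ω y
  have hb : Function.Bijective φ := by
    algebraize [φ]
    exact IsAlgClosed.algebraMap_bijective_of_isIntegral (k := Ω) (K := W')
  let ψ : W' →+* Ω := (RingEquiv.ofBijective φ hb).symm.toRingHom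
  have hψ : ψ.comp φ = RingHom.id Ω := RingHom.ext (RingEquiv.ofBijective φ hb).symm_apply_apply
  refine ⟨Z', f, specMap ψ ≫ z, hf, ?_⟩
  rw [Category.assoc, hz, ← Category.assoc, ← specMap_comp, hψ]
  exact (congrArg (· ≫ y) (Spec.map_id _)).trans (Category.id_comp y)

variable (Ω) in
/-- The `G`-scheme induced from a geometric point. -/
abbrev indPt (G Ω : Type u) [Group G] [Field Ω] : Action Scheme.{u} G := ind G (Spec (.of Ω))

/-- Coverings of the induced geometric point have sections, hence sheafification adds nothing there.
-/
lemma exists_gmSection_eq (s : Sec (Gm G) (indPt G Ω)) :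
    ∃ x : invUnits (indPt G Ω), gmSection x = s := by
  obtain ⟨S, hS, hS'⟩ := exists_locally_gmSection_eq s
  obtain ⟨Z', f, z, hf, hz⟩ := exists_lift_geometricPoint hS (indι G (Spec (.of Ω)))
  obtain ⟨x, hx⟩ := hS' f hf
  refine ⟨invUnitsMap (indHom z) x, ?_⟩
  have h : indHom z ≫ f = 𝟙 _ := by
    apply ind_hom_ext
    rw [indHom_comp, indι_indHom, hz]
    exact (Category.comp_id _).symm
  rw [← gmSection_res, hx, sec_res_res, h]
  exact congrArg (fun m => m.hom s) ((Gm G).obj.map_id _)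

/-- The value of a section of `𝔾ₘ` at a geometric point. -/
def secEv (s : Sec (Gm G) (indPt G Ω)) : Additive Ωˣ :=
  Additive.ofMul (evAt (indι G _) (exists_gmSection_eq s).choose)

lemma secEv_gmSection (x : invUnits (indPt G Ω)) :
    secEv (gmSection x) = Additive.ofMul (evAt (indι G _) x) :=
  congrArg Additive.ofMul
    (evAt_eq_of_gmSection_eq _ _ _ (exists_gmSection_eq (gmSection x)).choose_spec)

lemma secEv_add (s t : Sec (Gm G) (indPt G Ω)) : secEv (s + t) = secEv s + secEv t := by
  obtain ⟨x, rfl⟩ := exists_gmSection_eq s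
  obtain ⟨y, rfl⟩ := exists_gmSection_eq t
  rw [← gmSection_mul, secEv_gmSection, secEv_gmSection, secEv_gmSection, map_mul, ofMul_mul]

lemma secEv_sub (s t : Sec (Gm G) (indPt G Ω)) : secEv (s - t) = secEv s - secEv t := by
  rw [eq_sub_iff_add_eq, ← secEv_add, sub_add_cancel]

end Geometric

section Galois

variable {F Ω : Type u} [Field F] [Field Ω] [Algebra F Ω] 

/-- The right action of the Galois group on the induced geometric point, given by a homomorphism
to `G`. -/
def galRight (π : (Ω ≃ₐ[F] Ω) →* G) (σ : Ω ≃ₐ[F] Ω) : indPt G Ω ⟶ indPt G Ω :=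
  indHom (specMap (σ : Ω →+* Ω) ≫ indInc _ (π σ))

lemma specMap_mul (σ τ : Ω ≃ₐ[F] Ω) :
    specMap ((σ * τ : Ω ≃ₐ[F] Ω) : Ω →+* Ω) = specMap (σ : Ω →+* Ω) ≫ specMap (τ : Ω →+* Ω) := by
  rw [← specMap_comp]
  rfl

lemma galRight_indHom (π : (Ω ≃ₐ[F] Ω) →* G) (σ : Ω ≃ₐ[F] Ω) {Z : Action Scheme.{u} G}
    (y : Spec (.of Ω) ⟶ Z.V) :
    galRight π σ ≫ indHom y = indHom (specMap (σ : Ω →+* Ω) ≫ y ≫ act Z (π σ)) := by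
  rw [galRight, indHom_comp, Category.assoc, indInc_indHom]

lemma galRight_mul (π : (Ω ≃ₐ[F] Ω) →* G) (σ τ : Ω ≃ₐ[F] Ω) :
    galRight π (σ * τ) = galRight π σ ≫ galRight π τ := by
  rw [galRight.eq_1 π τ, galRight_indHom, Category.assoc, indInc_act, galRight, map_mul,
    specMap_mul, Category.assoc]

/-- The translation by `π σ` is invisible to a `G`-invariant function; only the action of `σ` on its
value remains. So sections over the induced point form the Galois module Ωˣ. -/
lemma secEv_res_galRight [IsAlgClosed Ω] (π : (Ω ≃ₐ[F] Ω) →* G) (σ : Ω ≃ₐ[F] Ω)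
    (s : Sec (Gm G) (indPt G Ω)) :
    secEv (Sec.res (galRight π σ) s) = unitsRep (Ω ≃ₐ[F] Ω) Ω σ (secEv s) := by
  obtain ⟨x, rfl⟩ := exists_gmSection_eq s
  rw [gmSection_res, secEv_gmSection, secEv_gmSection, ← evAt_comp_hom, galRight, indι_indHom,
    evAt_specMap_comp]
  have h : indInc (Spec (.of Ω)) (π σ) = indι G _ ≫ act (indPt G Ω) (π σ) := by
    rw [indInc_act, mul_one]
  rw [h, evAt_comp_act]
  rfl

lemma isLocallyConstant_comp_ringHom {M : Type u} [Field M] (j : M →+* Ω)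
    (L : IntermediateField F Ω) [FiniteDimensional F L] (hL : ∀ x, j x ∈ L) :
    IsLocallyConstant fun σ : Ω ≃ₐ[F] Ω => (σ : Ω →+* Ω).comp j := by
  rw [IsLocallyConstant.iff_exists_open]
  intro σ
  refine ⟨(fun τ => σ⁻¹ * τ) ⁻¹' (L.fixingSubgroup : Set (Ω ≃ₐ[F] Ω)),
    L.fixingSubgroup_isOpen.preimage (continuous_const_mul _), by simp [one_mem], ?_⟩
  intro τ hτ
  refine RingHom.ext fun x => ?_
  have h := (IntermediateField.mem_fixingSubgroup_iff _ _).1 hτ (j x) (hL x)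
  have h' : σ.symm (τ (j x)) = j x := h
  exact (AlgEquiv.symm_apply_eq σ).1 h'

lemma exists_comp_eq_of_finite {M M' Ω : Type*} [Field M] [Field M'] [Field Ω] [IsAlgClosed Ω]
    (i : M →+* Ω) (φ : M →+* M') (hφ : φ.Finite) : ∃ j : M' →+* Ω, j.comp φ = i := by
  algebraize [φ, i]
  exact ⟨_, (IsAlgClosed.lift (R := M) (S := M') (M := Ω)).comp_algebraMap⟩

lemma exists_lift_of_finite [IsAlgClosed Ω] (M : IntermediateField F Ω) [FiniteDimensional F M]
    {M' : Type u} [Field M'] (φ : M →+* M') (hφ : φ.Finite) :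
    ∃ j : M' →+* Ω, j.comp φ = algebraMap M Ω ∧
      ∃ (L : IntermediateField F Ω) (_ : FiniteDimensional F L), ∀ x, j x ∈ L := by
  algebraize [φ, φ.comp (algebraMap F M)]
  have : FiniteDimensional F M' := FiniteDimensional.trans F M M'
  obtain ⟨j, hj⟩ := exists_comp_eq_of_finite (algebraMap M Ω) φ hφ
  let j' : M' →ₐ[F] Ω := { j with commutes' := fun r => RingHom.congr_fun hj (algebraMap F M r) }
  exact ⟨j, hj, j'.fieldRange, LinearEquiv.finiteDimensional
    (AlgEquiv.ofInjectiveField j').toLinearEquiv, fun x => ⟨x, rfl⟩⟩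

variable [TopologicalSpace G]

/-- A covering of the scheme induced from a finite level is dominated by a further finite level. The
translates of the geometric point on it depend only on `π σ` and on the restriction of `σ` to a
finite extension, which is the source of continuity. -/
lemma exists_refinement [DiscreteTopology G] [IsAlgClosed Ω] (π : (Ω ≃ₐ[F] Ω) →ₜ* G) (M : IntermediateField F Ω)
    [FiniteDimensional F M] (S : Sieve (ind G (Spec (.of M))))
    (hS : S ∈ equivEtale G (ind G (Spec (.of M)))) :
    ∃ (V' : Action Scheme.{u} G) (g : V' ⟶ ind G (Spec (.of M))) (h' : indPt G Ω ⟶ V'),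
      S g ∧ h' ≫ g = indMap (specMap (algebraMap M Ω)) ∧
        IsLocallyConstant fun σ => galRight π.toMonoidHom σ ≫ h' := by
  obtain ⟨M', _, φ, Z, f, z, hφ, hf, hz⟩ := liftsFieldPoints_of_mem hS M (indι G _)
  obtain ⟨j, hj, L, _, hL⟩ := exists_lift_of_finite M φ hφ
  refine ⟨ind G (Spec (.of M')), indHom z ≫ f, indMap (specMap j),
    S.downward_closed hf _, ?_, ?_⟩
  · rw [indHom_comp z, indMap_indHom, hz, ← Category.assoc, ← specMap_comp, hj]
  · have h1 := isLocallyConstant_comp_ringHom j L hL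
    have h2 : IsLocallyConstant fun σ : Ω ≃ₐ[F] Ω => ((σ : Ω →+* Ω).comp j, π σ) :=
      h1.prodMk (IsLocallyConstant.iff_continuous _ |>.2 π.continuous_toFun)
    convert h2.comp fun x : (M' →+* Ω) × G =>
      (indHom (specMap x.1 ≫ indInc _ x.2) : indPt G Ω ⟶ ind G (Spec (.of M'))) using 1
    funext σ
    rw [indMap, galRight_indHom]
    simp only [Category.assoc, Function.comp_apply]
    rw [indInc_act, mul_one, specMap_comp, Category.assoc]
    rfl

/-- The cochains on the induced geometric point defined by an edge class. -/
lemma IsEdgeClass.exists_isCochain_indPt (π : (Ω ≃ₐ[F] Ω) →ₜ* G) (M : IntermediateField F Ω)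
    {A : EqSheaf G} (T : TwoStep A) [Injective T.I] [Injective T.I']
    {Y Y₁ U₁ : Action Scheme.{u} G} (y : Spec (.of M) ⟶ Y.V)
    {Γ₁ : Type*} [Group Γ₁] [TopologicalSpace Γ₁] [DiscreteTopology Γ₁]
    (π₁ : (Ω ≃ₐ[F] Ω) →ₜ* Γ₁) {p₁ : U₁ ⟶ Y₁} {R₁ : Γ₁ → (U₁ ⟶ U₁)}
    {f : Γ₁ × Γ₁ → Sec A U₁} {c₁ : StackH A 2 Y₁}
    (hE : IsEdgeClass p₁ R₁ f c₁) (g : Y ⟶ Y₁)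
    (y₁ : Spec (.of M) ⟶ U₁.V) (hy₁ : y₁ ≫ p₁.hom = y ≫ g.hom)
    (hR : ∀ σ : Ω ≃ₐ[F] Ω, specMap (σ : Ω →+* Ω) ≫ (specMap (algebraMap M Ω) ≫ y₁) ≫ act U₁ (π σ) =
      (specMap (algebraMap M Ω) ≫ y₁) ≫ (R₁ (π₁ σ)).hom) :
    ∃ (e : (Ω ≃ₐ[F] Ω) → Sec T.I (indPt G Ω)) (x : Sec T.I' (ind G (Spec (.of M))))
      (s : Sec T.Q' Y),
      T.IsCochain (indHom (specMap (algebraMap M Ω) ≫ y)) (galRight π.toMonoidHom)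
        (fun z => Sec.res (indHom (specMap (algebraMap M Ω) ≫ y₁)) (f (π₁ z.1, π₁ z.2))) e
        (Sec.res (indMap (specMap (algebraMap M Ω))) x) s ∧
      Sec.res (indHom y) s = Sec.map T.q' x ∧ T.cls s = StackH.pullback g c₁ ∧
      IsLocallyConstant e := by
  obtain ⟨e, e', s, H, rfl⟩ := hE.exists_isCochain T
  refine ⟨fun σ => Sec.res (indHom (specMap (algebraMap M Ω) ≫ y₁)) (e (π₁ σ)),
    Sec.res (indHom y₁) e', Sec.res g s, ?_, ?_, T.cls_res g s, ?_⟩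
  · rw [sec_res_res, indMap_indHom]
    refine H.pullback π₁.toMonoidHom _ _ _ g (fun σ => ?_) ?_
    · rw [galRight_indHom, indHom_comp]
      exact congrArg indHom (hR σ)
    · rw [indHom_comp, indHom_comp, Category.assoc, Category.assoc, hy₁]
  · rw [sec_res_res, indHom_comp, ← hy₁, ← indHom_comp, ← sec_res_res, H.res_p, sec_map_res]
  · exact (IsLocallyConstant.iff_continuous _ |>.2 π₁.continuous_toFun).comp
      fun t => Sec.res (indHom (specMap (algebraMap M Ω) ≫ y₁)) (e t)

/-- Two cocycles with the same image under the edge maps define the same Galois cohomology class. -/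
lemma exists_coboundary_of_isEdgeClass [DiscreteTopology G] [IsAlgClosed Ω] (π : (Ω ≃ₐ[F] Ω) →ₜ* G) (M : IntermediateField F Ω)
    [FiniteDimensional F M]
    {Y Y₁ U₁ Y₂ U₂ : Action Scheme.{u} G} (y : Spec (.of M) ⟶ Y.V)
    (hy : ∀ σ : Ω ≃ₐ[F] Ω, specMap (σ : Ω →+* Ω) ≫ (specMap (algebraMap M Ω) ≫ y) ≫ act Y (π σ) =
      specMap (algebraMap M Ω) ≫ y)
    {Γ₁ : Type*} [Group Γ₁] [TopologicalSpace Γ₁] [DiscreteTopology Γ₁]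
    (π₁ : (Ω ≃ₐ[F] Ω) →ₜ* Γ₁) {p₁ : U₁ ⟶ Y₁} {R₁ : Γ₁ → (U₁ ⟶ U₁)}
    {f₁ : Γ₁ × Γ₁ → invUnits U₁} {c₁ : StackBr Y₁}
    (hE₁ : IsEdgeClass p₁ R₁ (fun x => gmSection (f₁ x)) c₁) (g₁ : Y ⟶ Y₁)
    (y₁ : Spec (.of M) ⟶ U₁.V) (hy₁ : y₁ ≫ p₁.hom = y ≫ g₁.hom)
    (hR₁ : ∀ σ : Ω ≃ₐ[F] Ω, specMap (σ : Ω →+* Ω) ≫ (specMap (algebraMap M Ω) ≫ y₁) ≫ act U₁ (π σ) =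
      (specMap (algebraMap M Ω) ≫ y₁) ≫ (R₁ (π₁ σ)).hom)
    {Γ₂ : Type*} [Group Γ₂] [TopologicalSpace Γ₂] [DiscreteTopology Γ₂]
    (π₂ : (Ω ≃ₐ[F] Ω) →ₜ* Γ₂) {p₂ : U₂ ⟶ Y₂} {R₂ : Γ₂ → (U₂ ⟶ U₂)}
    {f₂ : Γ₂ × Γ₂ → invUnits U₂} {c₂ : StackBr Y₂}
    (hE₂ : IsEdgeClass p₂ R₂ (fun x => gmSection (f₂ x)) c₂) (g₂ : Y ⟶ Y₂)
    (y₂ : Spec (.of M) ⟶ U₂.V) (hy₂ : y₂ ≫ p₂.hom = y ≫ g₂.hom)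
    (hR₂ : ∀ σ : Ω ≃ₐ[F] Ω, specMap (σ : Ω →+* Ω) ≫ (specMap (algebraMap M Ω) ≫ y₂) ≫ act U₂ (π σ) =
      (specMap (algebraMap M Ω) ≫ y₂) ≫ (R₂ (π₂ σ)).hom)
    (hc : StackH.pullback g₁ c₁ = StackH.pullback g₂ c₂) :
    ∃ c : (Ω ≃ₐ[F] Ω) → Additive Ωˣ, IsLocallyConstant c ∧ ∀ σ τ,
      Additive.ofMul (evAt (specMap (algebraMap M Ω) ≫ y₁) (f₁ (π₁ σ, π₁ τ))) =
      Additive.ofMul (evAt (specMap (algebraMap M Ω) ≫ y₂) (f₂ (π₂ σ, π₂ τ))) +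
        (unitsRep (Ω ≃ₐ[F] Ω) Ω σ (c τ) - c (σ * τ) + c σ) := by
  -- One injective resolution for both edge classes.
  obtain ⟨T, _, _⟩ := exists_injective_twoStep (Gm G)
  obtain ⟨e₁, x₁, s₁, H₁, h₁, hs₁, hl₁⟩ :=
    hE₁.exists_isCochain_indPt π M T y π₁ g₁ y₁ hy₁ hR₁
  obtain ⟨e₂, x₂, s₂, H₂, h₂, hs₂, hl₂⟩ :=
    hE₂.exists_isCochain_indPt π M T y π₂ g₂ y₂ hy₂ hR₂
  obtain ⟨V', h', u, c, hΦ, hc', hf⟩ := TwoStep.IsCochain.exists_coboundary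
    (h := indMap (specMap (algebraMap M Ω))) (pV := indHom y) (indMap_indHom _ _)
    (fun σ => (galRight_indHom _ _ _).trans (congrArg indHom (hy σ)))
    (galRight_mul _) H₁ H₂ h₁ h₂ (hs₁.trans (hc.trans hs₂.symm))
    (fun V' h' => IsLocallyConstant fun σ => galRight π.toMonoidHom σ ≫ h')
    (exists_refinement π M)
  have : Mono T.i := T.hS.mono_f
  -- The map induced by `T.i` on sections is injective, so continuity can be tested in `I`, where
  -- the cochain is a combination of locally constant terms.
  have hcl : IsLocallyConstant c := by
    refine IsLocallyConstant.desc c (Sec.map T.i) ?_ (sec_map_injective T.i _)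
    have : IsLocallyConstant fun σ => e₁ σ - e₂ σ -
        (Sec.res (galRight π.toMonoidHom σ ≫ h') u - Sec.res h' u) :=
      (hl₁.sub hl₂).sub ((hΦ.comp fun m => Sec.res m u).sub (IsLocallyConstant.const _))
    convert this using 1
    exact funext hc'
  refine ⟨fun σ => secEv (c σ), hcl.comp secEv, fun σ τ => ?_⟩
  have h1 := congrArg secEv (hf σ τ)
  rw [secEv_sub, secEv_add, secEv_sub, secEv_res_galRight, gmSection_res, gmSection_res,
    secEv_gmSection, secEv_gmSection, ← evAt_comp_hom, ← evAt_comp_hom, indι_indHom,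
    indι_indHom, sub_eq_iff_eq_add'] at h1
  exact h1

end Galois

end GenericPoint

/-! ### The class at the generic point is inflated from G -/

noncomputable section EdgeComparison

open CategoryTheory AlgebraicGeometry Opposite Limits TensorProduct

lemma specMap_injective {A B : Type u} [CommRing A] [CommRing B] {f g : A →+* B}
    (h : specMap f = specMap g) : f = g :=
  congrArg CommRingCat.Hom.hom (Spec.map_injective h)

lemma specMap_surjective {A B : Type u} [CommRing A] [CommRing B]
    (m : Spec (.of B) ⟶ Spec (.of A)) : ∃ f : A →+* B, specMap f = m := by
  obtain ⟨f, hf⟩ := Spec.map_surjective m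
  exact ⟨f.hom, hf⟩

variable {G : Type u} [Group G]

/-- The point of an affine `G`-scheme given by a ring homomorphism. -/
def specPt {R W : Type u} [CommRing R] [CommRing W] (φ : G →* (R →+* R)) (μ : R →+* W) :
    Spec (.of W) ⟶ (specAction φ).V := specMap μ

section SpecPt

variable {R W : Type u} [CommRing R] [CommRing W] (φ : G →* (R →+* R)) (μ : R →+* W)

lemma specMap_specPt {W' : Type u} [CommRing W'] (f : W →+* W') :
    specMap f ≫ specPt φ μ = specPt φ (f.comp μ) := (specMap_comp μ f).symm

lemma specPt_act (g : G) : specPt φ μ ≫ act (specAction φ) g = specPt φ (μ.comp (φ g⁻¹)) :=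
  (specMap_comp (φ g⁻¹) μ).symm

lemma specPt_specActionMap {R' : Type u} [CommRing R'] {φ' : G →* (R' →+* R')} (f : R' →+* R)
    (hf : ∀ g, f.comp (φ' g) = (φ g).comp f) :
    specPt φ μ ≫ (specActionMap f hf).hom = specPt φ' (μ.comp f) := (specMap_comp f μ).symm

end SpecPt

lemma evAt_specPt_specUnit {R : Type u} [CommRing R] (φ : G →* (R →+* R)) (x : Rˣ)
    (hx : ∀ g, φ g (x : R) = x) {W : Type u} [Field W] (μ : R →+* W) :
    evAt (specPt φ μ) (specUnit φ x hx) = Units.map (μ : R →* W) x := by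
  refine Units.ext ?_
  have h := RingHom.congr_fun (congrArg CommRingCat.Hom.hom
    (Scheme.ΓSpecIso_naturality (CommRingCat.ofHom μ)))
      ((Scheme.ΓSpecIso (.of R)).inv.hom (x : R))
  refine Eq.trans h ?_
  exact congrArg μ (RingHom.congr_fun (congrArg CommRingCat.Hom.hom
    (Scheme.ΓSpecIso (.of R)).inv_hom_id) (x : R))

/-- Comparison of an edge class for the trivial torsor over `X` with an edge class for an affine
torsor over the spectrum of a field `K` mapping to `X`. -/
lemma exists_coboundary_of_generic [TopologicalSpace G] [DiscreteTopology G]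
    {F K Ω : Type u} [Field F] [Field K] [Field Ω] [Algebra F Ω] [IsAlgClosed Ω]
    [MulSemiringAction G K] (π : (Ω ≃ₐ[F] Ω) →ₜ* G) (j : K →+* Ω)
    (hπ : ∀ σ x, j (π σ • x) = σ (j x))
    {X : Action Scheme.{u} G} (η : specAction (ringAction G K) ⟶ X)
    {f₁ : G × G → invUnits (prodGroup X)} {b : StackBr X}
    (hb : IsEdgeClass (prodGroupFst X) (prodGroupRight X) (fun x => gmSection (f₁ x)) b)
    {A : Type u} [CommRing A] {φ : G →* (A →+* A)} {i : K →+* A}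
    {hi : ∀ g, i.comp (ringAction G K g) = (φ g).comp i}
    {Γ₂ : Type*} [Group Γ₂] [TopologicalSpace Γ₂] [DiscreteTopology Γ₂]
    (π₂ : (Ω ≃ₐ[F] Ω) →ₜ* Γ₂) {r : Γ₂ → A →+* A} {hr : ∀ γ g, (r γ).comp (φ g) = (φ g).comp (r γ)}
    {a : Γ₂ × Γ₂ → Aˣ} {ha : ∀ x g, φ g (a x : A) = a x}
    (hE : IsEdgeClass (specActionMap i hi) (fun γ => specActionMap (r γ) (hr γ))
      (fun x => gmSection (specUnit φ (a x) (ha x))) (StackH.pullback η b))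
    (M : IntermediateField F Ω) [FiniteDimensional F M] (m : A →+* M)
    (hj : ∀ x, (m (i x) : Ω) = j x)
    (hm : ∀ σ x, σ (m (φ (π σ)⁻¹ x) : Ω) = m (r (π₂ σ) x)) :
    ∃ c : (Ω ≃ₐ[F] Ω) → Additive Ωˣ, IsLocallyConstant c ∧ ∀ σ τ,
      Additive.ofMul (evAt (Z := prodGroup X) (specPt (ringAction G K) j ≫ η.hom ≫ sigmaι X 1)
        (f₁ (π σ, π τ))) =
      Additive.ofMul (Units.map ((algebraMap M Ω).comp m : A →* Ω) (a (π₂ σ, π₂ τ))) +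
        (unitsRep (Ω ≃ₐ[F] Ω) Ω σ (c τ) - c (σ * τ) + c σ) := by
  have hj' : (algebraMap M Ω).comp (m.comp i) = j := RingHom.ext hj
  -- The geometric point of `Spec K` is unchanged if `σ` acts on its coordinates and `π σ` on the
  -- scheme. On a torsor the combined action becomes the right translation, as required of `y₁` and
  -- `y₂`.
  have hact : ∀ σ : Ω ≃ₐ[F] Ω, specMap (σ : Ω →+* Ω) ≫ specPt (ringAction G K) j ≫
      act (specAction (ringAction G K)) (π σ) = specPt (ringAction G K) j := fun σ => by
    rw [specPt_act, specMap_specPt]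
    congr 1
    refine RingHom.ext fun x => ?_
    change σ (j ((π σ)⁻¹ • x)) = j x
    rw [← hπ, smul_inv_smul]
  have hpt : specMap (algebraMap M Ω) ≫ specPt (ringAction G K) (m.comp i) ≫ η.hom ≫ sigmaι X 1 =
      specPt (ringAction G K) j ≫ η.hom ≫ sigmaι X 1 := by
    rw [← Category.assoc, specMap_specPt, hj']
  obtain ⟨c, hc, hc'⟩ := exists_coboundary_of_isEdgeClass π M
    (specPt (ringAction G K) (m.comp i)) (fun σ => by rw [specMap_specPt, hj', hact])
    π hb η (U₁ := prodGroup X) (specPt (ringAction G K) (m.comp i) ≫ η.hom ≫ sigmaι X 1) (by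
      change (_ ≫ _ ≫ _) ≫ sigmaFst X = _
      rw [Category.assoc, Category.assoc, ι_sigmaFst, Category.comp_id]) (fun σ => by
      have h : specMap (σ : Ω →+* Ω) ≫ (specPt (ringAction G K) j ≫ η.hom ≫ sigmaι X 1) ≫
          sigmaAct X (π σ) =
          (specPt (ringAction G K) j ≫ η.hom ≫ sigmaι X 1) ≫ sigmaRight X (π σ) := by
        rw [Category.assoc, Category.assoc, Category.assoc, Category.assoc, ι_sigmaAct,
          ι_sigmaRight, mul_one, one_mul, ← Category.assoc η.hom, ← act_comm, Category.assoc,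
          ← Category.assoc (specPt _ j), ← Category.assoc (specMap _), hact]
      rw [← hpt] at h
      exact h)
    π₂ hE (𝟙 _) (specPt φ m) (by
      rw [specPt_specActionMap]
      exact (Category.comp_id _).symm) (fun σ => by
      rw [specMap_specPt, specPt_specActionMap, specPt_act, specMap_specPt]
      congr 1
      exact RingHom.ext fun x => hm σ x) (by
      rw [StackH.pullback, StackH.pullback]
      simp)
  refine ⟨c, hc, fun σ τ => ?_⟩
  have h := hc' σ τ
  rw [specMap_specPt, evAt_specPt_specUnit] at h
  rw [← h]
  exact congrArg (fun p => Additive.ofMul (evAt (Z := prodGroup X) p (f₁ (π σ, π τ)))) hpt.symm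

lemma tensor_ringHom_ext {F L K A : Type*} [Field F] [Field L] [Field K] [Algebra F L]
    [Algebra F K] [CommRing A] (f g : L ⊗[F] K →+* A)
    (hL : ∀ l, f (l ⊗ₜ 1) = g (l ⊗ₜ 1)) (hR : ∀ x, f (1 ⊗ₜ x) = g (1 ⊗ₜ x)) : f = g := by
  refine RingHom.ext fun t => ?_
  induction t using TensorProduct.induction_on with
  | zero => rw [map_zero, map_zero]
  | add a b ha hb => rw [map_add, map_add, ha, hb]
  | tmul l x =>
    have h : l ⊗ₜ[F] x = (l ⊗ₜ 1) * (1 ⊗ₜ x) := by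
      rw [Algebra.TensorProduct.tmul_mul_tmul, mul_one, one_mul]
    rw [h, map_mul, map_mul, hL, hR]

section Compositum

variable {F K Ω : Type*} [Field F] [Field K] [Field Ω] [Algebra F K] [Algebra K Ω] [Algebra F Ω]
  [IsScalarTower F K Ω] (L : IntermediateField F Ω)

/-- The compositum of `L` and `K` is a finite level at which the torsors of both cocycles have
points. -/
lemma exists_ringHom_compositum [FiniteDimensional F K] [FiniteDimensional F L] :
    ∃ (M : IntermediateField F Ω) (_ : FiniteDimensional F M) (m : L ⊗[F] K →+* M),
      (∀ l, (m (l ⊗ₜ 1) : Ω) = l) ∧ ∀ x, (m (1 ⊗ₜ x) : Ω) = algebraMap K Ω x := by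
  have : FiniteDimensional F (IsScalarTower.toAlgHom F K Ω).fieldRange :=
    LinearEquiv.finiteDimensional
      (AlgEquiv.ofInjectiveField (IsScalarTower.toAlgHom F K Ω)).toLinearEquiv
  let N : IntermediateField F Ω := L ⊔ (IsScalarTower.toAlgHom F K Ω).fieldRange
  let i : K →ₐ[F] N := (IsScalarTower.toAlgHom F K Ω).codRestrict N.toSubalgebra fun x =>
    (le_sup_right : _ ≤ L ⊔ (IsScalarTower.toAlgHom F K Ω).fieldRange) ⟨x, rfl⟩
  refine ⟨N, IntermediateField.finiteDimensional_sup _ _,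
    (Algebra.TensorProduct.productMap (IntermediateField.inclusion le_sup_left) i).toRingHom,
    fun l => ?_, fun x => ?_⟩
  · change ((Algebra.TensorProduct.productMap (IntermediateField.inclusion le_sup_left) i
      (l ⊗ₜ 1) : N) : Ω) = _
    rw [Algebra.TensorProduct.productMap_apply_tmul, map_one, mul_one]
    rfl
  · change ((Algebra.TensorProduct.productMap (IntermediateField.inclusion le_sup_left) i
      (1 ⊗ₜ x) : N) : Ω) = _
    rw [Algebra.TensorProduct.productMap_apply_tmul, map_one, one_mul]
    rfl

end Compositum

/-- Comparison of an edge class for the trivial torsor over `X` with the edge class given by a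
Galois cocycle. -/
lemma exists_coboundary_of_galois [TopologicalSpace G] [DiscreteTopology G]
    {F K Ω : Type u} [Field F] [Field K] [Field Ω] [Algebra K Ω] [Algebra F Ω]
    [IsAlgClosed Ω]
    [MulSemiringAction G K] (π : (Ω ≃ₐ[F] Ω) →ₜ* G)
    (hπ : ∀ σ x, algebraMap K Ω (π σ • x) = σ (algebraMap K Ω x))
    {X : Action Scheme.{u} G} (η : specAction (ringAction G K) ⟶ X)
    {f₁ : G × G → invUnits (prodGroup X)} {b : StackBr X}
    (hb : IsEdgeClass (prodGroupFst X) (prodGroupRight X) (fun x => gmSection (f₁ x)) b)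
    (L : IntermediateField F Ω) (hL : FiniteDimensional F L) (hN : Normal F L)
    {A : Type u} [CommRing A] (iL : L →+* A) {iR : K →+* A} {φ : G →* (A →+* A)}
    (hφL : ∀ g l, φ g (iL l) = iL l)
    {hφR : ∀ g, iR.comp (ringAction G K g) = (φ g).comp iR}
    {r : (L ≃ₐ[F] L) → A →+* A} (hrL : ∀ γ l, r γ (iL l) = iL (γ l))
    (hrR : ∀ γ x, r γ (iR x) = iR x) {hr : ∀ γ g, (r γ).comp (φ g) = (φ g).comp (r γ)}
    (hext : ∀ f g : A →+* Ω, f.comp iL = g.comp iL → f.comp iR = g.comp iR → f = g)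
    (hA : ∃ (M : IntermediateField F Ω) (_ : FiniteDimensional F M) (m : A →+* M),
      (∀ l, (m (iL l) : Ω) = l) ∧ ∀ x, (m (iR x) : Ω) = algebraMap K Ω x)
    {a : (L ≃ₐ[F] L) × (L ≃ₐ[F] L) → Lˣ}
    {ha : ∀ x g, φ g (Units.map (iL : L →* A) (a x) : A) = (Units.map (iL : L →* A) (a x) : A)}
    (hE : IsEdgeClass (specActionMap iR hφR) (fun γ => specActionMap (r γ) (hr γ))
      (fun x => gmSection (specUnit φ (Units.map (iL : L →* A) (a x)) (ha x)))
      (StackH.pullback η b)) :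
    ∃ c : (Ω ≃ₐ[F] Ω) → Additive Ωˣ, IsLocallyConstant c ∧ ∀ σ τ,
      Additive.ofMul (evAt (Z := prodGroup X)
        (specPt (ringAction G K) (algebraMap K Ω) ≫ η.hom ≫ sigmaι X 1) (f₁ (π σ, π τ))) =
      Additive.ofMul (Units.map (algebraMap L Ω : L →* Ω)
        (a (galRestrict Ω F L σ, galRestrict Ω F L τ))) +
        (unitsRep (Ω ≃ₐ[F] Ω) Ω σ (c τ) - c (σ * τ) + c σ) := by
  obtain ⟨M, _, m, hmL, hmR⟩ := hA
  obtain ⟨c, hc, hc'⟩ := exists_coboundary_of_generic π (algebraMap K Ω) hπ η hb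
    (galRestrict Ω F L) hE M m hmR (fun σ t => by
      -- The two homomorphisms are compared separately on `L`, where `φ` is trivial and `r` acts,
      -- and on `K`, where the roles are exchanged.
      have h : ((σ : Ω →+* Ω).comp ((algebraMap M Ω).comp m)).comp (φ (π σ)⁻¹) =
          ((algebraMap M Ω).comp m).comp (r (galRestrict Ω F L σ)) := by
        refine hext _ _ (RingHom.ext fun l => ?_) (RingHom.ext fun x => ?_)
        · change σ (m (φ (π σ)⁻¹ (iL l)) : Ω) = m (r (galRestrict Ω F L σ) (iL l))
          rw [hφL, hrL, hmL, hmL]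
          exact (AlgEquiv.restrictNormal_commutes σ L l).symm
        · have h1 := RingHom.congr_fun (hφR (π σ)⁻¹) x
          change iR ((π σ)⁻¹ • x) = φ (π σ)⁻¹ (iR x) at h1
          change σ (m (φ (π σ)⁻¹ (iR x)) : Ω) = m (r (galRestrict Ω F L σ) (iR x))
          rw [← h1, hrR, hmR, hmR, ← hπ, smul_inv_smul]
      exact RingHom.congr_fun h t)
  refine ⟨c, hc, fun σ τ => (hc' σ τ).trans ?_⟩
  congr 1
  exact congrArg Additive.ofMul (Units.ext (hmL _))

namespace GSurface

variable {k : Type u} [Field k] (S : GSurface k G)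

lemma exists_constants : ∃ f : k →+* S.K, specMap f = S.generic.hom ≫ S.str :=
  specMap_surjective _

/-- The embedding of the constants in the function field. -/
def kToK : k →+* S.K := S.exists_constants.choose

lemma specMap_kToK : specMap S.kToK = S.generic.hom ≫ S.str := S.exists_constants.choose_spec

lemma smul_kToK (g : G) (c : k) : g • S.kToK c = S.kToK c := by
  have h : specMap ((ringAction G S.K g).comp S.kToK) = specMap S.kToK := by
    rw [specMap_comp]
    have h1 : specMap (ringAction G S.K g) = act S.specK g⁻¹ := by
      conv_lhs => rw [← inv_inv g]
      rfl
    rw [h1, specMap_kToK]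
    change act S.specK g⁻¹ ≫ _ = _
    rw [← Category.assoc, act_comm, Category.assoc, S.act_str]
  exact RingHom.congr_fun (specMap_injective h) c

lemma evAt_const {W : Type u} [Field W] (μ : S.K →+* W) (c : kˣ) :
    evAt (Z := prodGroup S.X) (specPt (ringAction G S.K) μ ≫ S.generic.hom ≫ sigmaι S.X 1)
      (S.const c) =
      Units.map (μ.comp S.kToK : k →* W) c := by
  refine Units.ext ?_
  have h : (specPt (ringAction G S.K) μ ≫ S.generic.hom ≫ sigmaι S.X 1) ≫
      sigmaFst S.X ≫ S.str = specMap (μ.comp S.kToK) := by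
    rw [specMap_comp, specMap_kToK, Category.assoc]
    have h' : (S.generic.hom ≫ sigmaι S.X 1) ≫ sigmaFst S.X ≫ S.str = S.generic.hom ≫ S.str :=
      (Category.assoc _ _ _).trans (congrArg _ (ι_sigmaFst_assoc S.X 1 S.str))
    exact congrArg (specMap μ ≫ ·) h'
  have h1 := RingHom.congr_fun (congrArg CommRingCat.Hom.hom
    (Scheme.ΓSpecIso_naturality (CommRingCat.ofHom (μ.comp S.kToK))))
      ((Scheme.ΓSpecIso (.of k)).inv.hom (c : k))
  change (Scheme.ΓSpecIso (.of W)).hom.hom ((specMap (μ.comp S.kToK)).appTop.hom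
    ((Scheme.ΓSpecIso (.of k)).inv.hom (c : k))) = _ at h1
  rw [← h, Scheme.Hom.comp_appTop] at h1
  refine Eq.trans h1 ?_
  exact congrArg (μ.comp S.kToK) (RingHom.congr_fun (congrArg CommRingCat.Hom.hom
    (Scheme.ΓSpecIso (.of k)).inv_hom_id) (c : k))

/-- The map `H²(G, kˣ) → H²(G, k(X)ˣ)`. -/
def constH2 [TopologicalSpace G] :
    H2 (trivRep G (Additive kˣ)) →+ H2 (unitsRep G S.K) :=
  H2.map (ContinuousMonoidHom.id G) (Units.map (S.kToK : k →* S.K)).toAdditive fun g x =>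
    Additive.toMul.injective (Units.ext (S.smul_kToK g (x.toMul : k)).symm)

variable [Finite G] [TopologicalSpace G] [DiscreteTopology G]

set_option maxHeartbeats 1000000 in
/-- The restriction to the generic point of the image of `β` is the inflation of the image of `β`
in `H²(G, k(X)ˣ)`. -/
lemma eq_fixedInflation {β : H2 (trivRep G (Additive kˣ))} {b : StackBr S.X} (hb : S.IsImage β b)
    {α : Br S.KG S.Kbar} (hα : S.RestrictsTo b α) :
    fixedInflation S.Kbar G (S.constH2 β) = α := by
  obtain ⟨z, rfl, hz⟩ := hb
  obtain ⟨L, hL, hLG, a, rfl, ha⟩ := hα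
  have hN : Normal S.KG L := hLG.to_normal
  let iL : L →+* L ⊗[S.KG] S.K :=
    (Algebra.TensorProduct.includeLeft : L →ₐ[S.KG] L ⊗[S.KG] S.K).toRingHom
  let iR : S.K →+* L ⊗[S.KG] S.K :=
    (Algebra.TensorProduct.includeRight : S.K →ₐ[S.KG] L ⊗[S.KG] S.K).toRingHom
  have hext : ∀ f g : L ⊗[S.KG] S.K →+* S.Kbar, f.comp iL = g.comp iL → f.comp iR = g.comp iR →
      f = g :=
    fun f g hL hR => tensor_ringHom_ext f g (RingHom.congr_fun hL) (RingHom.congr_fun hR)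
  have hM := exists_ringHom_compositum (F := S.KG) (K := S.K) (Ω := S.Kbar) L
  have hφL : ∀ g l, S.tensorAction L g (iL l) = iL l := fun g l =>
    (Algebra.TensorProduct.map_tmul _ _ _ _).trans (by rw [map_one]; rfl)
  let r : (L ≃ₐ[S.KG] L) → L ⊗[S.KG] S.K →+* L ⊗[S.KG] S.K := fun γ =>
    (Algebra.TensorProduct.map (γ : L →ₐ[S.KG] L) (AlgHom.id S.KG S.K)).toRingHom
  have hrL : ∀ γ l, r γ (iL l) = iL (γ l) := fun γ l => Algebra.TensorProduct.map_tmul _ _ _ _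
  have hrR : ∀ γ x, r γ (iR x) = iR x := fun γ x =>
    (Algebra.TensorProduct.map_tmul _ _ _ _).trans (by rw [map_one]; rfl)
  -- The pull-back of `b` to the generic point is the edge class of both cocycles, so they become
  -- cohomologous in Galois cohomology.
  obtain ⟨c, hc, hc'⟩ := exists_coboundary_of_galois (F := S.KG) (galToGroup S.Kbar G)
    (galToGroup_smul S.Kbar G) S.generic hz L hL hN
    iL hφL hrL hrR hext hM ha
  rw [galInflation, H2.map_mk, fixedInflation, constH2, H2.map_mk, H2.map_mk]
  refine (H2.mk_eq_mk_iff _ _).2 ⟨c, hc, fun σ τ => ?_⟩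
  refine Eq.trans ?_ (hc' σ τ)
  rw [evAt_const]
  rfl

end GSurface

end EdgeComparison

/-! ### One-dimensional local rings of smooth algebras -/

section Regularity

open IsLocalRing

lemma eq_bot_or_eq_maximalIdeal {R : Type*} [CommRing R] [IsDomain R] [IsLocalRing R]
    (hR : ringKrullDim R = 1) (Q : Ideal R) [Q.IsPrime] : Q = ⊥ ∨ Q = maximalIdeal R := by
  refine or_iff_not_imp_right.2 fun h => ?_
  have h1 : Q < maximalIdeal R := lt_of_le_of_ne (le_maximalIdeal (Ideal.IsPrime.ne_top ‹_›)) h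
  have h2 := Ideal.height_add_one_le_of_lt_of_isPrime h1
  have h3 : (maximalIdeal R).height = 1 := by
    have := maximalIdeal_height_eq_ringKrullDim (R := R)
    rw [hR] at this
    exact_mod_cast this
  rw [h3] at h2
  rw [← Ideal.height_eq_zero_iff_eq_bot]
  exact nonpos_iff_eq_zero.1
    ((ENat.add_le_add_iff_right ENat.one_ne_top).1 (h2.trans_eq (zero_add 1).symm))

/-- A one-dimensional local domain that is a localization of an étale algebra over a factorial ring
is a discrete valuation ring. -/
lemma isDiscreteValuationRing_of_etale {A B R : Type*} [CommRing A] [IsDomain A]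
    [UniqueFactorizationMonoid A] [IsNoetherianRing A] [CommRing B] [Algebra A B] [Algebra.Etale A B]
    [CommRing R] [IsDomain R] [IsLocalRing R] [Algebra B R] (q : Ideal B) [q.IsPrime]
    [IsLocalization.AtPrime R q] (hR : ringKrullDim R = 1) : IsDiscreteValuationRing R := by
  let _ : Algebra A R := ((algebraMap B R).comp (algebraMap A B)).toAlgebra
  have : IsScalarTower A B R := .of_algebraMap_eq' rfl
  have : IsNoetherianRing B := Algebra.FiniteType.isNoetherianRing A B
  have : IsNoetherianRing R := IsLocalization.isNoetherianRing q.primeCompl R inferInstance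
  have : Module.Flat B R := IsLocalization.flat R q.primeCompl
  have : Module.Flat A R := Module.Flat.trans A B R
  have hfield : ¬ IsField R := fun h => by
    rw [ringKrullDim_eq_zero_of_isField h] at hR
    exact zero_ne_one hR
  let p : Ideal A := (maximalIdeal R).under A
  have hpprime : p.IsPrime := inferInstanceAs ((maximalIdeal R).under A).IsPrime
  have : (maximalIdeal R).LiesOver p := ⟨rfl⟩
  have hunit : ∀ y : p.primeCompl, IsUnit (algebraMap A R y) := fun y => by
    by_contra h
    exact y.2 ((mem_maximalIdeal _).2 h)
  let _ : Algebra (Localization.AtPrime p) R :=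
    (IsLocalization.lift (S := Localization.AtPrime p) hunit).toAlgebra
  have : IsScalarTower A (Localization.AtPrime p) R :=
    .of_algebraMap_eq fun x => (IsLocalization.lift_eq hunit x).symm
  have : Algebra.FormallyUnramified B R := .of_isLocalization q.primeCompl
  have : Algebra.FormallyUnramified A R := .comp A B R
  have : Algebra.FormallyUnramified (Localization.AtPrime p) R :=
    .of_restrictScalars A (Localization.AtPrime p) R
  have : Algebra.EssFiniteType B R := .of_isLocalization R q.primeCompl
  have : Algebra.EssFiniteType A R := .comp A B R
  have : Algebra.EssFiniteType (Localization.AtPrime p) R := .of_comp A (Localization.AtPrime p) R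
  have : IsLocalHom (algebraMap (Localization.AtPrime p) R) := by
    refine ((local_hom_TFAE (algebraMap (Localization.AtPrime p) R)).out 0 2).2 ?_
    rw [← IsLocalization.AtPrime.map_eq_maximalIdeal p (Localization.AtPrime p), Ideal.map_map,
      ← IsScalarTower.algebraMap_eq A (Localization.AtPrime p) R]
    exact Ideal.map_comap_le
  -- For an unramified local extension the maximal ideal is generated by that of the base.
  have hm : p.map (algebraMap A R) = maximalIdeal R := by
    rw [← Algebra.FormallyUnramified.map_maximalIdeal (R := Localization.AtPrime p) (S := R),
      ← IsLocalization.AtPrime.map_eq_maximalIdeal p (Localization.AtPrime p), Ideal.map_map,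
      ← IsScalarTower.algebraMap_eq A (Localization.AtPrime p) R]
  have hp0 : p ≠ ⊥ := fun h => by
    rw [h, Ideal.map_bot] at hm
    exact hfield (isField_iff_maximalIdeal_eq.2 hm.symm)
  obtain ⟨t, htp, ht⟩ := hpprime.exists_mem_prime_of_ne_bot hp0
  have htprime : (Ideal.span {t}).IsPrime := (Ideal.span_singleton_prime ht.ne_zero).2 ht
  -- Going down for the flat ring `R`: below its maximal ideal there is a prime over `(t)`. Flatness
  -- keeps `t` nonzero in `R`, so this prime is not zero and, the dimension being one, it is the
  -- maximal ideal. Hence `p = (t)` is principal.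
  obtain ⟨Q, hQ, hQprime, hQt⟩ := Ideal.exists_ideal_le_liesOver_of_le (maximalIdeal R) (q := p)
    (p := Ideal.span {t}) ((Ideal.span_singleton_le_iff_mem _).2 htp)
  have hQ' : Q = maximalIdeal R := by
    refine (eq_bot_or_eq_maximalIdeal hR Q).resolve_left fun h => ?_
    subst h
    have h1 : t ∈ (⊥ : Ideal R).under A := by
      rw [← hQt.over]
      exact Ideal.mem_span_singleton_self t
    have h2 : algebraMap A R t = 0 := h1
    have h3 : t • (1 : R) = t • (0 : R) := by rw [smul_zero, Algebra.smul_def, h2, zero_mul]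
    have h4 : IsSMulRegular R t := Module.Flat.isSMulRegular_of_nonZeroDivisors
      (mem_nonZeroDivisors_of_ne_zero ht.ne_zero)
    exact one_ne_zero (h4 h3)
  subst hQ'
  have hpt : p = Ideal.span {t} := hQt.over.symm
  have htfae : IsDiscreteValuationRing R ↔ (maximalIdeal R).IsPrincipal :=
    (IsDiscreteValuationRing.TFAE R hfield).out 0 4
  refine htfae.2 ⟨algebraMap A R t, ?_⟩
  rw [← hm, hpt, Ideal.map_span, Set.image_singleton]

/-- A one-dimensional local domain that is a localization of a standard smooth algebra over a
factorial ring is a discrete valuation ring. -/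
lemma isDiscreteValuationRing_of_isStandardSmooth {D B R : Type*} [CommRing D] [IsDomain D]
    [UniqueFactorizationMonoid D] [IsNoetherianRing D] [CommRing B] {n : ℕ} {f : D →+* B}
    (hf : f.IsStandardSmoothOfRelativeDimension n)
    [CommRing R] [IsDomain R] [IsLocalRing R] [Algebra B R] (q : Ideal B) [q.IsPrime]
    [IsLocalization.AtPrime R q] (hR : ringKrullDim R = 1) : IsDiscreteValuationRing R := by
  -- A standard smooth algebra is étale over a polynomial ring, which is again factorial and
  -- noetherian.
  obtain ⟨g, -, hg⟩ := hf.exists_etale_mvPolynomial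
  algebraize [g]
  exact isDiscreteValuationRing_of_etale (A := MvPolynomial (Fin n) D) q hR

end Regularity

/-! ### The normalized valuation of a discrete valuation ring -/

section NormalizedValuation

/-- The normalized valuation of a discrete valuation ring with fraction field `K`. -/
lemma exists_isNormVal {R K : Type*} [CommRing R] [IsDomain R] [IsDiscreteValuationRing R] [Field K]
    [Algebra R K] [IsFractionRing R K] :
    ∃ v : Additive Kˣ →+ ℤ, IsNormVal (algebraMap R K).range v := by
  let w := (IsDiscreteValuationRing.maximalIdeal R).valuation K
  have hw : ∀ x : Kˣ, w x ≠ 0 := fun x => (map_ne_zero _).2 x.ne_zero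
  -- The multiplicative valuation is at most 1 on `R`, whence the sign in front of the logarithm.
  refine ⟨AddMonoidHom.mk' (fun x => -(w (x.toMul : K)).log) fun a b => ?_, fun n => ?_, fun x => ?_⟩
  · rw [toMul_add, Units.val_mul, map_mul, WithZero.log_mul (hw _) (hw _), neg_add]
  · obtain ⟨y, hy⟩ := (IsDiscreteValuationRing.maximalIdeal R).valuation_surjective K
      (WithZero.exp (-n))
    have hy0 : y ≠ 0 := by
      rintro rfl
      rw [map_zero] at hy
      exact WithZero.exp_ne_zero hy.symm
    refine ⟨Additive.ofMul (Units.mk0 y hy0), ?_⟩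
    change -(w y).log = n
    rw [hy, WithZero.log_exp, neg_neg]
  · change _ ↔ 0 ≤ -(w x).log
    rw [neg_nonneg, ← WithZero.log_one, WithZero.log_le_log (hw x) one_ne_zero]
    constructor
    · rintro ⟨r, hr⟩
      rw [← hr]
      exact (IsDiscreteValuationRing.maximalIdeal R).valuation_le_one r
    · intro h
      obtain ⟨r, hr⟩ := IsDiscreteValuationRing.exists_lift_of_le_one h
      exact ⟨r, hr⟩

end NormalizedValuation

/-! ### The tame character and cyclicity of inertia -/

section Tame

variable {K κ H : Type*} [Field K] [Field κ] [Group H] [MulSemiringAction H K]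
  {O : Subring K} {red : O →+* κ}
  {v : Additive Kˣ →+ ℤ} (hv : IsNormVal O v) (hO : ∀ (h : H), ∀ x ∈ O, h • x ∈ O)

include hv hO in
lemma smul_div_mem (h : H) (y : Kˣ) : h • (y : K) / y ∈ O := by
  have h1 := normVal_smul O hO h (Additive.ofMul y)
  rw [hv.normVal_eq] at h1
  have h2 := (hv.2 ((unitsRep H K h (Additive.ofMul y)).toMul / y)).2 (by
    rw [ofMul_div, map_sub, ofMul_toMul, h1, sub_self])
  rw [Units.val_div_eq_div_val] at h2
  exact h2

/-- The reduction of `h y / y`, as a function of `y`. -/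
def smulDivHom (h : H) : Kˣ →* κ where
  toFun y := red ⟨h • (y : K) / y, smul_div_mem hv hO h y⟩
  map_one' := by
    rw [← map_one red]
    congr 1
    exact Subtype.ext (by simp)
  map_mul' a b := by
    rw [← map_mul]
    congr 1
    refine Subtype.ext ?_
    change h • ((a * b : Kˣ) : K) / ((a * b : Kˣ) : K) = h • (a : K) / a * (h • (b : K) / b)
    rw [Units.val_mul, smul_mul', mul_div_mul_comm]

lemma smulDivHom_apply (h : H) (y : Kˣ) :
    smulDivHom (red := red) hv hO h y = red ⟨h • (y : K) / y, smul_div_mem hv hO h y⟩ := rfl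

variable [MulSemiringAction H κ]
  (hequiv : ∀ (h : H) (x : O), red ⟨h • (x : K), hO h x x.2⟩ = h • red x)

include hequiv in
lemma red_smul (n : (MulSemiringAction.toRingAut H κ).ker) (x : O) :
    red ⟨(n : H) • (x : K), hO n x x.2⟩ = red x := by
  rw [hequiv]
  exact RingEquiv.congr_fun n.2 (red x)

/-- The tame character of the inertia group. -/
def tameHom (y : Kˣ) : (MulSemiringAction.toRingAut H κ).ker →* κ where
  toFun n := smulDivHom (red := red) hv hO (n : H) y
  map_one' := by
    rw [smulDivHom_apply, ← map_one red]
    congr 1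
    exact Subtype.ext (by simp)
  -- Multiplicativity follows from `(mn)y / y = (my / y) * m (ny / y)`, where the outer `m` does not
  -- affect the residue.
  map_mul' m n := by
    rw [smulDivHom_apply, smulDivHom_apply, smulDivHom_apply,
      ← red_smul hO hequiv m ⟨_, smul_div_mem hv hO n y⟩, ← map_mul]
    congr 1
    refine Subtype.ext ?_
    change ((m * n : (MulSemiringAction.toRingAut H κ).ker) : H) • (y : K) / y =
      (m : H) • (y : K) / y * ((m : H) • ((n : H) • (y : K) / y))
    have h0 : (m : H) • (y : K) ≠ 0 := (smul_ne_zero_iff_ne _).2 y.ne_zero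
    rw [smul_div₀', Subgroup.coe_mul, mul_smul]
    field_simp

include hequiv in
-- An inertia element fixes the residue of a unit, so its character on units is trivial. Any `y` is
-- a unit times a power of the uniformizer `t`.
lemma smulDivHom_eq_one {t : Kˣ} (ht : v (Additive.ofMul t) = 1)
    (n : (MulSemiringAction.toRingAut H κ).ker) (hn : smulDivHom (red := red) hv hO (n : H) t = 1)
    (y : Kˣ) : smulDivHom (red := red) hv hO (n : H) y = 1 := by
  have key : ∀ u : Kˣ, v (Additive.ofMul u) = 0 → smulDivHom (red := red) hv hO (n : H) u = 1 := by
    intro u hu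
    have hu1 : (u : K) ∈ O := (hv.2 u).2 hu.ge
    have hu2 : ((u⁻¹ : Kˣ) : K) ∈ O := (hv.2 u⁻¹).2 (by rw [ofMul_inv, map_neg, hu, neg_zero])
    have hu3 : red ⟨u, hu1⟩ ≠ 0 := fun h => by
      have : red (⟨u, hu1⟩ * ⟨_, hu2⟩) = 1 := by
        rw [← map_one red]
        congr 1
        exact Subtype.ext (Units.mul_inv u)
      rw [map_mul, h, zero_mul] at this
      exact zero_ne_one this
    refine mul_right_cancel₀ hu3 ?_
    rw [one_mul, smulDivHom_apply, ← map_mul, ← red_smul hO hequiv n ⟨u, hu1⟩]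
    congr 1
    exact Subtype.ext (div_mul_cancel₀ _ u.ne_zero)
  have hy : y = y * t ^ (-v (Additive.ofMul y)) * t ^ v (Additive.ofMul y) := by
    rw [zpow_neg, inv_mul_cancel_right]
  rw [hy, map_mul, map_zpow, hn, one_zpow, mul_one]
  apply key
  rw [ofMul_mul, ofMul_zpow, map_add, map_zsmul, ht]
  simp

include hv hequiv in
/-- In residue characteristic zero the inertia group is cyclic. -/
lemma isCyclic_inertia [Finite H] [FaithfulSMul H K] [CharZero κ] :
    IsCyclic (MulSemiringAction.toRingAut H κ).ker := by
  obtain ⟨t, ht⟩ := hv.1 1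
  refine isCyclic_of_injective_ringHom (tameHom (red := red) hv hO hequiv t.toMul)
    ((injective_iff_map_eq_one _).2 fun n hn => ?_)
  by_contra hne
  -- Suppose that `n` is in the kernel of the tame character and moves `x`, and put `y = nx - x`.
  -- The sum of `n ^ j y` over a period telescopes to zero. Divided by `y` it reduces to the order
  -- of `n`, which is nonzero in characteristic zero.
  obtain ⟨x, hx⟩ : ∃ x : K, (n : H) • x ≠ x := by
    by_contra! h
    refine hne (Subtype.ext (eq_of_smul_eq_smul (α := K) fun x => ?_))
    rw [h x]
    exact (one_smul H x).symm
  let y : Kˣ := Units.mk0 ((n : H) • x - x) (sub_ne_zero.2 hx)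
  have h1 : ∀ j : ℕ, red ⟨((n : H) ^ j) • (y : K) / y, smul_div_mem hv hO _ y⟩ = 1 := fun j => by
    have := smulDivHom_eq_one hv hO hequiv (t := t.toMul) ht (n ^ j) (by
      change tameHom hv hO hequiv t.toMul (n ^ j) = 1
      rw [map_pow, hn, one_pow]) y
    exact this
  have h2 : ∑ j ∈ Finset.range (orderOf (n : H)), ((n : H) ^ j) • (y : K) = 0 := by
    have : ∀ j, ((n : H) ^ j) • (y : K) = (n : H) ^ (j + 1) • x - (n : H) ^ j • x := fun j => by
      change ((n : H) ^ j) • ((n : H) • x - x) = _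
      rw [smul_sub, ← mul_smul, pow_succ]
    simp_rw [this]
    rw [Finset.sum_range_sub (fun j => (n : H) ^ j • x), pow_orderOf_eq_one, pow_zero, sub_self]
  have h3 : ∑ j ∈ Finset.range (orderOf (n : H)),
      (⟨((n : H) ^ j) • (y : K) / y, smul_div_mem hv hO _ y⟩ : O) = 0 := by
    refine Subtype.ext ?_
    rw [AddSubmonoidClass.coe_finsetSum]
    change ∑ j ∈ Finset.range (orderOf (n : H)), ((n : H) ^ j) • (y : K) / y = 0
    rw [← Finset.sum_div, h2, zero_div]
  have h4 := congrArg red h3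
  rw [map_sum, map_zero, Finset.sum_congr rfl fun j _ => h1 j, Finset.sum_const, Finset.card_range,
    nsmul_one, Nat.cast_eq_zero] at h4
  exact (orderOf_pos (n : H)).ne' h4

end Tame

/-! ### The local ring at a point of codimension one and its stabilizer -/

noncomputable section CodimensionOne

open CategoryTheory AlgebraicGeometry Opposite Limits

lemma isDominant_specMap {A B : Type u} [CommRing A] [CommRing B] {f : A →+* B}
    (hf : Function.Injective f) : IsDominant (specMap f) :=
  ⟨(PrimeSpectrum.denseRange_comap_iff_ker_le_nilRadical f).2 (by
    rw [(RingHom.injective_iff_ker_eq_bot f).1 hf]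
    exact bot_le)⟩

/-- Separatedness is what allows morphisms to `X` to be compared at the generic point in
`act_inv_specializes`. -/
lemma IsProjectiveOver.isSeparated {k : Type u} [Field k] {X : Scheme.{u}} {s : X ⟶ Spec (.of k)}
    (h : IsProjectiveOver s) : X.IsSeparated := by
  obtain ⟨n, i, hi, -⟩ := h
  constructor
  have h1 : i ≫ terminal.from _ = terminal.from X := terminal.hom_ext _ _
  rw [← h1]
  infer_instance

/-- The local ring at a point of codimension one of a smooth scheme over a field is a discrete
valuation ring. -/
lemma isDiscreteValuationRing_stalk {k : Type u} [Field k] {X : Scheme.{u}} [IsIntegral X]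
    (s : X ⟶ Spec (.of k)) {n : ℕ} [SmoothOfRelativeDimension n s] (ξ : X)
    (hξ : Order.coheight ξ = 1) : IsDiscreteValuationRing (X.presheaf.stalk ξ) := by
  obtain ⟨U, hU, V, hV, hξV, e, hf⟩ :=
    SmoothOfRelativeDimension.exists_isStandardSmoothOfRelativeDimension (n := n) (f := s) ξ
  have hUtop : U = ⊤ := by
    refine top_unique fun y _ => ?_
    have h1 : s ξ ∈ U := e hξV
    have : Subsingleton (PrimeSpectrum k) := inferInstance
    have h2 : y = s ξ := Subsingleton.elim (α := PrimeSpectrum k) _ _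
    rw [h2]
    exact h1
  subst hUtop
  let ε : k ≃+* Γ(Spec (.of k), ⊤) := (Scheme.ΓSpecIso (.of k)).commRingCatIsoToRingEquiv.symm
  have : IsDomain Γ(Spec (.of k), ⊤) := ε.symm.toMulEquiv.isDomain k
  have : UniqueFactorizationMonoid Γ(Spec (.of k), ⊤) :=
    ε.toMulEquiv.uniqueFactorizationMonoid inferInstance
  have : IsNoetherianRing Γ(Spec (.of k), ⊤) := isNoetherianRing_of_ringEquiv k ε
  have hdim : ringKrullDim (X.presheaf.stalk ξ) = 1 := by
    rw [ringKrullDim_stalk_eq_coheight, hξ]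
    rfl
  let _ : Algebra Γ(X, V) (X.presheaf.stalk ξ) := X.presheaf.algebra_section_stalk ⟨ξ, hξV⟩
  have : IsLocalization.AtPrime (X.presheaf.stalk ξ) (hV.primeIdealOf ⟨ξ, hξV⟩).asIdeal :=
    hV.isLocalization_stalk ⟨ξ, hξV⟩
  exact isDiscreteValuationRing_of_isStandardSmooth hf (hV.primeIdealOf ⟨ξ, hξV⟩).asIdeal hdim

namespace GSurface

variable {k G : Type u} [Field k] [Group G] (S : GSurface k G)

instance isSeparated : S.X.V.IsSeparated := S.projective.isSeparated

variable (ξ : S.X.V)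

lemma exists_isNormVal (hξ : Order.coheight ξ = 1) :
    ∃ v : Additive S.Kˣ →+ ℤ, IsNormVal (S.O ξ) v := by
  have := S.smooth
  have := isDiscreteValuationRing_stalk (n := 2) S.str ξ hξ
  exact BrauerResidue.exists_isNormVal (R := S.X.V.presheaf.stalk ξ) (K := S.X.V.functionField)

/-- The local ring at `ξ` is isomorphic to its image in the function field. -/
def stalkEquiv : S.X.V.presheaf.stalk ξ ≃+* S.O ξ :=
  RingEquiv.ofBijective (S.toK ξ).rangeRestrict
    ⟨fun _ _ h => S.toK_injective ξ (congrArg Subtype.val h), (S.toK ξ).rangeRestrict_surjective⟩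

lemma coe_stalkEquiv (s : S.X.V.presheaf.stalk ξ) : (S.stalkEquiv ξ s : S.K) = S.toK ξ s := rfl

/-- The reduction map. -/
def red : S.O ξ →+* S.κ ξ :=
  (IsLocalRing.residue (S.X.V.presheaf.stalk ξ)).comp (S.stalkEquiv ξ).symm.toRingHom

lemma red_stalkEquiv (s : S.X.V.presheaf.stalk ξ) :
    S.red ξ (S.stalkEquiv ξ s) = IsLocalRing.residue _ s :=
  congrArg (IsLocalRing.residue _) ((S.stalkEquiv ξ).symm_apply_apply s)

lemma reduction_eq_red (F : Subfield S.K) (hF : F ≤ S.KD ξ) (x : (S.O ξ).comap F.subtype) :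
    (S.reduction ξ F hF x : S.κ ξ) = S.red ξ ⟨x.1, x.2⟩ := rfl

lemma red_smul (d : S.D ξ) (x : S.O ξ) :
    S.red ξ ⟨d • (x : S.K), S.smul_mem_O ξ d x x.2⟩ = d • S.red ξ x := by
  obtain ⟨s, rfl⟩ := (S.stalkEquiv ξ).surjective x
  have h : (⟨d • ((S.stalkEquiv ξ s : S.O ξ) : S.K), S.smul_mem_O ξ d _ (S.stalkEquiv ξ s).2⟩ :
      S.O ξ) = S.stalkEquiv ξ (d • s) := Subtype.ext (S.toK_smul ξ d s).symm
  rw [h, red_stalkEquiv, red_stalkEquiv, IsLocalRing.ResidueField.residue_smul]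

lemma isReduction {v : Additive S.Kˣ →+ ℤ} (hv : IsNormVal (S.O ξ) v) :
    IsReduction (S.O ξ) (S.red ξ) where
  mem_or_inv_mem := hv.mem_or_inv_mem
  surjective := IsLocalRing.residue_surjective.comp (S.stalkEquiv ξ).symm.surjective
  eq_zero_iff x := by
    obtain ⟨s, rfl⟩ := (S.stalkEquiv ξ).surjective x
    rw [red_stalkEquiv, IsLocalRing.residue_eq_zero_iff, IsLocalRing.mem_maximalIdeal,
      mem_nonunits_iff, coe_stalkEquiv, ← not_iff_not, not_not, not_or, not_not]
    constructor
    · intro h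
      obtain ⟨t, ht⟩ := isUnit_iff_exists_inv.1 h
      have h1 : S.toK ξ s * S.toK ξ t = 1 := by rw [← map_mul, ht, map_one]
      exact ⟨left_ne_zero_of_mul_eq_one h1, t, eq_inv_of_mul_eq_one_right h1⟩
    · rintro ⟨h0, t, ht⟩
      refine isUnit_iff_exists_inv.2 ⟨t, S.toK_injective ξ ?_⟩
      rw [map_mul, ht, map_one, mul_inv_cancel₀ h0]

/-- An element of `G` preserving the local ring maps `ξ` to a generization. -/
lemma act_inv_specializes (g : G) (hg : ∀ x ∈ S.O ξ, g • x ∈ S.O ξ) : act S.X g⁻¹ ξ ⤳ ξ := by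
  let ρ : S.X.V.presheaf.stalk ξ →+* S.X.V.presheaf.stalk ξ :=
    (S.stalkEquiv ξ).symm.toRingHom.comp (((ringAction G S.K g).comp (S.toK ξ)).codRestrict (S.O ξ)
      fun s => hg _ ⟨s, rfl⟩)
  have hρ : (S.toK ξ).comp ρ = (ringAction G S.K g).comp (S.toK ξ) := RingHom.ext fun s =>
    congrArg Subtype.val ((S.stalkEquiv ξ).apply_symm_apply ⟨g • S.toK ξ s, hg _ ⟨s, rfl⟩⟩)
  have hgen : specMap (S.toK ξ) ≫ S.X.V.fromSpecStalk ξ = S.generic.hom :=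
    Scheme.SpecMap_stalkSpecializes_fromSpecStalk (genericPoint_specializes ξ)
  have hdom : IsDominant (specMap (S.toK ξ)) := isDominant_specMap (S.toK_injective ξ)
  -- The two morphisms agree on `Spec k(X)`, which is dominant in the spectrum of the local ring,
  -- and `X` is separated.
  have h : specMap ρ ≫ S.X.V.fromSpecStalk ξ = S.X.V.fromSpecStalk ξ ≫ act S.X g⁻¹ := by
    refine ext_of_isDominant (specMap (S.toK ξ)) ?_
    have h1 : specMap (ringAction G S.K g) = act S.specK g⁻¹ := by
      conv_lhs => rw [← inv_inv g]
      rfl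
    have h2 : specMap (ringAction G S.K g) ≫ S.generic.hom = S.generic.hom ≫ act S.X g⁻¹ :=
      (congrArg (· ≫ S.generic.hom) h1).trans (act_comm S.generic g⁻¹)
    rw [← hgen] at h2
    rw [← Category.assoc, ← specMap_comp, hρ, specMap_comp, Category.assoc]
    exact h2.trans (Category.assoc _ _ _)
  -- The closed point goes to the translate of `ξ` on one side and into the image of the spectrum of
  -- the local ring, that is to a generization of `ξ`, on the other.
  have h1 : S.X.V.fromSpecStalk ξ (specMap ρ (IsLocalRing.closedPoint _)) =
      act S.X g⁻¹ (S.X.V.fromSpecStalk ξ (IsLocalRing.closedPoint _)) :=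
    congrArg (fun m : Spec (S.X.V.presheaf.stalk ξ) ⟶ S.X.V => m (IsLocalRing.closedPoint _)) h
  rw [Scheme.fromSpecStalk_closedPoint] at h1
  rw [← h1]
  have h2 : S.X.V.fromSpecStalk ξ (specMap ρ (IsLocalRing.closedPoint _)) ∈
    Set.range (S.X.V.fromSpecStalk ξ) := ⟨_, rfl⟩
  rw [Scheme.range_fromSpecStalk] at h2
  exact h2

/-- As `G` is finite, `g⁻¹` is a power of `g` and preserves the local ring as well. Then `ξ` and its
translate by `g` specialize to each other and coincide. -/
lemma mem_D [Finite G] (g : G) (hg : ∀ x ∈ S.O ξ, g • x ∈ S.O ξ) : g ∈ S.D ξ := by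
  have hpow : ∀ n : ℕ, ∀ x ∈ S.O ξ, g ^ n • x ∈ S.O ξ := fun n => by
    induction n with
    | zero => intro x hx; rwa [pow_zero, one_smul]
    | succ n ih => intro x hx; rw [pow_succ, mul_smul]; exact ih _ (hg x hx)
  have hinv : ∀ x ∈ S.O ξ, g⁻¹ • x ∈ S.O ξ := fun x hx => by
    obtain ⟨n, hn⟩ := (mem_powers_iff_mem_zpowers).2 ((Subgroup.zpowers g).inv_mem
      (Subgroup.mem_zpowers g))
    rw [← hn]
    exact hpow n x hx
  have h1 := S.act_inv_specializes ξ g hg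
  have h2 := S.act_inv_specializes ξ g⁻¹ hinv
  rw [inv_inv] at h2
  have h3 := h1.map (act S.X g).continuous
  have h4 : act S.X g (act S.X g⁻¹ ξ) = ξ := by
    rw [← Scheme.Hom.comp_apply, ← act_mul, mul_inv_cancel, act_one]
    rfl
  rw [h4] at h3
  exact (h2.antisymm h3).eq

end GSurface

end CodimensionOne

/-! ### Restriction of Brauer classes between fixed fields -/

noncomputable section Restriction

variable {K Ω : Type*} [Field K] [Field Ω] [Algebra K Ω] [Algebra.IsAlgebraic K Ω]

lemma brRes_refl {F : Subfield K} [Algebra.IsAlgebraic F K] (α : Br F Ω) :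
    brRes (le_refl F) α = α := by
  obtain ⟨z, rfl⟩ := H2.mk_surjective _ α
  rfl

variable (Ω) in
lemma isGalois_of_isAlgClosed [IsAlgClosed Ω] [CharZero K] (F : Subfield K)
    [Algebra.IsAlgebraic F K] : IsGalois F Ω := by
  have : Algebra.IsAlgebraic F Ω := Algebra.IsAlgebraic.trans F K Ω
  have : IsAlgClosure F Ω := ⟨inferInstance, inferInstance⟩
  have : CharZero F := inferInstance
  infer_instance

/-- In characteristic zero `Ω` is Galois over `F`, so the Galois group is compact and the connecting
homomorphism is bijective. -/
lemma existsUnique_bockstein_eq [IsAlgClosed Ω] [CharZero K] (F : Subfield K)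
    [Algebra.IsAlgebraic F K] (x : H2 (trivRep (Ω ≃ₐ[F] Ω) ℤ)) : ∃! r, bockstein r = x := by
  have := isGalois_of_isAlgClosed Ω F
  obtain ⟨r, hr⟩ := bockstein_surjective x
  exact ⟨r, hr, fun r' hr' => bockstein_injective (hr'.trans hr.symm)⟩

variable {H : Type*} [Group H] [Finite H] [TopologicalSpace H] [MulSemiringAction H K]
  [FaithfulSMul H K] (D : Subgroup H)

lemma galToGroup_galIncl (h : FixedPoints.subfield H K ≤ FixedPoints.subfield D K)
    (σ : Ω ≃ₐ[FixedPoints.subfield D K] Ω) :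
    galToGroup Ω H (galIncl h σ) = (galToGroup Ω D σ : H) :=
  eq_of_smul_eq_smul (α := K) fun x => (algebraMap K Ω).injective
    ((galToGroup_smul Ω H (galIncl h σ) x).trans (galToGroup_smul Ω D σ x).symm)

/-- The inflation map commutes with restriction. -/
lemma brRes_fixedInflation (h : FixedPoints.subfield H K ≤ FixedPoints.subfield D K)
    (x : H2 (unitsRep H K)) :
    brRes h (fixedInflation Ω H x) = fixedInflation Ω D
      (H2.map (ρ' := unitsRep D K) ⟨D.subtype, continuous_subtype_val⟩ (AddMonoidHom.id _)
        (fun _ _ => rfl) x) := by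
  obtain ⟨z, rfl⟩ := H2.mk_surjective _ x
  refine congrArg (H2.mk _) (Subtype.ext (funext fun p => ?_))
  change unitsMap (algebraMap K Ω) (z.1 (galToGroup Ω H (galIncl h p.1),
    galToGroup Ω H (galIncl h p.2))) = unitsMap (algebraMap K Ω)
      (z.1 ((galToGroup Ω D p.1 : H), (galToGroup Ω D p.2 : H)))
  rw [galToGroup_galIncl, galToGroup_galIncl]

end Restriction

/-! ### The lift to the quotient by inertia, and the main theorem -/

noncomputable section Final

open CategoryTheory AlgebraicGeometry

lemma exists_nsmul_eq {k : Type*} [Field k] [IsAlgClosed k] (n : ℕ) (hn : n ≠ 0)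
    (x : Additive kˣ) : ∃ y, n • y = x := by
  obtain ⟨y, hy⟩ := IsAlgClosed.exists_pow_nat_eq (x.toMul : k) (Nat.pos_of_ne_zero hn)
  have hy0 : y ≠ 0 := by
    rintro rfl
    rw [zero_pow hn] at hy
    exact x.toMul.ne_zero hy.symm
  exact ⟨Additive.ofMul (Units.mk0 y hy0), Additive.toMul.injective (Units.ext hy)⟩

namespace GSurface

variable {k G : Type u} [Field k] [Group G] (S : GSurface k G)

instance [CharZero k] : CharZero S.K := charZero_of_injective_ringHom S.kToK.injective

instance [CharZero k] (ξ : S.X.V) : CharZero (S.κ ξ) := by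
  obtain ⟨j, -⟩ := specMap_surjective (A := k) (B := S.X.V.presheaf.stalk ξ)
    (S.X.V.fromSpecStalk ξ ≫ S.str)
  exact charZero_of_injective_ringHom
    ((IsLocalRing.residue (S.X.V.presheaf.stalk ξ)).comp j).injective

variable [Finite G] (ξ : S.X.V)

/-- This supplies the hypothesis `hstab` of `isResidue_iff` over k(X)^G. Over k(X)^{D_ξ} it holds by
`exists_eq_smul`, without any condition on the local ring. -/
lemma exists_mem_D (h : S.K ≃ₐ[S.KG] S.K) (hh : ∀ x ∈ S.O ξ, h x ∈ S.O ξ) :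
    ∃ d : S.D ξ, ∀ x, h x = d • x := by
  obtain ⟨g, rfl⟩ := FixedPoints.toAlgAut_surjective G S.K h
  exact ⟨⟨g, S.mem_D ξ g hh⟩, fun x => rfl⟩

lemma exists_eq_smul (h : S.K ≃ₐ[S.KD ξ] S.K) : ∃ d : S.D ξ, ∀ x, h x = d • x := by
  obtain ⟨d, rfl⟩ := FixedPoints.toAlgAut_surjective (S.D ξ) S.K h
  exact ⟨d, fun x => rfl⟩

/-- The restriction of the image of `β` to the decomposition group is inflated from the quotient by
the inertia group. -/
lemma exists_inflation_eq_brRes [TopologicalSpace G] [DiscreteTopology G] [IsAlgClosed k]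
    [CharZero k] (hξ : Order.coheight ξ = 1)
    (β : H2 (trivRep G (Additive kˣ))) :
    ∃ γ : H2 (unitsRep (S.D ξ ⧸ S.I ξ) (FixedPoints.subfield (S.I ξ) S.K)),
      fixedInflation S.Kbar (S.D ξ) (inflation (S.I ξ) γ) =
        brRes (S.fixed_le ξ) (fixedInflation S.Kbar G (S.constH2 β)) := by
  obtain ⟨v, hv⟩ := S.exists_isNormVal ξ hξ
  have : IsCyclic (S.I ξ) := isCyclic_inertia hv (S.smul_mem_O ξ) (S.red_smul ξ)
  obtain ⟨z, rfl⟩ := H2.mk_surjective _ β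
  -- Triviality on the inertia group already holds with coefficients in kˣ, on which the group acts
  -- trivially and which is divisible.
  obtain ⟨c, hc⟩ := exists_coboundary_of_isCyclic (I := S.I ξ) exists_nsmul_eq
    (fun p => z.1 ((p.1 : S.D ξ), (p.2 : S.D ξ))) fun g h j => z.2.2 _ _ _
  let f : Z2 (unitsRep (S.D ξ) S.K) :=
    Z2.map (ρ' := unitsRep (S.D ξ) S.K) ⟨(S.D ξ).subtype, continuous_subtype_val⟩
      (AddMonoidHom.id _) (fun _ _ => rfl)
      (Z2.map (ρ := trivRep G (Additive kˣ)) (ρ' := unitsRep G S.K) (ContinuousMonoidHom.id G)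
        (Units.map (S.kToK : k →* S.K)).toAdditive
        (fun g x => Additive.toMul.injective (Units.ext (S.smul_kToK g (x.toMul : k)).symm)) z)
  have hf : ∀ m n : S.I ξ, f.1 (m, n) =
      unitsRep (S.D ξ) S.K m (unitsMap S.kToK (c n)) - unitsMap S.kToK (c (m * n)) +
        unitsMap S.kToK (c m) := fun m n => by
    have h1 : unitsRep (S.D ξ) S.K m (unitsMap S.kToK (c n)) = unitsMap S.kToK (c n) :=
      Additive.toMul.injective (Units.ext (S.smul_kToK ((m : S.D ξ) : G) ((c n).toMul : k)))
    rw [h1, ← map_sub, ← map_add, ← hc]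
    rfl
  obtain ⟨γ, hγ⟩ := exists_inflation_eq (S.I ξ) f _ hf
  refine ⟨γ, ?_⟩
  rw [hγ, brRes_fixedInflation]
  rfl

end GSurface

end Final

end BrauerResidue

/-- The first conjunct turns the relation `IsResidue` into a function of `α`, so that the
equivalences that follow are equalities of residues. -/
theorem mainTheorem3 {k G : Type u} [Field k] [IsAlgClosed k] [CharZero k] [Group G] [Finite G]
    [TopologicalSpace G] [DiscreteTopology G] (S : GSurface k G)
    (β : H2 (trivRep G (Additive kˣ))) (b : StackBr S.X) (hb : S.IsImage β b)
    (α : Br S.KG S.Kbar) (hα : S.RestrictsTo b α) (ξ : S.X.V) (hξ : Order.coheight ξ = 1) :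
    (∃! r : H1QZ (S.κbar ξ ≃ₐ[S.κD ξ] S.κbar ξ),
      IsResidue (S.reduction ξ S.KG (S.fixed_le ξ)) α r) ∧
    (∀ r : H1QZ (S.κbar ξ ≃ₐ[S.κD ξ] S.κbar ξ),
      IsResidue (S.reduction ξ S.KG (S.fixed_le ξ)) α r ↔
        IsResidue (S.reduction ξ (S.KD ξ) le_rfl) (brRes (S.fixed_le ξ) α) r) ∧
    (∃ γ : H2 (unitsRep (S.D ξ ⧸ S.I ξ) (FixedPoints.subfield (S.I ξ) S.K)),
      fixedInflation S.Kbar (S.D ξ) (inflation (S.I ξ) γ) = brRes (S.fixed_le ξ) α) ∧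
    (∀ γ : H2 (unitsRep (S.D ξ ⧸ S.I ξ) (FixedPoints.subfield (S.I ξ) S.K)),
      fixedInflation S.Kbar (S.D ξ) (inflation (S.I ξ) γ) = brRes (S.fixed_le ξ) α →
      ∀ r : H1QZ (S.κbar ξ ≃ₐ[S.κD ξ] S.κbar ξ),
        IsResidue (S.reduction ξ S.KG (S.fixed_le ξ)) α r ↔
          bockstein r = H2.map (galToQuot (S.κbar ξ) (S.D ξ)) (AddMonoidHom.id ℤ) (fun _ _ => rfl)
            (fixedValH2 (S.I ξ) (S.O ξ) (S.smul_mem_O ξ) γ)) := by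
  have := isGalois_of_isAlgClosed S.Kbar S.KG
  have := isGalois_of_isAlgClosed S.Kbar (S.KD ξ)
  obtain ⟨v, hv⟩ := S.exists_isNormVal ξ hξ
  have hα' := S.eq_fixedInflation hb hα
  have key : ∀ γ : H2 (unitsRep (S.D ξ ⧸ S.I ξ) (FixedPoints.subfield (S.I ξ) S.K)),
      fixedInflation S.Kbar (S.D ξ) (inflation (S.I ξ) γ) = brRes (S.fixed_le ξ) α →
      ∀ r : H1QZ (S.κbar ξ ≃ₐ[S.κD ξ] S.κbar ξ),
        IsResidue (S.reduction ξ S.KG (S.fixed_le ξ)) α r ↔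
          bockstein r = H2.map (galToQuot (S.κbar ξ) (S.D ξ)) (AddMonoidHom.id ℤ) (fun _ _ => rfl)
            (fixedValH2 (S.I ξ) (S.O ξ) (S.smul_mem_O ξ) γ) := fun γ hγ r =>
    isResidue_iff (S.isReduction ξ hv) hv (S.smul_mem_O ξ) (S.red_smul ξ) (S.fixed_le ξ)
      (S.exists_mem_D ξ) (S.reduction_eq_red ξ _ _) α γ hγ r
  have keyD : ∀ γ : H2 (unitsRep (S.D ξ ⧸ S.I ξ) (FixedPoints.subfield (S.I ξ) S.K)),
      fixedInflation S.Kbar (S.D ξ) (inflation (S.I ξ) γ) = brRes (S.fixed_le ξ) α →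
      ∀ r : H1QZ (S.κbar ξ ≃ₐ[S.κD ξ] S.κbar ξ),
        IsResidue (S.reduction ξ (S.KD ξ) le_rfl) (brRes (S.fixed_le ξ) α) r ↔
          bockstein r = H2.map (galToQuot (S.κbar ξ) (S.D ξ)) (AddMonoidHom.id ℤ) (fun _ _ => rfl)
            (fixedValH2 (S.I ξ) (S.O ξ) (S.smul_mem_O ξ) γ) := fun γ hγ r =>
    isResidue_iff (S.isReduction ξ hv) hv (S.smul_mem_O ξ) (S.red_smul ξ) le_rfl
      (fun h _ => S.exists_eq_smul ξ h) (S.reduction_eq_red ξ _ _) _ γ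
      (hγ.trans (brRes_refl _).symm) r
  obtain ⟨γ, hγ⟩ : ∃ γ : H2 (unitsRep (S.D ξ ⧸ S.I ξ) (FixedPoints.subfield (S.I ξ) S.K)),
      fixedInflation S.Kbar (S.D ξ) (inflation (S.I ξ) γ) = brRes (S.fixed_le ξ) α :=
    hα' ▸ S.exists_inflation_eq_brRes ξ hξ β
  -- The same expression in `γ` computes the residue over both fields, which yields (i); the
  -- existence of `γ` is (ii), and `key` is (iii).
  refine ⟨?_, fun r => (key γ hγ r).trans (keyD γ hγ r).symm, ⟨γ, hγ⟩, key⟩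
  obtain ⟨r, hr, hr'⟩ := existsUnique_bockstein_eq (S.κD ξ)
    (H2.map (galToQuot (S.κbar ξ) (S.D ξ)) (AddMonoidHom.id ℤ) (fun _ _ => rfl)
      (fixedValH2 (S.I ξ) (S.O ξ) (S.smul_mem_O ξ) γ))
  exact ⟨r, (key γ hγ r).2 hr, fun r' h => hr' r' ((key γ hγ r').1 h)⟩
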